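/- Let $k$ be a field of characteristic zero, $A$ a commutative $k$-algebra, $I$ a free $A$-module of finite rank, and $0\to I\to B\xrightarrow{\pi}A\to 0$ an extension of commutative $k$-algebras with $I^2=0$, split by a $k$-algebra morphism $\sigma\colon A\to B$. Complexes are graded homologically and unadorned tensor products are over $A$. For a complex $K$ of $B$-modules put $\overline K=K\otimes_BA$, let $\mathrm{Tor}^1_B(K,A)$ be the complex of $A$-modules obtained by applying the first left derived functor of $-\otimes_BA$ termwise, and let $\mu_K\colon I\otimes\overline K\to K$ be the multiplication map. The complex $K$ is called admissible if the complex $\mathrm{Tor}^1_B(K,A)$ is acyclic. Let $\mathrm D^{\mathrm{adm}}(B)$ be the localization of the homotopy category $\mathrm K^-(B)$ with respect to the null system of those complexes $K$ for which both $\overline K$ and $\mathrm{Tor}^1_B(K,A)$ are exact; $K\mapsto\overline K$ induces a functor $\mathrm D^{\mathrm{adm}}(B)\to\mathrm D^-(A)$. Viewing $K$ as a complex of $A$-modules via $\sigma$, the local HKR class $\theta_K\colon\overline K\to\mathrm{Tor}^1_B(K,A)[2]$ is the morphism in the derived category of $A$ associated with the exact sequence $$0\to\mathrm{Tor}^1_B(K,A)\to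 I\otimes\overline K\xrightarrow{\mu_K}K\to\overline K\to0 .$$ Let $N$ be an integer and let $K$ be a bounded complex of $B$-modules concentrated in homological degrees $\ge N$. Then the following are equivalent: (i) $\theta_K=0$. (ii) The canonical morphism $K\otimes^{\mathbf L}_BA\to K\otimes_BA$ admits a right inverse in $\mathrm D^-(A)$. (iii) There exist a bounded admissible complex $V$ of $B$-modules concentrated in degrees $\ge N$ and a morphism $V\to K$ in $\mathrm D^{\mathrm b}(B)$ such that the composite $V\otimes^{\mathbf L}_BA\to K\otimes^{\mathbf L}_BA\to K\otimes_BA$ is an isomorphism in $\mathrm D^-(A)$. (iv) There exist a bounded admissible complex $V$ of $B$-modules concentrated in degrees $\ge N$ and a morphism $V\to K$ in $\mathrm D^{\mathrm{adm}}(B)$ such that the induced morphism $\overline V\to\overline K$ is an isomorphism in $\mathrm D^{\mathrm b}(A)$. (v) There exist a bounded admissible complex $V$ of $B$-modules concentrated in degrees $\ge N$ and a subcomplex $T$ of $I\otimes\overline V$ such that $K$ is isomorphic in $\mathrm D^{\mathrm{adm}}(B)$ to $V/T$, the quotient of $V$ by $\mu_V(T)$. If these conditions hold, then in $\mathrm D^-(A)$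 $$K\otimes^{\mathbf L}_BA\;\simeq\;K\otimes_BA\,\oplus\,\bigl(\mathrm{Tor}^1_B(K,A)\otimes^{\mathbf L}_BA\bigr)[1]\;\simeq\;K\otimes_BA\,\oplus\,\bigoplus_{p\ge0}I^{\otimes p}\otimes\mathrm{Tor}^1_B(K,A)[p+1],$$ where in the middle term $\mathrm{Tor}^1_B(K,A)$ is regarded as a complex of $B$-modules via $\pi$. -/

import Mathlib

universe w w' v u

open CategoryTheory Limits Opposite

/-- A split extension `0 ⟶ I ⟶ B ⟶ A ⟶ 0` of the `k`-algebra `A` by the square zero ideal `I`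
(`incl` identifies the `A`-module `I` with the kernel of `proj`, on which `B` acts through `proj`,
so that `I ^ 2 = 0`), together with a splitting `sect`. -/
structure SplitSqZeroExtension (k : Type v) (A I B : Type u) [Field k] [CommRing A] [Algebra k A]
    [AddCommGroup I] [Module A I] [CommRing B] [Algebra k B] where
  incl : I →+ B
  proj : B →ₐ[k] A
  sect : A →ₐ[k] B
  incl_injective : Function.Injective incl
  proj_eq_zero_iff : ∀ b : B, proj b = 0 ↔ ∃ i : I, incl i = b
  mul_incl : ∀ (b : B) (i : I), b * incl i = incl (proj b • i)
  proj_sect : ∀ a : A, proj (sect a) = a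

namespace SplitSqZeroExtension

variable {k : Type v} {A I B : Type u} [Field k] [CommRing A] [Algebra k A]
  [AddCommGroup I] [Module A I] [CommRing B] [Algebra k B] (E : SplitSqZeroExtension k A I B)

/-- `M ↦ M ⊗_B A`. -/
noncomputable abbrev baseChange : ModuleCat.{u} B ⥤ ModuleCat.{u} A :=
  ModuleCat.extendScalars.{u, u, u} E.proj.toRingHom

/-- Restriction of scalars along the splitting `A ⟶ B`. -/
noncomputable abbrev viaSect : ModuleCat.{u} B ⥤ ModuleCat.{u} A :=
  ModuleCat.restrictScalars.{u} E.sect.toRingHom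

/-- Restriction of scalars along the projection `B ⟶ A`. -/
noncomputable abbrev viaProj : ModuleCat.{u} A ⥤ ModuleCat.{u} B :=
  ModuleCat.restrictScalars.{u} E.proj.toRingHom

/-- `M ↦ I ⊗_A (M ⊗_B A)`. -/
noncomputable abbrev idealTensor : ModuleCat.{u} B ⥤ ModuleCat.{u} A :=
  E.baseChange ⋙ MonoidalCategory.tensorLeft (ModuleCat.of A I)

open ChangeOfRings

/-- The `A`-linear map `M ⟶ M ⊗_B A`, `v ↦ 1 ⊗ v`. -/
noncomputable def toBaseChange : E.viaSect ⟶ E.baseChange where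
  app V := ModuleCat.ofHom (X := E.viaSect.obj V) (Y := E.baseChange.obj V)
    { toFun := fun v => (1 : A) ⊗ₜ[B, E.proj.toRingHom] (v : V)
      map_add' := fun v w =>
        map_add (ModuleCat.ExtendRestrictScalarsAdj.Unit.map E.proj.toRingHom (X := V)).hom v w
      map_smul' := fun a v => by
        refine (map_smul (ModuleCat.ExtendRestrictScalarsAdj.Unit.map E.proj.toRingHom
          (X := V)).hom (E.sect a) v).trans ?_
        change (E.proj (E.sect a)) •
          (show E.baseChange.obj V from (1 : A) ⊗ₜ[B, E.proj.toRingHom] (v : V)) = _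
        rw [E.proj_sect]
        rfl }
  naturality V W f := rfl

/-- `v ↦ (i ↦ i v)` -/
noncomputable def actionAux (V : ModuleCat.{u} B) :
    V ⟶ E.viaProj.obj (ModuleCat.of A (I →ₗ[A] E.viaSect.obj V)) :=
  ModuleCat.ofHom (Y := E.viaProj.obj (ModuleCat.of A (I →ₗ[A] E.viaSect.obj V)))
    { toFun := fun v =>
        { toFun := fun i => (E.incl i • v : V)
          map_add' := fun i j => by rw [map_add, add_smul]; rfl
          map_smul' := fun a i => by
            change E.incl (a • i) • v = E.sect a • E.incl i • v
            rw [← mul_smul, E.mul_incl, E.proj_sect] }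
      map_add' := fun v w => LinearMap.ext fun i => smul_add (E.incl i) v w
      map_smul' := fun b v => LinearMap.ext fun i => by
        change E.incl i • b • v = E.sect (E.proj b) • E.incl i • v
        rw [← mul_smul, ← mul_smul, E.mul_incl, E.proj_sect, ← E.mul_incl, mul_comm] }

/-- `M ⊗_B A ⟶ Hom_A(I, M)`, induced by `v ↦ (i ↦ i v)`. -/
noncomputable def actionHom (V : ModuleCat.{u} B) :
    E.baseChange.obj V →ₗ[A] I →ₗ[A] E.viaSect.obj V :=
  (ModuleCat.ExtendRestrictScalarsAdj.HomEquiv.fromExtendScalars E.proj.toRingHom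
    (E.actionAux V)).hom

lemma toBaseChange_surjective (V : ModuleCat.{u} B) :
    Function.Surjective (E.toBaseChange.app V).hom := by
  refine (ModuleCat.epi_iff_surjective (E.toBaseChange.app V)).1 ⟨fun g h w => ?_⟩
  exact ModuleCat.ExtendScalars.hom_ext fun v => congr($w v)

lemma actionHom_toBaseChange (V : ModuleCat.{u} B) (v : V) (i : I) :
    E.actionHom V ((E.toBaseChange.app V).hom v) i = (E.incl i • v : V) := by
  change E.sect 1 • E.incl i • v = _
  rw [map_one, one_smul]

/-- The multiplication map `I ⊗_A (M ⊗_B A) ⟶ M`, `i ⊗ (1 ⊗ v) ↦ i v`. -/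
noncomputable def mul : E.idealTensor ⟶ E.viaSect where
  app V := ModuleCat.ofHom (X := E.idealTensor.obj V) (Y := E.viaSect.obj V)
    (TensorProduct.lift (E.actionHom V).flip)
  naturality V W f := by
    refine ModuleCat.hom_ext (TensorProduct.ext' fun (i : I) (x : E.baseChange.obj V) => ?_)
    obtain ⟨v, rfl⟩ := E.toBaseChange_surjective V x
    refine (E.actionHom_toBaseChange W (f.hom v) i).trans ?_
    refine (map_smul f.hom (E.incl i) v).symm.trans ?_
    exact (congr_arg f.hom (E.actionHom_toBaseChange V v i)).symm

lemma mul_smul_eq (V : ModuleCat.{u} B) (b : B) (x : E.idealTensor.obj V) :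
    (E.mul.app V).hom (E.proj b • x) = (b • (show V from (E.mul.app V).hom x) : V) := by
  induction x using TensorProduct.induction_on with
  | zero =>
    rw [smul_zero, map_zero]; exact (smul_zero (A := V) b).symm
  | add x y hx hy =>
    rw [smul_add, map_add, map_add, hx, hy]
    exact (smul_add (A := V) b _ _).symm
  | tmul i x =>
    obtain ⟨v, rfl⟩ := E.toBaseChange_surjective V x
    refine (E.actionHom_toBaseChange V v (E.proj b • i)).trans ?_
    rw [← E.mul_incl]
    refine (mul_smul (β := V) b (E.incl i) v).trans ?_
    exact (congr_arg (fun w : V => b • w) (E.actionHom_toBaseChange V v i)).symm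

/-- The multiplication map, which is `B`-linear if `B` acts on the source through `A`. -/
noncomputable def mulB : E.idealTensor ⋙ E.viaProj ⟶ 𝟭 (ModuleCat.{u} B) where
  app V := ModuleCat.ofHom (X := E.viaProj.obj (E.idealTensor.obj V)) (Y := V)
    { toFun := fun x => (E.mul.app V).hom x
      map_add' := fun x y => map_add (E.mul.app V).hom x y
      map_smul' := fun b x => E.mul_smul_eq V b x }
  naturality V W f := by
    ext x
    exact congr($(E.mul.naturality f) x)

instance : E.baseChange.Additive :=
  (ModuleCat.extendRestrictScalarsAdj.{u, u, u} E.proj.toRingHom).left_adjoint_additive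
instance : E.idealTensor.Additive := inferInstance
instance : PreservesFiniteColimits E.baseChange := inferInstance
instance : PreservesFiniteColimits E.idealTensor := inferInstance
instance : PreservesFiniteLimits E.viaSect := inferInstance
instance : PreservesFiniteColimits E.viaSect := inferInstance

lemma incl_smul_mem_range (V : ModuleCat.{u} B) (i : I) (v : V) :
    ∃ x, (E.mulB.app V).hom x = E.incl i • v :=
  ⟨i ⊗ₜ[A] (E.toBaseChange.app V).hom v, E.actionHom_toBaseChange V v i⟩

lemma toBaseChange_smul (V : ModuleCat.{u} B) (b : B) (v : V) :
    (E.toBaseChange.app V).hom (b • v : V) = E.proj b • (E.toBaseChange.app V).hom v :=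
  map_smul (ModuleCat.ExtendRestrictScalarsAdj.Unit.map E.proj.toRingHom (X := V)).hom b v

lemma mul_comp_toBaseChange : E.mul ≫ E.toBaseChange = 0 := by
  ext V : 2
  refine ModuleCat.hom_ext (TensorProduct.ext' fun (i : I) (x : E.baseChange.obj V) => ?_)
  obtain ⟨v, rfl⟩ := E.toBaseChange_surjective V x
  refine (congr_arg (E.toBaseChange.app V).hom (E.actionHom_toBaseChange V v i)).trans ?_
  refine (E.toBaseChange_smul V _ v).trans ?_
  rw [(E.proj_eq_zero_iff _).2 ⟨i, rfl⟩, zero_smul]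
  rfl

lemma mul_toBaseChange_exact (V : ModuleCat.{u} B) :
    Function.Exact (E.mul.app V).hom (E.toBaseChange.app V).hom := by
  intro v
  constructor
  · intro hv
    let N : Submodule B V := LinearMap.range (E.mulB.app V).hom
    let q : V ⟶ E.viaProj.obj (E.viaSect.obj (ModuleCat.of B (V ⧸ N))) :=
      ModuleCat.ofHom (Y := E.viaProj.obj (E.viaSect.obj (ModuleCat.of B (V ⧸ N))))
        { toFun := fun v => N.mkQ v
          map_add' := fun v w => map_add N.mkQ v w
          map_smul' := fun b v => by
            change N.mkQ (b • v) = E.sect (E.proj b) • N.mkQ v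
            rw [← map_smul, ← sub_eq_zero, ← map_sub, ← sub_smul]
            obtain ⟨i, hi⟩ := (E.proj_eq_zero_iff (b - E.sect (E.proj b))).1
              (by rw [map_sub, E.proj_sect, sub_self])
            rw [← hi]
            exact (Submodule.Quotient.mk_eq_zero N).2 (E.incl_smul_mem_range V i v) }
    let r := ModuleCat.ExtendRestrictScalarsAdj.HomEquiv.fromExtendScalars E.proj.toRingHom q
    have h : (E.toBaseChange.app V ≫ r).hom v = N.mkQ v := by
      change E.sect 1 • N.mkQ v = N.mkQ v
      rw [map_one, one_smul]
    have h' : N.mkQ v = 0 := h.symm.trans ((congr_arg r.hom hv).trans (map_zero r.hom))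
    exact (Submodule.Quotient.mk_eq_zero N).1 h'
  · rintro ⟨x, rfl⟩
    exact congr($(congr_app E.mul_comp_toBaseChange V) x)

lemma mul_injective (P : ModuleCat.{u} B) [Projective P] :
    Function.Injective (E.mul.app P).hom := by
  have hP : Module.Projective B P := (IsProjective.iff_projective P).2 inferInstance
  let I' : ModuleCat.{u} B := E.viaProj.obj (ModuleCat.of A I)
  let ιB : I' →ₗ[B] B :=
    { toFun := fun i => E.incl i
      map_add' := fun i j => map_add E.incl i j
      map_smul' := fun b i => (E.mul_incl b i).symm }
  have hι : Function.Injective (LinearMap.rTensor P ιB) :=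
    Module.Flat.rTensor_preserves_injective_linearMap ιB E.incl_injective
  let ψ : TensorProduct B I' P →ₗ[B] E.viaProj.obj (E.idealTensor.obj P) :=
    TensorProduct.lift (LinearMap.mk₂ B
      (fun (i : I) (p : P) => i ⊗ₜ[A] (E.toBaseChange.app P).hom p)
      (fun i j p => TensorProduct.add_tmul _ _ _)
      (fun b i p => (TensorProduct.smul_tmul' (M := I) (E.proj b) i
        ((E.toBaseChange.app P).hom p)).symm)
      (fun i p q => (congr_arg (fun x => (show I from i) ⊗ₜ[A] x)
        (map_add (E.toBaseChange.app P).hom p q)).trans (TensorProduct.tmul_add (M := I) _ _ _))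
      (fun b i p => (congr_arg (fun x => (show I from i) ⊗ₜ[A] x)
        (E.toBaseChange_smul P b p)).trans (TensorProduct.tmul_smul (M := I) (E.proj b) _ _)))
  have hψ : Function.Surjective ψ := by
    intro x
    induction x using TensorProduct.induction_on with
    | zero => exact ⟨0, map_zero _⟩
    | add x y hx hy =>
      obtain ⟨v, rfl⟩ := hx
      obtain ⟨w, rfl⟩ := hy
      exact ⟨v + w, map_add _ v w⟩
    | tmul i x =>
      obtain ⟨v, rfl⟩ := E.toBaseChange_surjective P x
      exact ⟨(show I' from i) ⊗ₜ[B] v, rfl⟩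
  have hcomp : ∀ y, (E.mulB.app P).hom (ψ y) =
      TensorProduct.lid B P (LinearMap.rTensor P ιB y) := by
    intro y
    induction y using TensorProduct.induction_on with
    | zero => simp
    | add x y hx hy => rw [map_add, map_add, hx, hy, map_add, map_add]
    | tmul i p => exact E.actionHom_toBaseChange P p i
  refine (injective_iff_map_eq_zero (E.mul.app P).hom).2 fun x hx => ?_
  obtain ⟨y, rfl⟩ := hψ x
  have hy := (hcomp y).symm.trans hx
  have hy' : y = 0 := hι (((TensorProduct.lid B P).injective (hy.trans (map_zero _).symm)).trans
    (map_zero _).symm)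
  rw [hy']
  exact map_zero ψ

end SplitSqZeroExtension



namespace LeftDerivedOne

section

variable {C D : Type*} [Category* C] [Category* D] [Abelian C] [Abelian D]

/-- The canonical map `H₀(G P) ⟶ G V` for a projective resolution `P ⟶ V`. -/
noncomputable def homologyZeroTo {V : C} (P : ProjectiveResolution V) (G : C ⥤ D) [G.Additive] :
    ((G.mapHomologicalComplex (ComplexShape.down ℕ)).obj P.complex).homology 0 ⟶ G.obj V :=
  (ChainComplex.isoHomologyι₀ _).hom ≫ P.fromLeftDerivedZero' G

lemma homologyZeroTo_naturality {V W : C} (f : V ⟶ W) (P : ProjectiveResolution V)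
    (Q : ProjectiveResolution W) (φ : P.complex ⟶ Q.complex)
    (comm : φ.f 0 ≫ Q.π.f 0 = P.π.f 0 ≫ f) (G : C ⥤ D) [G.Additive] :
    HomologicalComplex.homologyMap ((G.mapHomologicalComplex _).map φ) 0 ≫ homologyZeroTo Q G =
      homologyZeroTo P G ≫ G.map f := by
  simp only [homologyZeroTo, Category.assoc]
  rw [← ProjectiveResolution.fromLeftDerivedZero'_naturality f P Q φ comm G]
  simp

lemma homologyZeroTo_natTrans {V : C} (P : ProjectiveResolution V) {G H : C ⥤ D}
    [G.Additive] [H.Additive] (α : G ⟶ H) :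
    HomologicalComplex.homologyMap
      ((NatTrans.mapHomologicalComplex α (ComplexShape.down ℕ)).app P.complex) 0 ≫
        homologyZeroTo P H = homologyZeroTo P G ≫ α.app V := by
  simp only [homologyZeroTo, Category.assoc]
  have : HomologicalComplex.opcyclesMap
      ((NatTrans.mapHomologicalComplex α (ComplexShape.down ℕ)).app P.complex) 0 ≫
      P.fromLeftDerivedZero' H = P.fromLeftDerivedZero' G ≫ α.app V := by
    rw [← cancel_epi (HomologicalComplex.pOpcycles _ _)]
    simp only [HomologicalComplex.p_opcyclesMap_assoc,
      ProjectiveResolution.pOpcycles_comp_fromLeftDerivedZero',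
      ProjectiveResolution.pOpcycles_comp_fromLeftDerivedZero'_assoc,
      NatTrans.mapHomologicalComplex_app_f]
    exact (α.naturality _).symm
  rw [← this]
  simp

instance {V : C} (P : ProjectiveResolution V) (G : C ⥤ D) [G.Additive]
    [PreservesFiniteColimits G] : IsIso (homologyZeroTo P G) := by
  unfold homologyZeroTo
  infer_instance

variable {J S F : C ⥤ D} [J.Additive] [S.Additive] [F.Additive]
  (μ : J ⟶ S) (ε : S ⟶ F) (w : μ ≫ ε = 0)

noncomputable abbrev resolutionSequence (P : ChainComplex C ℕ) :
    ShortComplex (ChainComplex D ℕ) :=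
  ShortComplex.mk ((NatTrans.mapHomologicalComplex μ (ComplexShape.down ℕ)).app P)
    ((NatTrans.mapHomologicalComplex ε (ComplexShape.down ℕ)).app P) (by
      ext n
      exact congr_app w (P.X n))

lemma resolutionSequence_shortExact
    (h : ∀ (P : C) [Projective P],
      (ShortComplex.mk (μ.app P) (ε.app P) (congr_app w P)).ShortExact)
    {V : C} (P : ProjectiveResolution V) :
    (resolutionSequence μ ε w P.complex).ShortExact :=
  HomologicalComplex.shortExact_of_degreewise_shortExact _ fun n => h (P.complex.X n)

noncomputable def resolutionδ
    (h : ∀ (P : C) [Projective P],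
      (ShortComplex.mk (μ.app P) (ε.app P) (congr_app w P)).ShortExact)
    {V : C} (P : ProjectiveResolution V) :
    ((F.mapHomologicalComplex (ComplexShape.down ℕ)).obj P.complex).homology 1 ⟶
      ((J.mapHomologicalComplex (ComplexShape.down ℕ)).obj P.complex).homology 0 :=
  (resolutionSequence_shortExact μ ε w h P).δ 1 0 (by simp)

lemma resolutionδ_naturality
    (h : ∀ (P : C) [Projective P],
      (ShortComplex.mk (μ.app P) (ε.app P) (congr_app w P)).ShortExact)
    {V W : C} (P : ProjectiveResolution V) (Q : ProjectiveResolution W)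
    (φ : P.complex ⟶ Q.complex) :
    HomologicalComplex.homologyMap ((F.mapHomologicalComplex _).map φ) 1 ≫
      resolutionδ μ ε w h Q = resolutionδ μ ε w h P ≫
        HomologicalComplex.homologyMap ((J.mapHomologicalComplex _).map φ) 0 :=
  (HomologicalComplex.HomologySequence.δ_naturality
    (S₁ := resolutionSequence μ ε w P.complex) (S₂ := resolutionSequence μ ε w Q.complex)
    { τ₁ := (J.mapHomologicalComplex _).map φ
      τ₂ := (S.mapHomologicalComplex _).map φ
      τ₃ := (F.mapHomologicalComplex _).map φ }
    (resolutionSequence_shortExact μ ε w h P)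
    (resolutionSequence_shortExact μ ε w h Q) 1 0 (by simp)).symm

noncomputable def leftDerivedOneIso [HasProjectiveResolutions C]
    {V : C} (P : ProjectiveResolution V) (F : C ⥤ D) [F.Additive] :
    (F.leftDerived 1).obj V ≅
      ((F.mapHomologicalComplex (ComplexShape.down ℕ)).obj P.complex).homology 1 :=
  P.isoLeftDerivedObj F 1

lemma leftDerivedOneIso_naturality [HasProjectiveResolutions C]
    {V W : C} (f : V ⟶ W) (P : ProjectiveResolution V)
    (Q : ProjectiveResolution W) (φ : P.complex ⟶ Q.complex)
    (comm : φ.f 0 ≫ Q.π.f 0 = P.π.f 0 ≫ f) (F : C ⥤ D) [F.Additive] :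
    (F.leftDerived 1).map f ≫ (leftDerivedOneIso Q F).hom =
      (leftDerivedOneIso P F).hom ≫
        HomologicalComplex.homologyMap ((F.mapHomologicalComplex _).map φ) 1 :=
  ProjectiveResolution.isoLeftDerivedObj_hom_naturality f P Q φ comm F 1

/-- The natural transformation `L₁F ⟶ J` attached to natural transformations `J ⟶ S ⟶ F` which are
short exact on projective objects: the connecting morphism `H₁(F P) ⟶ H₀(J P)` for a projective
resolution `P ⟶ V`, followed by `H₀(J P) ⟶ J V`. -/
noncomputable def connecting [HasProjectiveResolutions C]
    (h : ∀ (P : C) [Projective P],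
      (ShortComplex.mk (μ.app P) (ε.app P) (congr_app w P)).ShortExact) :
    F.leftDerived 1 ⟶ J where
  app V := (leftDerivedOneIso (projectiveResolution V) F).hom ≫
    resolutionδ μ ε w h (projectiveResolution V) ≫ homologyZeroTo (projectiveResolution V) J
  naturality V W f := by
    let φ := ProjectiveResolution.lift f (projectiveResolution V) (projectiveResolution W)
    have comm : φ.f 0 ≫ (projectiveResolution W).π.f 0 = (projectiveResolution V).π.f 0 ≫ f := by
      have := congr_arg (fun g => g.f 0) (ProjectiveResolution.lift_commutes f
        (projectiveResolution V) (projectiveResolution W))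
      refine this.trans ?_
      rw [HomologicalComplex.comp_f, ChainComplex.single₀_map_f_zero]
      rfl
    have h₁ := leftDerivedOneIso_naturality f _ _ φ comm F
    have h₂ := resolutionδ_naturality μ ε w h (projectiveResolution V) (projectiveResolution W) φ
    have h₃ := homologyZeroTo_naturality f _ _ φ comm J
    rw [Category.assoc, Category.assoc, ← h₃, reassoc_of% h₁, reassoc_of% h₂]

lemma connecting_mono [HasProjectiveResolutions C] [PreservesFiniteLimits S]
    [PreservesFiniteColimits S] [PreservesFiniteColimits J]
    (h : ∀ (P : C) [Projective P],
      (ShortComplex.mk (μ.app P) (ε.app P) (congr_app w P)).ShortExact) (V : C) :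
    Mono ((connecting μ ε w h).app V) := by
  have : Mono (resolutionδ μ ε w h (projectiveResolution V)) := by
    refine (resolutionSequence_shortExact μ ε w h (projectiveResolution V)).mono_δ 1 0 (by simp) ?_
    rw [← HomologicalComplex.exactAt_iff_isZero_homology]
    exact ((projectiveResolution V).complex_exactAt_succ 0).map S
  dsimp only [connecting]
  infer_instance

lemma connecting_comp [HasProjectiveResolutions C]
    (h : ∀ (P : C) [Projective P],
      (ShortComplex.mk (μ.app P) (ε.app P) (congr_app w P)).ShortExact) (V : C) :
    (connecting μ ε w h).app V ≫ μ.app V = 0 := by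
  dsimp only [connecting]
  rw [Category.assoc, Category.assoc, ← homologyZeroTo_natTrans]
  have : resolutionδ μ ε w h (projectiveResolution V) ≫ HomologicalComplex.homologyMap
      ((NatTrans.mapHomologicalComplex μ (ComplexShape.down ℕ)).app _) 0 = 0 :=
    (resolutionSequence_shortExact μ ε w h (projectiveResolution V)).δ_comp 1 0 (by simp)
  rw [reassoc_of% this]
  simp

lemma connecting_exact [HasProjectiveResolutions C]
    [PreservesFiniteColimits S] [PreservesFiniteColimits J]
    (h : ∀ (P : C) [Projective P],
      (ShortComplex.mk (μ.app P) (ε.app P) (congr_app w P)).ShortExact) (V : C) :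
    (ShortComplex.mk _ _ (connecting_comp μ ε w h V)).Exact := by
  have H := (resolutionSequence_shortExact μ ε w h (projectiveResolution V)).homology_exact₁
    1 0 (by simp)
  refine (ShortComplex.exact_iff_of_iso (ShortComplex.isoMk
    (leftDerivedOneIso (projectiveResolution V) F)
    (asIso (homologyZeroTo (projectiveResolution V) J)).symm
    (asIso (homologyZeroTo (projectiveResolution V) S)).symm ?_ ?_)).2 H
  · have : (connecting μ ε w h).app V ≫ inv (homologyZeroTo (projectiveResolution V) J) =
        (leftDerivedOneIso (projectiveResolution V) F).hom ≫
          resolutionδ μ ε w h (projectiveResolution V) := by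
      simp [connecting]
    exact this.symm
  · have := homologyZeroTo_natTrans (projectiveResolution V) μ
    simp only [Iso.symm_hom, asIso_inv]
    have h' : inv (homologyZeroTo (projectiveResolution V) J) ≫ HomologicalComplex.homologyMap
        ((NatTrans.mapHomologicalComplex μ (ComplexShape.down ℕ)).app _) 0 =
        μ.app V ≫ inv (homologyZeroTo (projectiveResolution V) S) := by
      rw [IsIso.inv_comp_eq, ← Category.assoc, ← this]
      simp
    exact h'

end

end LeftDerivedOne



namespace ProjectiveModels

section

variable {C : Type u} [Category.{v} C] [Abelian C]

lemma quasiIsoAt_op_iff {K L : CochainComplex C ℤ} (f : K ⟶ L) (m : ℤ) :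
    QuasiIsoAt ((CochainComplex.opEquivalence C).functor.map f.op) m ↔ QuasiIsoAt f (-m) := by
  rw [quasiIsoAt_iff' _ (m-1) m (m+1) (by simp) (by simp),
    quasiIsoAt_iff' _ (-(m+1)) (-m) (-(m-1)) (by simp; lia) (by simp; lia)]
  exact ShortComplex.quasiIso_opMap_iff
    ((HomologicalComplex.shortComplexFunctor' C (.up ℤ) (-(m+1)) (-m) (-(m-1))).map f)

lemma quasiIso_op_iff {K L : CochainComplex C ℤ} (f : K ⟶ L) :
    QuasiIso ((CochainComplex.opEquivalence C).functor.map f.op) ↔ QuasiIso f := by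
  rw [quasiIso_iff, quasiIso_iff]
  refine ⟨fun h n => ?_, fun h n => (quasiIsoAt_op_iff f n).2 (h _)⟩
  have := (quasiIsoAt_op_iff f (-n)).1 (h _)
  rwa [neg_neg] at this

lemma exists_projective [EnoughProjectives C] (K : CochainComplex C ℤ) (b : ℤ)
    [K.IsStrictlyLE b] :
    ∃ (P : CochainComplex C ℤ) (p : P ⟶ K), QuasiIso p ∧ (∀ n, Projective (P.X n)) ∧
      P.IsStrictlyLE b := by
  let e := CochainComplex.opEquivalence C
  let L := e.functor.obj (op K)
  have : L.IsStrictlyGE (-b) := by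
    rw [CochainComplex.isStrictlyGE_iff]
    intro i hi
    exact (K.isZero_of_isStrictlyLE b (-i) (by lia)).op
  obtain ⟨M, i, hi, hM, hM'⟩ :=
    CochainComplex.Plus.modelCategoryQuillen.exists_quasiIso_injective L (-b)
  let P := (e.inverse.obj M).unop
  let p : P ⟶ K := (e.unitIso.hom.app (op K) ≫ e.inverse.map i).unop
  refine ⟨P, p, ?_, ?_, ?_⟩
  · rw [← quasiIso_op_iff]
    have : e.functor.map p.op = i ≫ (e.counitIso.app M).inv := by
      rw [← cancel_mono (e.counitIso.app M).hom]
      change e.functor.map (e.unitIso.hom.app (op K) ≫ e.inverse.map i) ≫ e.counitIso.hom.app M = _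
      simp [L]
    have h : QuasiIso (e.functor.map p.op) := by
      rw [this]; infer_instance
    exact h
  · intro n
    have := hM (-n)
    exact (Injective.projective_iff_injective_op).2 this
  · rw [CochainComplex.isStrictlyLE_iff]
    intro i hi
    exact (M.isZero_of_isStrictlyGE (-b) (-i) (by lia)).unop

end

section

variable {C : Type u} [Category.{v} C] [Abelian C] [HasDerivedCategory.{w} C]

/-- A bounded above complex of projective objects representing an object of the derived
category. -/
structure Model (X : DerivedCategory C) where
  complex : CochainComplex C ℤ
  bound : ℤ
  isStrictlyLE : complex.IsStrictlyLE bound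
  projective : ∀ n, Projective (complex.X n)
  iso : DerivedCategory.Qh.obj ((HomotopyCategory.quotient C (.up ℤ)).obj complex) ≅ X

lemma Model.isKProjective {X : DerivedCategory C} (P : Model X) : P.complex.IsKProjective :=
  have := P.isStrictlyLE
  have := P.projective
  CochainComplex.isKProjective_of_projective P.complex P.bound

/-- Bounded above cochain complexes. -/
def boundedAbove (C : Type u) [Category.{v} C] [Abelian C] :
    ObjectProperty (CochainComplex C ℤ) :=
  fun K => ∃ n : ℤ, K.IsStrictlyLE n

/-- Bounded complexes concentrated in cohomological degrees `≤ b`, i.e. in homological degrees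
`≥ -b`. -/
def boundedLE (C : Type*) [Category* C] [Abelian C] (b : ℤ) :
    ObjectProperty (CochainComplex C ℤ) :=
  fun K => K.IsStrictlyLE b ∧ ∃ a : ℤ, K.IsStrictlyGE a

lemma boundedLE.boundedAbove {C : Type*} [Category* C] [Abelian C] {b : ℤ}
    {K : CochainComplex C ℤ} (hK : boundedLE C b K) : ProjectiveModels.boundedAbove C K :=
  ⟨b, hK.1⟩

/-- The homotopy category `K⁻(C)` as a full subcategory of `K(C)`. -/
def homotopyMinus (C : Type*) [Category* C] [Abelian C] :
    ObjectProperty (HomotopyCategory C (.up ℤ)) :=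
  (boundedAbove C).strictMap (HomotopyCategory.quotient C (.up ℤ))

/-- The object of `D⁻` given by a bounded above complex. -/
noncomputable def toMinus (K : CochainComplex C ℤ) (hK : boundedAbove C K) :
    DerivedCategory.Minus C :=
  ⟨DerivedCategory.Q.obj K, by
    obtain ⟨n, hn⟩ := hK
    exact ⟨n, K, Iso.refl _, hn⟩⟩

lemma nonempty_model [EnoughProjectives C] (X : DerivedCategory.Minus C) :
    Nonempty (Model X.obj) := by
  obtain ⟨n, K, e, hK⟩ := X.property
  obtain ⟨P, p, hp, hP, hP'⟩ := exists_projective K n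
  exact ⟨⟨P, n, hP', hP, (DerivedCategory.quotientCompQhIso C).app P ≪≫
    asIso (DerivedCategory.Q.map p) ≪≫ e.symm⟩⟩

/-- A chosen projective model. -/
noncomputable def model [EnoughProjectives C] (X : DerivedCategory.Minus C) : Model X.obj :=
  (nonempty_model X).some

/-- The unique homotopy class out of a projective model that represents a given morphism of the
derived category. -/
noncomputable def Model.lift {X : DerivedCategory C} (P : Model X)
    {L : HomotopyCategory C (.up ℤ)} (f : X ⟶ DerivedCategory.Qh.obj L) :
    (HomotopyCategory.quotient C (.up ℤ)).obj P.complex ⟶ L :=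
  have := P.isKProjective
  ((CochainComplex.IsKProjective.Qh_map_bijective P.complex L).surjective
    (P.iso.hom ≫ f)).choose

@[simp]
lemma Model.Qh_map_lift {X : DerivedCategory C} (P : Model X)
    {L : HomotopyCategory C (.up ℤ)} (f : X ⟶ DerivedCategory.Qh.obj L) :
    DerivedCategory.Qh.map (P.lift f) = P.iso.hom ≫ f :=
  have := P.isKProjective
  ((CochainComplex.IsKProjective.Qh_map_bijective P.complex L).surjective
    (P.iso.hom ≫ f)).choose_spec

lemma Model.hom_ext {X : DerivedCategory C} (P : Model X)
    {L : HomotopyCategory C (.up ℤ)}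
    {f g : (HomotopyCategory.quotient C (.up ℤ)).obj P.complex ⟶ L}
    (h : DerivedCategory.Qh.map f = DerivedCategory.Qh.map g) : f = g :=
  have := P.isKProjective
  (CochainComplex.IsKProjective.Qh_map_bijective P.complex L).injective h

variable {D : Type*} [Category* D] [Abelian D] [HasDerivedCategory.{w'} D]
  (F : C ⥤ D) [F.Additive]

/-- The total left derived functor `D⁻(C) ⥤ D(D)`, computed on projective models. -/
noncomputable def leftDerivedMinus [EnoughProjectives C] :
    DerivedCategory.Minus C ⥤ DerivedCategory D where
  obj X := DerivedCategory.Qh.obj ((F.mapHomotopyCategory (.up ℤ)).obj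
    ((HomotopyCategory.quotient C (.up ℤ)).obj (model X).complex))
  map {X Y} f := DerivedCategory.Qh.map ((F.mapHomotopyCategory (.up ℤ)).map
    ((model X).lift (f.hom ≫ (model Y).iso.inv)))
  map_id X := by
    rw [← CategoryTheory.Functor.map_id, ← CategoryTheory.Functor.map_id]
    congr 2
    exact (model X).hom_ext (by simp)
  map_comp {X Y Z} f g := by
    rw [← Functor.map_comp, ← Functor.map_comp]
    congr 2
    exact (model X).hom_ext (by simp)

/-- The canonical morphism from the derived functor to the functor applied termwise. -/
noncomputable def fromLeftDerivedMinus [EnoughProjectives C] (K : CochainComplex C ℤ)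
    (hK : boundedAbove C K) :
    (leftDerivedMinus F).obj (toMinus K hK) ⟶
      DerivedCategory.Q.obj ((F.mapHomologicalComplex (.up ℤ)).obj K) :=
  DerivedCategory.Qh.map ((F.mapHomotopyCategory (.up ℤ)).map
      ((model (toMinus K hK)).lift ((DerivedCategory.quotientCompQhIso C).inv.app K))) ≫
    DerivedCategory.Qh.map ((F.mapHomotopyCategoryFactors (.up ℤ)).hom.app K) ≫
    (DerivedCategory.quotientCompQhIso D).hom.app
      ((F.mapHomologicalComplex (.up ℤ)).obj K)

end

end ProjectiveModels
lemma leftDerived_additive {C D : Type*} [Category* C] [Category* D] [Abelian C] [Abelian D]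
    [HasProjectiveResolutions C] (F : C ⥤ D) [F.Additive] (n : ℕ) : (F.leftDerived n).Additive where
  map_add {X Y f g} := by
    have hf := ProjectiveResolution.lift_commutes f (projectiveResolution X) (projectiveResolution Y)
    have hg := ProjectiveResolution.lift_commutes g (projectiveResolution X) (projectiveResolution Y)
    rw [F.leftDerived_map_eq n f _ hf, F.leftDerived_map_eq n g _ hg,
      F.leftDerived_map_eq n (f + g) (ProjectiveResolution.lift f (projectiveResolution X)
        (projectiveResolution Y) + ProjectiveResolution.lift g (projectiveResolution X)
        (projectiveResolution Y)) (by rw [Preadditive.add_comp, hf, hg, Functor.map_add,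
          Preadditive.comp_add])]
    rw [Functor.map_add, Preadditive.add_comp, Preadditive.comp_add]

namespace YonedaTwo

section

variable {C : Type u} [Category.{v} C] [Abelian C]
  {T J S F : CochainComplex C ℤ} (t : T ⟶ J) (m : J ⟶ S) (e : S ⟶ F)
  (htm : t ≫ m = 0) (hme : m ≫ e = 0)

lemma left_shortExact [Mono t] (h₁ : (ShortComplex.mk t m htm).Exact)
    (h₂ : (ShortComplex.mk m e hme).Exact) :
    (ShortComplex.mk t (kernel.lift e m hme)
      (by rw [← cancel_mono (kernel.ι e)]; simpa using htm)).ShortExact where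
  exact := by
    refine (ShortComplex.exact_iff_of_epi_of_isIso_of_mono
      (S₁ := ShortComplex.mk t (kernel.lift e m hme)
        (by rw [← cancel_mono (kernel.ι e)]; simpa using htm))
      (S₂ := ShortComplex.mk t m htm)
      { τ₁ := 𝟙 _, τ₂ := 𝟙 _, τ₃ := kernel.ι e }).2 h₁
  mono_f := inferInstance
  epi_g := h₂.epi_kernelLift

lemma right_shortExact [Epi e] :
    (ShortComplex.mk (kernel.ι e) e (kernel.condition e)).ShortExact where
  exact := ShortComplex.exact_kernel e

/-- The class `F ⟶ T[2]` in the derived category of an exact sequence of complexes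
`0 ⟶ T ⟶ J ⟶ S ⟶ F ⟶ 0`: the composition of the connecting morphisms of the two short
exact sequences into which it splits at `ker (S ⟶ F) = im (J ⟶ S)`. -/
noncomputable def extClass [HasDerivedCategory.{w} C] [Mono t] [Epi e]
    (h₁ : (ShortComplex.mk t m htm).Exact) (h₂ : (ShortComplex.mk m e hme).Exact) :
    DerivedCategory.Q.obj F ⟶ (DerivedCategory.Q.obj T)⟦(2 : ℤ)⟧ :=
  DerivedCategory.triangleOfSESδ (right_shortExact e) ≫
    (DerivedCategory.triangleOfSESδ (left_shortExact t m e htm hme h₁ h₂))⟦(1 : ℤ)⟧' ≫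
    (shiftFunctorAdd' (DerivedCategory C) (1 : ℤ) 1 2 (by norm_num)).inv.app
      (DerivedCategory.Q.obj T)

end

end YonedaTwo


namespace SplitSqZeroExtension

section

variable {k : Type v} {A I B : Type u} [Field k] [CommRing A] [Algebra k A]
  [AddCommGroup I] [Module A I] [CommRing B] [Algebra k B] (E : SplitSqZeroExtension k A I B)

/-- `M ↦ Tor₁^B(M, A)`. -/
noncomputable abbrev tor₁ : ModuleCat.{u} B ⥤ ModuleCat.{u} A :=
  E.baseChange.leftDerived 1

instance tor₁_additive : E.tor₁.Additive := leftDerived_additive _ _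

lemma projective_shortExact (P : ModuleCat.{u} B) [Projective P] :
    (ShortComplex.mk (E.mul.app P) (E.toBaseChange.app P)
      (congr_app E.mul_comp_toBaseChange P)).ShortExact where
  exact := (ShortComplex.ShortExact.moduleCat_exact_iff_function_exact _).2
    (E.mul_toBaseChange_exact P)
  mono_f := (ModuleCat.mono_iff_injective _).2 (E.mul_injective P)
  epi_g := (ModuleCat.epi_iff_surjective _).2 (E.toBaseChange_surjective P)

/-- The inclusion `Tor₁^B(M, A) ⟶ I ⊗ (M ⊗_B A)`: the connecting morphism of the sequence
`0 ⟶ I ⟶ B ⟶ A ⟶ 0` tensored with `M`. -/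
noncomputable def torInclusion : E.tor₁ ⟶ E.idealTensor :=
  LeftDerivedOne.connecting E.mul E.toBaseChange E.mul_comp_toBaseChange
    fun P _ => E.projective_shortExact P

/-- `K ↦ K ⊗_B A`, termwise. -/
noncomputable abbrev baseChangeC :
    CochainComplex (ModuleCat.{u} B) ℤ ⥤ CochainComplex (ModuleCat.{u} A) ℤ :=
  E.baseChange.mapHomologicalComplex (.up ℤ)

/-- `K ↦ Tor₁^B(K, A)`, termwise. -/
noncomputable abbrev tor₁C :
    CochainComplex (ModuleCat.{u} B) ℤ ⥤ CochainComplex (ModuleCat.{u} A) ℤ :=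
  E.tor₁.mapHomologicalComplex (.up ℤ)

/-- `K ↦ I ⊗_A (K ⊗_B A)`, termwise. -/
noncomputable abbrev idealTensorC :
    CochainComplex (ModuleCat.{u} B) ℤ ⥤ CochainComplex (ModuleCat.{u} A) ℤ :=
  E.idealTensor.mapHomologicalComplex (.up ℤ)

/-- Termwise restriction of scalars along the splitting. -/
noncomputable abbrev viaSectC :
    CochainComplex (ModuleCat.{u} B) ℤ ⥤ CochainComplex (ModuleCat.{u} A) ℤ :=
  E.viaSect.mapHomologicalComplex (.up ℤ)

/-- Termwise restriction of scalars along the projection. -/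
noncomputable abbrev viaProjC :
    CochainComplex (ModuleCat.{u} A) ℤ ⥤ CochainComplex (ModuleCat.{u} B) ℤ :=
  E.viaProj.mapHomologicalComplex (.up ℤ)

section

variable (K : CochainComplex (ModuleCat.{u} B) ℤ)

noncomputable abbrev torInclusionC : E.tor₁C.obj K ⟶ E.idealTensorC.obj K :=
  (NatTrans.mapHomologicalComplex E.torInclusion (.up ℤ)).app K

noncomputable abbrev mulC : E.idealTensorC.obj K ⟶ E.viaSectC.obj K :=
  (NatTrans.mapHomologicalComplex E.mul (.up ℤ)).app K

noncomputable abbrev toBaseChangeC : E.viaSectC.obj K ⟶ E.baseChangeC.obj K :=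
  (NatTrans.mapHomologicalComplex E.toBaseChange (.up ℤ)).app K

instance torInclusionC_mono : Mono (E.torInclusionC K) :=
  HomologicalComplex.mono_of_mono_f _ fun n =>
    LeftDerivedOne.connecting_mono E.mul E.toBaseChange E.mul_comp_toBaseChange _ (K.X n)

instance toBaseChangeC_epi : Epi (E.toBaseChangeC K) :=
  HomologicalComplex.epi_of_epi_f _ fun n =>
    (ModuleCat.epi_iff_surjective _).2 (E.toBaseChange_surjective (K.X n))

lemma torInclusionC_mulC : E.torInclusionC K ≫ E.mulC K = 0 := by
  ext n : 1
  exact LeftDerivedOne.connecting_comp E.mul E.toBaseChange E.mul_comp_toBaseChange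
    (fun P _ => E.projective_shortExact P) (K.X n)

lemma mulC_toBaseChangeC : E.mulC K ≫ E.toBaseChangeC K = 0 := by
  ext n : 1
  exact congr_app E.mul_comp_toBaseChange (K.X n)

lemma torInclusionC_mulC_exact :
    (ShortComplex.mk _ _ (E.torInclusionC_mulC K)).Exact :=
  HomologicalComplex.exact_of_degreewise_exact _ fun n =>
    LeftDerivedOne.connecting_exact E.mul E.toBaseChange E.mul_comp_toBaseChange
      (fun P _ => E.projective_shortExact P) (K.X n)

lemma mulC_toBaseChangeC_exact :
    (ShortComplex.mk _ _ (E.mulC_toBaseChangeC K)).Exact :=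
  HomologicalComplex.exact_of_degreewise_exact _ fun n =>
    (ShortComplex.ShortExact.moduleCat_exact_iff_function_exact _).2
      (E.mul_toBaseChange_exact (K.X n))

/-- The local HKR class `K ⊗_B A ⟶ Tor₁^B(K, A)[2]`, the class in the derived category of `A` of
`0 ⟶ Tor₁^B(K, A) ⟶ I ⊗ (K ⊗_B A) ⟶ K ⟶ K ⊗_B A ⟶ 0`, where `A` acts on `K` via the splitting. -/
noncomputable def hkrClass [HasDerivedCategory.{w} (ModuleCat.{u} A)] :
    DerivedCategory.Q.obj (E.baseChangeC.obj K) ⟶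
      (DerivedCategory.Q.obj (E.tor₁C.obj K))⟦(2 : ℤ)⟧ :=
  YonedaTwo.extClass (E.torInclusionC K) (E.mulC K) (E.toBaseChangeC K)
    (E.torInclusionC_mulC K) (E.mulC_toBaseChangeC K)
    (E.torInclusionC_mulC_exact K) (E.mulC_toBaseChangeC_exact K)

/-- The termwise `Tor₁^B(V, A)` is acyclic. -/
def Admissible : Prop := (E.tor₁C.obj K).Acyclic

end

section Dadm

/-- Complexes `K` such that `K ⊗_B A` and `Tor₁^B(K, A)` are exact. -/
def nullSystem : ObjectProperty (HomotopyCategory (ModuleCat.{u} B) (.up ℤ)) :=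
  (HomotopyCategory.subcategoryAcyclic (ModuleCat.{u} A)).inverseImage
      (E.baseChange.mapHomotopyCategory (.up ℤ)) ⊓
    (HomotopyCategory.subcategoryAcyclic (ModuleCat.{u} A)).inverseImage
      (E.tor₁.mapHomotopyCategory (.up ℤ))

/-- The morphisms of `K⁻(B)` with cone in the null system. -/
def admissibleW : MorphismProperty (ProjectiveModels.homotopyMinus (ModuleCat.{u} B)).FullSubcategory :=
  E.nullSystem.trW.inverseImage (ProjectiveModels.homotopyMinus (ModuleCat.{u} B)).ι

/-- The admissible derived category: the localization of `K⁻(B)` at the null system. -/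
abbrev DerivedAdm := E.admissibleW.Localization

/-- The object of the admissible derived category given by a bounded above complex. -/
noncomputable def toDerivedAdm (K : CochainComplex (ModuleCat.{u} B) ℤ)
    (hK : ProjectiveModels.boundedAbove _ K) : E.DerivedAdm :=
  E.admissibleW.Q.obj ⟨(HomotopyCategory.quotient _ _).obj K, ⟨K, hK⟩⟩

lemma admissibleW_isInvertedBy [HasDerivedCategory.{w} (ModuleCat.{u} A)] :
    E.admissibleW.IsInvertedBy ((ProjectiveModels.homotopyMinus (ModuleCat.{u} B)).ι ⋙
      E.baseChange.mapHomotopyCategory (.up ℤ) ⋙ DerivedCategory.Qh) := by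
  intro X Y f hf
  exact ObjectProperty.inverseImage_trW_isInverted
    (P := HomotopyCategory.subcategoryAcyclic (ModuleCat.{u} A))
    (F := E.baseChange.mapHomotopyCategory (.up ℤ)) DerivedCategory.Qh _
    (ObjectProperty.trW_monotone inf_le_left _ hf)

/-- The functor `K ↦ K ⊗_B A` from the admissible derived category of `B` to the derived
category of `A`. -/
noncomputable def baseChangeAdm [HasDerivedCategory.{w} (ModuleCat.{u} A)] :
    E.DerivedAdm ⥤ DerivedCategory (ModuleCat.{u} A) :=
  Localization.Construction.lift _ E.admissibleW_isInvertedBy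

end Dadm

/-- The complex `I^{⊗ p} ⊗ Tor₁^B(K, A)`, tensor products being over `A`. -/
noncomputable abbrev tensorPowerTor (K : CochainComplex (ModuleCat.{u} B) ℤ) (p : ℕ) :
    CochainComplex (ModuleCat.{u} A) ℤ :=
  ((MonoidalCategory.tensorLeft (ModuleCat.of A (TensorPower A p I))).mapHomologicalComplex
    (.up ℤ)).obj (E.tor₁C.obj K)

lemma tor₁C_boundedAbove (K : CochainComplex (ModuleCat.{u} B) ℤ)
    (hK : ProjectiveModels.boundedAbove _ K) :
    ProjectiveModels.boundedAbove _ (E.viaProjC.obj (E.tor₁C.obj K)) := by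
  obtain ⟨n, hn⟩ := hK
  refine ⟨n, ?_⟩
  rw [CochainComplex.isStrictlyLE_iff]
  intro i hi
  exact E.viaProj.map_isZero (E.tor₁.map_isZero (K.isZero_of_isStrictlyLE n i hi))

section Quotient

variable (V : CochainComplex (ModuleCat.{u} B) ℤ) {T : CochainComplex (ModuleCat.{u} A) ℤ}
  (t : T ⟶ E.idealTensorC.obj V)

/-- The multiplication map, as a `B`-linear morphism of complexes. -/
noncomputable def mulBC : E.viaProjC.obj (E.idealTensorC.obj V) ⟶ V where
  f n := E.mulB.app (V.X n)
  comm' i j _ := (E.mulB.naturality (V.d i j)).symm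

/-- `V / T` for `T ⊆ I ⊗ (V ⊗_B A)`: the quotient of `V` by the image of `T` under
multiplication. -/
noncomputable def quotientComplex : CochainComplex (ModuleCat.{u} B) ℤ :=
  cokernel (E.viaProjC.map t ≫ E.mulBC V)

/-- The projection `V ⟶ V / T`. -/
noncomputable def quotientComplexπ : V ⟶ E.quotientComplex V t :=
  cokernel.π (E.viaProjC.map t ≫ E.mulBC V)

instance quotientComplexπ_epi : Epi (E.quotientComplexπ V t) :=
  inferInstanceAs (Epi (cokernel.π (E.viaProjC.map t ≫ E.mulBC V)))

lemma quotientComplex_boundedAbove (hV : ProjectiveModels.boundedAbove _ V) :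
    ProjectiveModels.boundedAbove _ (E.quotientComplex V t) := by
  obtain ⟨n, hn⟩ := hV
  refine ⟨n, ?_⟩
  rw [CochainComplex.isStrictlyLE_iff]
  intro i hi
  have : Epi ((E.quotientComplexπ V t).f i) :=
    inferInstanceAs (Epi ((HomologicalComplex.eval _ _ i).map (E.quotientComplexπ V t)))
  exact IsZero.of_epi ((E.quotientComplexπ V t).f i) (V.isZero_of_isStrictlyLE n i hi)

end Quotient

section

variable [HasDerivedCategory.{w} (ModuleCat.{u} A)] [HasDerivedCategory.{w'} (ModuleCat.{u} B)]

/-- `- ⊗ᴸ_B A : D⁻(B) ⥤ D(A)` -/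
noncomputable abbrev derivedBaseChange :
    DerivedCategory.Minus (ModuleCat.{u} B) ⥤ DerivedCategory (ModuleCat.{u} A) :=
  ProjectiveModels.leftDerivedMinus E.baseChange

/-- `K ⊗ᴸ_B A ⟶ K ⊗_B A`. -/
noncomputable abbrev derivedToBaseChange (K : CochainComplex (ModuleCat.{u} B) ℤ)
    (hK : ProjectiveModels.boundedAbove _ K) :
    E.derivedBaseChange.obj (ProjectiveModels.toMinus K hK) ⟶
      DerivedCategory.Q.obj (E.baseChangeC.obj K) :=
  ProjectiveModels.fromLeftDerivedMinus E.baseChange K hK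

end

end

end SplitSqZeroExtension

/-! Degrees are cohomological here, so "homological degrees `≥ N`" becomes `IsStrictlyLE b` with `b
= -N`. Write `K̄` for the base change of `K`.

The heart is a deformation argument. `θ_K` is the product of two connecting morphisms: the class of
`0 → IK → K → K̄ → 0`, followed by that of `0 → Tor₁ → I ⊗ K̄ → IK → 0`. If it vanishes, the first
class lifts to `Ext¹(K̄, I ⊗ K̄)`. Over a projective resolution `R → K̄` with surjective terms, such
a lift is a degree one cocycle `R → I ⊗ R`. Since `I² = 0`, this cocycle is all that is needed to
perturb the differential of `B ⊗_A R`. The perturbed complex `S` consists of projectives, has base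
change `R`, and maps to `K` by some `f` for which `f̄` is a surjective quasi-isomorphism
(`exists_projective_of_hkrClass_eq_zero`).

As `K` is bounded, `S̄` is exact in low degrees, and the canonical truncation `V` of `S` is bounded,
has termwise vanishing `Tor₁`, and has the same plain and derived base change as `S`
(`exists_truncation`). This gives (iii). Dividing `V` by the products that die in `K` changes
neither `V̄` nor the map to `K̄`, and makes `Tor₁` agree with that of `K`. This gives (v), and (iv)
follows because `V → V/T` is an isomorphism after base change.

The way back to `θ_K = 0` is naturality. The class vanishes on complexes of projectives, which
handles (ii), and on admissible complexes; it also descends to the admissible derived category,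
which handles (iv).

For the decomposition, let `T` be the kernel of `I ⊗ S̄ → K`. Then `S/T → K` and `T → Tor₁(K)` are
quasi-isomorphisms, so `K` is the cone of a map `u : P → S` with `P` a projective resolution of `T`
over `B`. Since `u ≫ f = 0` and `f̄` is invertible in `D(A)`, the base change of `u` vanishes there
and the cone splits (`nonempty_derivedBaseChange_iso_biprod`). The second form comes from an
explicit choice of `P`: a twist of `B ⊗_A ∐ I^{⊗p} ⊗ M[p]`, where `M` resolves `T` over `A`
(`exists_projective_viaProj`). -/

namespace CochainComplex

/-! ### Acyclicity and surjective quasi-isomorphisms on elements -/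

section Elements

variable {R : Type u} [Ring R] {K L : CochainComplex (ModuleCat.{u} R) ℤ}

lemma exactAt_iff_elements (K : CochainComplex (ModuleCat.{u} R) ℤ) (m n p : ℤ) (hm : m + 1 = n)
    (hp : n + 1 = p) :
    K.ExactAt n ↔ ∀ x : K.X n, K.d n p x = 0 → ∃ y : K.X m, K.d m n y = x := by
  rw [HomologicalComplex.exactAt_iff' K m n p (by simp [← hm]) (by simp [hp]),
    ShortComplex.moduleCat_exact_iff]
  rfl

lemma d_apply_d_apply (K : CochainComplex (ModuleCat.{u} R) ℤ) (m n p : ℤ) (x : K.X m) :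
    K.d n p (K.d m n x) = 0 := by
  rw [← ConcreteCategory.comp_apply, K.d_comp_d]
  rfl

lemma hom_d_apply (f : K ⟶ L) (m n : ℤ) (x : K.X m) :
    L.d m n (f.f m x) = f.f n (K.d m n x) := by
  rw [← ConcreteCategory.comp_apply, ← ConcreteCategory.comp_apply, f.comm]

/-- The kernel of a morphism of complexes is acyclic, expressed in terms of elements. -/
def KernelAcyclic (f : K ⟶ L) : Prop :=
  ∀ (m n p : ℤ), m + 1 = n → n + 1 = p → ∀ x : K.X n, f.f n x = 0 → K.d n p x = 0 →
    ∃ y : K.X m, f.f m y = 0 ∧ K.d m n y = x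

lemma acyclic_kernel_iff (f : K ⟶ L) :
    (kernel f).Acyclic ↔ KernelAcyclic f := by
  have ι_exact : ∀ n, Function.Exact ((kernel.ι f).f n) (f.f n) := fun n => by
    have := (ShortComplex.exact_kernel f).map (HomologicalComplex.eval _ _ n)
    exact (ShortComplex.ShortExact.moduleCat_exact_iff_function_exact _).1 this
  have ι_inj : ∀ n, Function.Injective ((kernel.ι f).f n) := fun n =>
    (ModuleCat.mono_iff_injective _).1
      (inferInstanceAs (Mono ((HomologicalComplex.eval _ _ n).map (kernel.ι f))))
  constructor
  · intro h m n p hm hp x hx hdx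
    obtain ⟨z, rfl⟩ := (ι_exact n x).1 hx
    rw [hom_d_apply] at hdx
    obtain ⟨y, rfl⟩ := (exactAt_iff_elements _ m n p hm hp).1 (h n) z
      (ι_inj p (hdx.trans (map_zero _).symm))
    exact ⟨(kernel.ι f).f m y, (ι_exact m _).2 ⟨y, rfl⟩, hom_d_apply _ _ _ _⟩
  · intro h n
    rw [exactAt_iff_elements _ (n - 1) n (n + 1) (by lia) rfl]
    intro x hx
    obtain ⟨y, hy, hy'⟩ := h (n - 1) n (n + 1) (by lia) rfl ((kernel.ι f).f n x)
      ((ι_exact n _).2 ⟨x, rfl⟩) (by rw [hom_d_apply, hx, map_zero])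
    obtain ⟨z, rfl⟩ := (ι_exact _ y).1 hy
    rw [hom_d_apply] at hy'
    exact ⟨z, ι_inj n hy'⟩

open scoped ZeroObject in
-- Compare `0 → 0 → K → K → 0` with `0 → ker f → K → L → 0`: the left map is a quasi-isomorphism
-- because the kernel is acyclic and the middle one is the identity, so the right one, `f`, is too.
lemma quasiIso_of_surjective (f : K ⟶ L) (hf : ∀ n, Function.Surjective (f.f n))
    (h : KernelAcyclic f) : QuasiIso f := by
  have : ∀ n, Epi (f.f n) := fun n => (ModuleCat.epi_iff_surjective _).2 (hf n)
  have : Epi f := HomologicalComplex.epi_of_epi_f _ inferInstance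
  have h₀ : (ShortComplex.mk (0 : (0 : CochainComplex (ModuleCat.{u} R) ℤ) ⟶ K) (𝟙 K)
      (by simp)).ShortExact :=
    { exact := (ShortComplex.exact_iff_mono _ rfl).2 inferInstance
      mono_f := ⟨fun _ _ _ => (isZero_zero _).eq_of_tgt _ _⟩ }
  have h₁ : (ShortComplex.mk (kernel.ι f) f (by simp)).ShortExact :=
    { exact := ShortComplex.exact_kernel f }
  refine HomologicalComplex.HomologySequence.quasiIso_τ₃
    (S₁ := ShortComplex.mk (0 : (0 : CochainComplex (ModuleCat.{u} R) ℤ) ⟶ K) (𝟙 K) (by simp))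
    (S₂ := ShortComplex.mk (kernel.ι f) f (by simp))
    { τ₁ := 0, τ₂ := 𝟙 K, τ₃ := f } h₀ h₁ ?_ inferInstance
  dsimp only
  rw [quasiIso_iff]
  intro i
  rw [quasiIsoAt_iff_exactAt]
  · exact (acyclic_kernel_iff f).2 h i
  · rw [HomologicalComplex.exactAt_iff]
    exact ShortComplex.exact_of_isZero_X₂ _
      (Functor.map_isZero (HomologicalComplex.eval _ _ i) (isZero_zero _))

lemma kernelAcyclic_of_quasiIso (f : K ⟶ L) (hf : ∀ n, Function.Surjective (f.f n))
    (h : QuasiIso f) : KernelAcyclic f := by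
  have : ∀ n, Epi (f.f n) := fun n => (ModuleCat.epi_iff_surjective _).2 (hf n)
  have : Epi f := HomologicalComplex.epi_of_epi_f _ inferInstance
  have h₁ : (ShortComplex.mk (kernel.ι f) f (by simp)).ShortExact :=
    { exact := ShortComplex.exact_kernel f }
  exact (acyclic_kernel_iff f).1 (h₁.acyclic_X₁ h)

end Elements

end CochainComplex

/-! ### Projective resolutions with surjective terms and a prescribed bound -/

namespace CochainComplex

open HomComplex

section

variable {C : Type u} [Category.{v} C] [Abelian C] {K L : CochainComplex C ℤ}

lemma acyclic_mappingCone_iff (f : K ⟶ L) : (mappingCone f).Acyclic ↔ QuasiIso f := by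
  have := (HomotopyCategory.subcategoryAcyclic C).trW_iff_of_distinguished _
    (HomotopyCategory.mappingCone_triangleh_distinguished f)
  rw [← HomotopyCategory.quasiIso_eq_trW_subcategoryAcyclic] at this
  rw [← HomotopyCategory.quotient_obj_mem_subcategoryAcyclic_iff_acyclic]
  refine this.symm.trans ?_
  exact HomotopyCategory.quotient_map_mem_quasiIso_iff f

lemma isStrictlyLE_mappingCone (f : K ⟶ L) (b : ℤ) [K.IsStrictlyLE b] [L.IsStrictlyLE b] :
    (mappingCone f).IsStrictlyLE b := by
  rw [isStrictlyLE_iff]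
  intro i hi
  rw [mappingCone.isZero_X_iff]
  exact ⟨K.isZero_of_isStrictlyLE b _ (by lia), L.isZero_of_isStrictlyLE b _ (by lia)⟩

lemma projective_mappingCone_X (f : K ⟶ L) (hK : ∀ n, Projective (K.X n))
    (hL : ∀ n, Projective (L.X n)) (n : ℤ) : Projective ((mappingCone f).X n) := by
  have := hK (n + 1)
  have := hL n
  exact Projective.of_iso (HomologicalComplex.homotopyCofiber.XIsoBiprod f n (n + 1) rfl).symm
    inferInstance

end

section

variable {R : Type u} [Ring R] {K L : CochainComplex (ModuleCat.{u} R) ℤ}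

/-- The cycle `y`, placed in the acyclic cone of `f`, is a boundary; the two components of a
primitive are `x` and `z`. -/
lemma exists_homologous_of_quasiIso (f : K ⟶ L) (hf : QuasiIso f) (m n p : ℤ) (hm : m + 1 = n)
    (hp : n + 1 = p) (y : L.X n) (hy : L.d n p y = 0) :
    ∃ (x : K.X n) (z : L.X m), f.f n x + L.d m n z = y := by
  obtain ⟨c, hc⟩ := (exactAt_iff_elements _ m n p hm hp).1
    ((acyclic_mappingCone_iff f).2 hf n) ((mappingCone.inr f).f n y)
    (by rw [hom_d_apply, hy, map_zero])
  refine ⟨(mappingCone.fst f).1.v m n hm c, (mappingCone.snd f).v m m (add_zero m) c, ?_⟩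
  have h := congr($(mappingCone.d_snd_v f m n hm) c)
  have h' := congr($(mappingCone.inr_f_snd_v f n) y)
  have := congr_arg ((mappingCone.snd f).v n n (add_zero n)) hc
  exact (h.symm.trans this).trans h'

lemma exists_surjective_cochain (K : CochainComplex (ModuleCat.{u} R) ℤ) (b : ℤ) :
    ∃ (X : CochainComplex (ModuleCat.{u} R) ℤ) (h : Cochain X K (-1)),
      (∀ n, Projective (X.X n)) ∧ X.IsStrictlyLE b ∧
      ∀ n m hnm, n ≤ b → Function.Surjective (h.v n m hnm) := by
  -- Degree `n` of `X` covers degree `n - 1` of `K`, so only the degrees of `K` below `b` get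
  -- covered; in exchange the cone of `𝟙 X` stays in degrees `≤ b`.
  let X : CochainComplex (ModuleCat.{u} R) ℤ :=
    { X := fun n => if n ≤ b then Projective.over (K.X (n - 1)) else ModuleCat.of R PUnit
      d := fun _ _ => 0 }
  refine ⟨X, Cochain.mk fun n m hnm =>
    if hn : n ≤ b then eqToHom (if_pos hn) ≫ Projective.π (K.X (n - 1)) ≫
      eqToHom (by obtain rfl : m = n - 1 := by lia
                  rfl) else 0, fun n => ?_, ?_, fun n m hnm hn => ?_⟩
  · dsimp [X]
    split_ifs
    · infer_instance
    · exact (ModuleCat.isZero_of_subsingleton _).projective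
  · rw [isStrictlyLE_iff]
    intro i hi
    dsimp [X]
    rw [if_neg (by lia)]
    exact ModuleCat.isZero_of_subsingleton _
  · obtain rfl : m = n - 1 := by lia
    rw [Cochain.mk_v, dif_pos hn, ← ModuleCat.epi_iff_surjective]
    infer_instance

/-- A bounded above complex is the target of a surjective quasi-isomorphism from a complex of
projective modules with the same bound. -/
lemma exists_projective_surjective (K : CochainComplex (ModuleCat.{u} R) ℤ) (b : ℤ)
    [K.IsStrictlyLE b] :
    ∃ (P : CochainComplex (ModuleCat.{u} R) ℤ) (p : P ⟶ K), QuasiIso p ∧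
      (∀ n, Projective (P.X n)) ∧ P.IsStrictlyLE b ∧ ∀ n, Function.Surjective (p.f n) := by
  obtain ⟨P, p, hp, hP, hPb⟩ := ProjectiveModels.exists_projective K b
  obtain ⟨X, h, hX, hXb, hh⟩ := exists_surjective_cochain K b
  -- Adding the contractible complex `D` to `P` does not change the homotopy type and makes the map
  -- to `K` surjective below `b`.
  let D := mappingCone (𝟙 X)
  obtain ⟨d, hd⟩ : ∃ d : D ⟶ K, ∀ p q hpq,
      (mappingCone.inl (𝟙 X)).v p q hpq ≫ d.f q = h.v p q hpq :=
    ⟨mappingCone.desc (𝟙 X) h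
      (Cocycle.homOf (Cocycle.mk (δ (-1) 0 h) 1 (by omega) (by rw [δ_δ]))) (by simp),
      fun _ _ _ => by simp⟩
  have hDb : D.IsStrictlyLE b := isStrictlyLE_mappingCone _ b
  have hD : ∀ n, Projective (D.X n) := projective_mappingCone_X _ hX hX
  have hinl : QuasiIso (biprod.inl : P ⟶ P ⊞ D) := by
    let e : HomotopyEquiv P (P ⊞ D) :=
      { hom := biprod.inl
        inv := biprod.fst
        homotopyHomInvId := Homotopy.ofEq (by simp)
        homotopyInvHomId :=
          (Homotopy.equivSubZero.symm
            ((Homotopy.ofEq (by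
              rw [sub_eq_iff_eq_add']
              simp only [Category.comp_id]
              exact biprod.total.symm)).trans
                (((mappingCone.homotopyToZeroOfId X).compLeft biprod.snd).compRight
                  biprod.inr |>.trans (Homotopy.ofEq (by simp))))).symm }
    exact e.quasiIso_hom
  have hX₁ : ∀ n (x : P.X n), (biprod.desc p d).f n ((biprod.inl : P ⟶ P ⊞ D).f n x) =
      p.f n x := fun n x => congr(($(biprod.inl_desc p d)).f n x)
  have hX₂ : ∀ n (x : D.X n), (biprod.desc p d).f n ((biprod.inr : D ⟶ P ⊞ D).f n x) =
      d.f n x := fun n x => congr(($(biprod.inr_desc p d)).f n x)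
  have hd' : ∀ n, n < b → Function.Surjective (d.f n) := fun n hn y => by
    obtain ⟨x, hx⟩ := hh (n + 1) n (by omega) (by omega) y
    exact ⟨(mappingCone.inl (𝟙 X)).v (n + 1) n (by omega) x,
      (congr($(hd (n + 1) n (by omega)) x)).trans hx⟩
  refine ⟨P ⊞ D, biprod.desc p d, ?_, fun n => ?_, ?_, fun n y => ?_⟩
  · exact quasiIso_of_comp_left (biprod.inl : P ⟶ P ⊞ D) _
      (hφφ' := by rw [biprod.inl_desc]; exact hp)
  · have := hP n
    have := hD n
    exact Projective.of_iso (HomologicalComplex.biprodXIso P D n).symm inferInstance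
  · rw [isStrictlyLE_iff]
    intro i hi
    exact (biprod_isZero_iff _ _).2 ⟨P.isZero_of_isStrictlyLE b i hi,
      D.isZero_of_isStrictlyLE b i hi⟩ |>.of_iso (HomologicalComplex.biprodXIso P D i)
  · obtain hn | rfl | hn := lt_trichotomy n b
    · obtain ⟨x, hx⟩ := hd' n hn y
      exact ⟨_, (hX₂ n x).trans hx⟩
    -- In the top degree every element of `K` is a cycle, hence comes from `P` up to a boundary `d
    -- z`, and `z` lies in a degree covered by `D`.
    · obtain ⟨x, z, rfl⟩ := exists_homologous_of_quasiIso p hp (n - 1) n (n + 1) (by omega) rfl y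
        (by
          have := ModuleCat.subsingleton_of_isZero (K.isZero_of_isStrictlyLE n (n + 1) (by omega))
          exact Subsingleton.elim _ _)
      obtain ⟨w, rfl⟩ := hd' (n - 1) (by omega) z
      refine ⟨(biprod.inl : P ⟶ P ⊞ D).f n x + (biprod.inr : D ⟶ P ⊞ D).f n (D.d (n - 1) n w),
        ?_⟩
      rw [map_add, hX₁, hX₂, hom_d_apply]
    · have := ModuleCat.subsingleton_of_isZero (K.isZero_of_isStrictlyLE b n hn)
      exact ⟨0, Subsingleton.elim _ _⟩

end

end CochainComplex

/-! ### The derived functor on complexes of projectives, and naturality -/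

namespace ProjectiveModels

section

variable {C : Type u} [Category.{v} C] [Abelian C]

lemma isKProjective_of_boundedAbove {P : CochainComplex C ℤ} (hP : boundedAbove C P)
    (hP' : ∀ n, Projective (P.X n)) : P.IsKProjective := by
  obtain ⟨b, hb⟩ := hP
  exact CochainComplex.isKProjective_of_projective P b

end

section

variable {C : Type u} [Category.{v} C] [Abelian C] [HasDerivedCategory.{w} C]
  {D : Type*} [Category* D] [Abelian D] [HasDerivedCategory.{w'} D]
  (F : C ⥤ D) [F.Additive]

/-- Homotopy classes out of a K-projective complex are the same as morphisms of the derived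
category, so the inverse lifts. -/
lemma isIso_of_isIso_Qh_map {P P' : CochainComplex C ℤ} [P.IsKProjective] [P'.IsKProjective]
    (f : (HomotopyCategory.quotient C (.up ℤ)).obj P ⟶ (HomotopyCategory.quotient C (.up ℤ)).obj P')
    [IsIso (DerivedCategory.Qh.map f)] : IsIso f := by
  obtain ⟨g, hg⟩ := (CochainComplex.IsKProjective.Qh_map_bijective P' _).surjective
    (inv (DerivedCategory.Qh.map f))
  exact ⟨g, (CochainComplex.IsKProjective.Qh_map_bijective P _).injective (by simp [hg]),
    (CochainComplex.IsKProjective.Qh_map_bijective P' _).injective (by simp [hg])⟩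

lemma exists_map_eq {P : CochainComplex C ℤ} [P.IsKProjective] {L : CochainComplex C ℤ}
    (f : DerivedCategory.Q.obj P ⟶ DerivedCategory.Q.obj L) :
    ∃ g : P ⟶ L, DerivedCategory.Q.map g = f := by
  obtain ⟨g, hg⟩ := (CochainComplex.IsKProjective.Qh_map_bijective P
    ((HomotopyCategory.quotient C (.up ℤ)).obj L)).surjective
      ((DerivedCategory.quotientCompQhIso C).hom.app P ≫ f ≫
        (DerivedCategory.quotientCompQhIso C).inv.app L)
  obtain ⟨g, rfl⟩ := (HomotopyCategory.quotient C (.up ℤ)).map_surjective g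
  refine ⟨g, ?_⟩
  rw [← cancel_epi ((DerivedCategory.quotientCompQhIso C).hom.app P),
    ← (DerivedCategory.quotientCompQhIso C).hom.naturality]
  simp [hg]

lemma homotopy_of_Q_map_eq {P : CochainComplex C ℤ} [P.IsKProjective] {L : CochainComplex C ℤ}
    (f g : P ⟶ L) (h : DerivedCategory.Q.map f = DerivedCategory.Q.map g) :
    Nonempty (Homotopy f g) := by
  refine ⟨HomotopyCategory.homotopyOfEq _ _
    ((CochainComplex.IsKProjective.Qh_map_bijective P _).injective ?_)⟩
  have h₁ := (DerivedCategory.quotientCompQhIso C).hom.naturality f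
  have h₂ := (DerivedCategory.quotientCompQhIso C).hom.naturality g
  rw [h, ← h₂, cancel_mono] at h₁
  exact h₁

lemma Model.isIso_lift {K : CochainComplex C ℤ} [K.IsKProjective]
    (M : Model (DerivedCategory.Q.obj K)) :
    IsIso (M.lift (L := (HomotopyCategory.quotient C (.up ℤ)).obj K)
      ((DerivedCategory.quotientCompQhIso C).inv.app K)) := by
  have := M.isKProjective
  have h := M.Qh_map_lift (L := (HomotopyCategory.quotient C (.up ℤ)).obj K)
    ((DerivedCategory.quotientCompQhIso C).inv.app K)
  have : IsIso (DerivedCategory.Qh.map (M.lift (L := (HomotopyCategory.quotient C (.up ℤ)).obj K)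
      ((DerivedCategory.quotientCompQhIso C).inv.app K))) := by
    rw [h]
    exact IsIso.comp_isIso' inferInstance
      (inferInstanceAs (IsIso ((DerivedCategory.quotientCompQhIso C).inv.app K)))
  exact isIso_of_isIso_Qh_map _

/-- Both sides start at a projective model, so it suffices to compare them in the derived category.
-/
lemma Model.lift_naturality {K L : CochainComplex C ℤ} (f : K ⟶ L)
    (M : Model (DerivedCategory.Q.obj K)) (N : Model (DerivedCategory.Q.obj L)) :
    M.lift (DerivedCategory.Q.map f ≫ N.iso.inv) ≫
      N.lift (L := (HomotopyCategory.quotient C (.up ℤ)).obj L)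
        ((DerivedCategory.quotientCompQhIso C).inv.app L) =
      M.lift (L := (HomotopyCategory.quotient C (.up ℤ)).obj K)
        ((DerivedCategory.quotientCompQhIso C).inv.app K) ≫
        (HomotopyCategory.quotient C (.up ℤ)).map f := by
  refine M.hom_ext ?_
  rw [Functor.map_comp, Functor.map_comp, Model.Qh_map_lift, Model.Qh_map_lift,
    Model.Qh_map_lift]
  simp only [Category.assoc, Iso.inv_hom_id_assoc]
  congr 1
  exact (DerivedCategory.quotientCompQhIso C).inv.naturality f

variable [EnoughProjectives C]

/-- The derived functor is computed by any bounded above complex of projective objects. -/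
lemma nonempty_leftDerivedMinus_obj_iso (X : DerivedCategory.Minus C) {P : CochainComplex C ℤ}
    (hP : boundedAbove C P) (hP' : ∀ n, Projective (P.X n))
    (e : X.obj ≅ DerivedCategory.Q.obj P) :
    Nonempty ((leftDerivedMinus F).obj X ≅
      DerivedCategory.Q.obj ((F.mapHomologicalComplex (.up ℤ)).obj P)) := by
  have := isKProjective_of_boundedAbove hP hP'
  have := (model X).isKProjective
  let f := (model X).lift (e.hom ≫ (DerivedCategory.quotientCompQhIso C).inv.app P)
  have : IsIso (DerivedCategory.Qh.map f) := by
    rw [Model.Qh_map_lift]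
    infer_instance
  have := isIso_of_isIso_Qh_map f
  exact ⟨DerivedCategory.Qh.mapIso ((F.mapHomotopyCategory (.up ℤ)).mapIso (asIso f)) ≪≫
    DerivedCategory.Qh.mapIso ((F.mapHomotopyCategoryFactors (.up ℤ)).app P) ≪≫
      (DerivedCategory.quotientCompQhIso D).app ((F.mapHomologicalComplex (.up ℤ)).obj P)⟩

/-- The comparison of `P` with its chosen model is an isomorphism in the homotopy category, hence is
preserved by any additive functor applied termwise. -/
lemma isIso_fromLeftDerivedMinus {P : CochainComplex C ℤ}
    (hP : boundedAbove C P) (hP' : ∀ n, Projective (P.X n)) :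
    IsIso (fromLeftDerivedMinus F P hP) := by
  have := isKProjective_of_boundedAbove hP hP'
  have := Model.isIso_lift (K := P) (model (toMinus P hP))
  exact IsIso.comp_isIso' (DerivedCategory.Qh.mapIso
    ((F.mapHomotopyCategory (.up ℤ)).mapIso (@asIso _ _ _ _ _ this))).isIso_hom inferInstance

/-- The morphism of `D⁻` given by a morphism of complexes. -/
noncomputable def toMinusMap {K L : CochainComplex C ℤ} (f : K ⟶ L) (hK : boundedAbove C K)
    (hL : boundedAbove C L) : toMinus K hK ⟶ toMinus L hL :=
  ObjectProperty.homMk (DerivedCategory.Q.map f)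

lemma fromLeftDerivedMinus_naturality {K L : CochainComplex C ℤ} (f : K ⟶ L)
    (hK : boundedAbove C K) (hL : boundedAbove C L) :
    (leftDerivedMinus F).map (toMinusMap f hK hL) ≫ fromLeftDerivedMinus F L hL =
      fromLeftDerivedMinus F K hK ≫
        DerivedCategory.Q.map ((F.mapHomologicalComplex (.up ℤ)).map f) := by
  have h : (model (toMinus K hK)).lift ((toMinusMap f hK hL).hom ≫
        (model (toMinus L hL)).iso.inv) ≫
      (model (toMinus L hL)).lift ((DerivedCategory.quotientCompQhIso C).inv.app L) =
      (model (toMinus K hK)).lift ((DerivedCategory.quotientCompQhIso C).inv.app K) ≫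
        (HomotopyCategory.quotient C (.up ℤ)).map f :=
    Model.lift_naturality f (model (toMinus K hK)) (model (toMinus L hL))
  dsimp only [fromLeftDerivedMinus, leftDerivedMinus]
  rw [← Functor.map_comp_assoc, ← Functor.map_comp, h]
  simp only [Functor.map_comp, Category.assoc]
  congr 1
  rw [← Functor.map_comp_assoc]
  erw [(F.mapHomotopyCategoryFactors (.up ℤ)).hom.naturality f]
  rw [Functor.map_comp_assoc]
  congr 1
  exact (DerivedCategory.quotientCompQhIso D).hom.naturality _

instance {K L : CochainComplex C ℤ} (f : K ⟶ L) [QuasiIso f] (hK : boundedAbove C K)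
    (hL : boundedAbove C L) : IsIso (toMinusMap f hK hL) := by
  have : IsIso ((DerivedCategory.Minus.ι (C := C)).map (toMinusMap f hK hL)) :=
    inferInstanceAs (IsIso (DerivedCategory.Q.map f))
  exact isIso_of_reflects_iso _ (DerivedCategory.Minus.ι (C := C))

end

end ProjectiveModels

/-! ### Naturality of the class of a four-term exact sequence -/

namespace YonedaTwo

section

variable {C : Type u} [Category.{v} C] [Abelian C] [HasDerivedCategory.{w} C]

/-- A morphism of four-term sequences induces a map on `ker e`, which splits it into morphisms of
the two short exact sequences; the two connecting morphisms are natural separately. -/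
lemma extClass_naturality {T J S F T' J' S' F' : CochainComplex C ℤ}
    (t : T ⟶ J) (m : J ⟶ S) (e : S ⟶ F) (htm : t ≫ m = 0) (hme : m ≫ e = 0) [Mono t] [Epi e]
    (h₁ : (ShortComplex.mk t m htm).Exact) (h₂ : (ShortComplex.mk m e hme).Exact)
    (t' : T' ⟶ J') (m' : J' ⟶ S') (e' : S' ⟶ F') (htm' : t' ≫ m' = 0) (hme' : m' ≫ e' = 0)
    [Mono t'] [Epi e']
    (h₁' : (ShortComplex.mk t' m' htm').Exact) (h₂' : (ShortComplex.mk m' e' hme').Exact)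
    (φT : T ⟶ T') (φJ : J ⟶ J') (φS : S ⟶ S') (φF : F ⟶ F')
    (ht : t ≫ φJ = φT ≫ t') (hm : m ≫ φS = φJ ≫ m') (he : e ≫ φF = φS ≫ e') :
    extClass t m e htm hme h₁ h₂ ≫ (DerivedCategory.Q.map φT)⟦(2 : ℤ)⟧' =
      DerivedCategory.Q.map φF ≫ extClass t' m' e' htm' hme' h₁' h₂' := by
  have n₁ := DerivedCategory.triangleOfSESδ_naturality (right_shortExact e) (right_shortExact e')
    { τ₁ := kernel.map e e' φS φF he, τ₂ := φS, τ₃ := φF, comm₁₂ := by simp, comm₂₃ := he.symm }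
  have n₂ := DerivedCategory.triangleOfSESδ_naturality (left_shortExact t m e htm hme h₁ h₂)
    (left_shortExact t' m' e' htm' hme' h₁' h₂')
    { τ₁ := φT, τ₂ := φJ, τ₃ := kernel.map e e' φS φF he
      comm₁₂ := ht.symm
      comm₂₃ := by
        rw [← cancel_mono (kernel.ι e')]
        simp [hm] }
  dsimp at n₁ n₂
  dsimp only [extClass]
  have n₃ := (shiftFunctorAdd' (DerivedCategory C) (1 : ℤ) 1 2 (by norm_num)).inv.naturality
    (DerivedCategory.Q.map φT)
  dsimp at n₃
  rw [Category.assoc, Category.assoc, ← n₃, ← Functor.map_comp_assoc, n₂, Functor.map_comp_assoc,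
    reassoc_of% n₁]

end

end YonedaTwo

/-! ### Conditions (ii) and (iv) force the local HKR class to vanish -/

namespace SplitSqZeroExtension

section

variable {k : Type v} {A I B : Type u} [Field k] [CommRing A] [Algebra k A]
  [AddCommGroup I] [Module A I] [CommRing B] [Algebra k B] (E : SplitSqZeroExtension k A I B)

/-- The monomorphism `torInclusion` is annihilated by `mul`, which is itself a monomorphism on
projectives. -/
lemma isZero_tor₁_of_projective (P : ModuleCat.{u} B) [Projective P] : IsZero (E.tor₁.obj P) := by
  have h : E.torInclusion.app P ≫ E.mul.app P = 0 :=
    LeftDerivedOne.connecting_comp E.mul E.toBaseChange E.mul_comp_toBaseChange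
      (fun P _ => E.projective_shortExact P) P
  have h₁ : Mono (E.torInclusion.app P) :=
    LeftDerivedOne.connecting_mono E.mul E.toBaseChange E.mul_comp_toBaseChange
      (fun P _ => E.projective_shortExact P) P
  have h₂ : Mono (E.mul.app P) := (E.projective_shortExact P).mono_f
  have h₃ : E.torInclusion.app P = 0 := zero_of_comp_mono (E.mul.app P) h
  exact IsZero.of_mono_eq_zero _ h₃

lemma admissible_of_isZero {K : CochainComplex (ModuleCat.{u} B) ℤ}
    (hK : ∀ n, IsZero (E.tor₁.obj (K.X n))) : E.Admissible K := fun n => by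
  rw [HomologicalComplex.exactAt_iff]
  exact ShortComplex.exact_of_isZero_X₂ _ (hK n)

section

variable [HasDerivedCategory.{w} (ModuleCat.{u} A)]

lemma isZero_Q_obj_of_acyclic {C : Type u} [Category.{v} C] [Abelian C] [HasDerivedCategory.{w} C]
    {K : CochainComplex C ℤ} (hK : K.Acyclic) : IsZero (DerivedCategory.Q.obj K) := by
  have : QuasiIso (0 : K ⟶ K) := by
    rw [quasiIso_iff]
    intro i
    rw [quasiIsoAt_iff_exactAt _ _ (hK i)]
    exact hK i
  have h : IsIso (DerivedCategory.Q.map (0 : K ⟶ K)) := inferInstance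
  rw [Functor.map_zero] at h
  rw [IsZero.iff_id_eq_zero, ← cancel_epi (0 : DerivedCategory.Q.obj K ⟶ _)]
  simp

lemma hkrClass_naturality {K L : CochainComplex (ModuleCat.{u} B) ℤ} (f : K ⟶ L) :
    E.hkrClass K ≫ (DerivedCategory.Q.map (E.tor₁C.map f))⟦(2 : ℤ)⟧' =
      DerivedCategory.Q.map (E.baseChangeC.map f) ≫ E.hkrClass L :=
  YonedaTwo.extClass_naturality _ _ _ _ _ _ _ _ _ _ _ _ _ _
    (E.tor₁C.map f) (E.idealTensorC.map f) (E.viaSectC.map f) (E.baseChangeC.map f)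
    ((NatTrans.mapHomologicalComplex E.torInclusion (.up ℤ)).naturality f).symm
    ((NatTrans.mapHomologicalComplex E.mul (.up ℤ)).naturality f).symm
    ((NatTrans.mapHomologicalComplex E.toBaseChange (.up ℤ)).naturality f).symm

lemma hkrClass_eq_zero_of_admissible {K : CochainComplex (ModuleCat.{u} B) ℤ}
    (hK : E.Admissible K) : E.hkrClass K = 0 :=
  ((shiftFunctor _ (2 : ℤ)).map_isZero (isZero_Q_obj_of_acyclic hK)).eq_of_tgt _ _

end

section

variable [HasDerivedCategory.{w} (ModuleCat.{u} A)] [HasDerivedCategory.{w'} (ModuleCat.{u} B)]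

/-- For a projective resolution `P → K` the class of `P` is zero, and `K ⊗ᴸ A → K̄` is identified
with `P̄ → K̄`. By naturality `θ_K` dies after composition with `K ⊗ᴸ A → K̄`; a section of that map
then gives `θ_K = 0`. -/
lemma hkrClass_eq_zero_of_section (K : CochainComplex (ModuleCat.{u} B) ℤ)
    (hK : ProjectiveModels.boundedAbove _ K)
    (s : DerivedCategory.Q.obj (E.baseChangeC.obj K) ⟶
      E.derivedBaseChange.obj (ProjectiveModels.toMinus K hK))
    (hs : s ≫ E.derivedToBaseChange K hK = 𝟙 _) : E.hkrClass K = 0 := by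
  obtain ⟨b, hb⟩ := id hK
  obtain ⟨P, p, hp, hP, hPb⟩ := ProjectiveModels.exists_projective K b
  have hP' : ProjectiveModels.boundedAbove _ P := ⟨b, hPb⟩
  have := ProjectiveModels.isIso_fromLeftDerivedMinus E.baseChange hP' hP
  have h := ProjectiveModels.fromLeftDerivedMinus_naturality E.baseChange p hP' hK
  have h₀ : E.hkrClass P = 0 := E.hkrClass_eq_zero_of_admissible
    (E.admissible_of_isZero fun n => have := hP n; E.isZero_tor₁_of_projective _)
  have h₁ := E.hkrClass_naturality p
  rw [h₀, zero_comp] at h₁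
  have h₂ : E.derivedToBaseChange K hK ≫ E.hkrClass K = 0 := by
    rw [← cancel_epi (E.derivedBaseChange.map (ProjectiveModels.toMinusMap p hP' hK)),
      reassoc_of% h]
    erw [← h₁]
    simp
  rw [← Category.id_comp (E.hkrClass K), ← hs, Category.assoc, h₂, comp_zero]

end

section

variable [HasDerivedCategory.{w} (ModuleCat.{u} A)]

lemma admissibleW_isInvertedBy_tor₁ :
    E.admissibleW.IsInvertedBy ((ProjectiveModels.homotopyMinus (ModuleCat.{u} B)).ι ⋙
      E.tor₁.mapHomotopyCategory (.up ℤ) ⋙ DerivedCategory.Qh) := by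
  intro X Y f hf
  exact ObjectProperty.inverseImage_trW_isInverted
    (P := HomotopyCategory.subcategoryAcyclic (ModuleCat.{u} A))
    (F := E.tor₁.mapHomotopyCategory (.up ℤ)) DerivedCategory.Qh _
    (ObjectProperty.trW_monotone inf_le_right _ hf)

/-- The functor `K ↦ Tor₁^B(K, A)` from the admissible derived category of `B` to the derived
category of `A`. -/
noncomputable def torAdm : E.DerivedAdm ⥤ DerivedCategory (ModuleCat.{u} A) :=
  Localization.Construction.lift _ E.admissibleW_isInvertedBy_tor₁

/-- The local HKR class as a natural transformation on the admissible derived category. -/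
noncomputable def hkrAdm : E.baseChangeAdm ⟶ E.torAdm ⋙ shiftFunctor _ (2 : ℤ) :=
  Localization.Construction.natTransExtension
    { app X := E.hkrClass X.obj.as
      naturality X Y f := by
        -- Naturality on homotopy classes is checked on a representing chain map. The extension to
        -- the localization needs nothing more, since both functors invert `admissibleW`.
        obtain ⟨g, hg⟩ := (HomotopyCategory.quotient _ _).map_surjective f.hom
        have h := E.hkrClass_naturality g
        have h₁ : DerivedCategory.Q.map (E.baseChangeC.map g) =
            DerivedCategory.Qh.map ((E.baseChange.mapHomotopyCategory (.up ℤ)).map f.hom) := by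
          rw [← hg]
          rfl
        have h₂ : DerivedCategory.Q.map (E.tor₁C.map g) =
            DerivedCategory.Qh.map ((E.tor₁.mapHomotopyCategory (.up ℤ)).map f.hom) := by
          rw [← hg]
          rfl
        have h₃ : E.baseChangeAdm.map (E.admissibleW.Q.map f) =
            DerivedCategory.Qh.map ((E.baseChange.mapHomotopyCategory (.up ℤ)).map f.hom) :=
          (Functor.congr_hom (Localization.Construction.fac _ E.admissibleW_isInvertedBy) f).trans
            ((Category.id_comp _).trans (Category.comp_id _))
        have h₄ : E.torAdm.map (E.admissibleW.Q.map f) =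
            DerivedCategory.Qh.map ((E.tor₁.mapHomotopyCategory (.up ℤ)).map f.hom) :=
          (Functor.congr_hom (Localization.Construction.fac _
            E.admissibleW_isInvertedBy_tor₁) f).trans
            ((Category.id_comp _).trans (Category.comp_id _))
        rw [h₁, h₂, ← h₃, ← h₄] at h
        exact h.symm }

/-- The class of an admissible complex has zero target. Naturality along `φ`, which need not come
from a chain map, carries the vanishing to `K` because the base change of `φ` can be cancelled. -/
lemma hkrClass_eq_zero_of_adm {V K : CochainComplex (ModuleCat.{u} B) ℤ}
    (hV : ProjectiveModels.boundedAbove _ V) (hK : ProjectiveModels.boundedAbove _ K)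
    (hV' : E.Admissible V) (φ : E.toDerivedAdm V hV ⟶ E.toDerivedAdm K hK)
    [IsIso (E.baseChangeAdm.map φ)] : E.hkrClass K = 0 := by
  have h := E.hkrAdm.naturality φ
  have h₁ : E.hkrAdm.app (E.toDerivedAdm V hV) = 0 :=
    (Localization.Construction.NatTransExtension.app_eq _ _).trans
      (E.hkrClass_eq_zero_of_admissible hV')
  have h₂ : E.hkrAdm.app (E.toDerivedAdm K hK) = E.hkrClass K :=
    Localization.Construction.NatTransExtension.app_eq _ _
  rw [h₁, zero_comp] at h
  exact h₂.symm.trans ((cancel_epi (E.baseChangeAdm.map φ)).1 (h.trans comp_zero.symm))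

end

end

end SplitSqZeroExtension

/-! ### Induction along the splitting and twisted differentials -/

namespace SplitSqZeroExtension

/-- `M ↦ I ⊗ M`. -/
noncomputable abbrev tensorI (A I : Type u) [CommRing A] [AddCommGroup I] [Module A I] :
    ModuleCat.{u} A ⥤ ModuleCat.{u} A :=
  MonoidalCategory.tensorLeft (ModuleCat.of A I)

/-- `M ↦ I ⊗ M`, termwise. -/
noncomputable abbrev tensorC (A I : Type u) [CommRing A] [AddCommGroup I] [Module A I] :
    CochainComplex (ModuleCat.{u} A) ℤ ⥤ CochainComplex (ModuleCat.{u} A) ℤ :=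
  (tensorI A I).mapHomologicalComplex (.up ℤ)

section

variable {k : Type v} {A I B : Type u} [Field k] [CommRing A] [Algebra k A]
  [AddCommGroup I] [Module A I] [CommRing B] [Algebra k B] (E : SplitSqZeroExtension k A I B)

/-- `M ↦ B ⊗_A M`, where `B` is an `A`-algebra via the splitting. -/
noncomputable abbrev induction : ModuleCat.{u} A ⥤ ModuleCat.{u} B :=
  ModuleCat.extendScalars.{u, u, u} E.sect.toRingHom

/-- `M ↦ B ⊗_A M` is left adjoint to restriction along the splitting. -/
noncomputable abbrev inductionAdj : E.induction ⊣ E.viaSect :=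
  ModuleCat.extendRestrictScalarsAdj.{u, u, u} E.sect.toRingHom

/-- `M ⟶ B ⊗_A M`. -/
noncomputable def toInduction (M : ModuleCat.{u} A) : M ⟶ E.viaSect.obj (E.induction.obj M) :=
  E.inductionAdj.unit.app M

/-- The `B`-linear extension to `B ⊗_A M` of an `A`-linear map out of `M`. -/
noncomputable def extend {M : ModuleCat.{u} A} {N : ModuleCat.{u} B} (g : M ⟶ E.viaSect.obj N) :
    E.induction.obj M ⟶ N :=
  (E.inductionAdj.homEquiv M N).symm g

@[simp]
lemma toInduction_extend {M : ModuleCat.{u} A} {N : ModuleCat.{u} B} (g : M ⟶ E.viaSect.obj N) :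
    E.toInduction M ≫ E.viaSect.map (E.extend g) = g :=
  (Adjunction.homEquiv_unit (adj := E.inductionAdj) (f := E.extend g)).symm.trans
    ((E.inductionAdj.homEquiv M N).apply_symm_apply g)

lemma induction_hom_ext {M : ModuleCat.{u} A} {N : ModuleCat.{u} B}
    {f g : E.induction.obj M ⟶ N}
    (h : E.toInduction M ≫ E.viaSect.map f = E.toInduction M ≫ E.viaSect.map g) : f = g :=
  (E.inductionAdj.homEquiv M N).injective
    ((Adjunction.homEquiv_unit (adj := E.inductionAdj) (f := f)).trans
      (h.trans (Adjunction.homEquiv_unit (adj := E.inductionAdj) (f := g)).symm))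

/-- `M ⟶ (B ⊗_A M) ⊗_B A`. -/
noncomputable def toBaseChangeInduction (M : ModuleCat.{u} A) :
    M ⟶ E.baseChange.obj (E.induction.obj M) :=
  E.toInduction M ≫ E.toBaseChange.app (E.induction.obj M)

lemma toBaseChangeInduction_extend {M : ModuleCat.{u} A} {N : ModuleCat.{u} B}
    (g : M ⟶ E.viaSect.obj N) :
    E.toBaseChangeInduction M ≫ E.baseChange.map (E.extend g) = g ≫ E.toBaseChange.app N := by
  have := E.toBaseChange.naturality (E.extend g)
  rw [toBaseChangeInduction, Category.assoc, ← this, reassoc_of% E.toInduction_extend]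

/-- The identity `N ⟶ N` as an `A`-linear map, with `A` acting on the target through `B`. -/
noncomputable def toViaSectViaProj (N : ModuleCat.{u} A) : N ⟶ E.viaSect.obj (E.viaProj.obj N) :=
  ModuleCat.ofHom (Y := E.viaSect.obj (E.viaProj.obj N))
    { toFun := fun x => x
      map_add' := fun _ _ => rfl
      map_smul' := fun a x => by
        change a • x = E.proj (E.sect a) • x
        rw [E.proj_sect] }

lemma fromBaseChange_toBaseChange {V : ModuleCat.{u} B} {N : ModuleCat.{u} A}
    (φ : E.baseChange.obj V ⟶ N) (v : V) :
    (((ModuleCat.extendRestrictScalarsAdj.{u, u, u} E.proj.toRingHom).homEquiv V N) φ).hom v =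
      φ.hom ((E.toBaseChange.app V).hom v) :=
  congr($(Adjunction.homEquiv_unit
    (adj := ModuleCat.extendRestrictScalarsAdj.{u, u, u} E.proj.toRingHom) (f := φ)).hom v)

/-- This is `(B ⊗_A M) ⊗_B A ≅ M`, a consequence of `proj ∘ sect = id`. The retraction is adjoint,
in two steps, to the identity of `M`; the two adjunctions also show that maps out of the target are
determined on `M`. -/
instance (M : ModuleCat.{u} A) : IsIso (E.toBaseChangeInduction M) := by
  have : IsSplitMono (E.toBaseChangeInduction M) := by
    let r : E.baseChange.obj (E.induction.obj M) ⟶ M :=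
      ((ModuleCat.extendRestrictScalarsAdj.{u, u, u} E.proj.toRingHom).homEquiv _ _).symm
        (E.extend (E.toViaSectViaProj M))
    refine ⟨⟨⟨r, ?_⟩⟩⟩
    ext x
    refine (E.fromBaseChange_toBaseChange r ((E.toInduction M).hom x)).symm.trans ?_
    rw [Equiv.apply_symm_apply]
    exact congr(($(E.toInduction_extend (E.toViaSectViaProj M))).hom x)
  have : Epi (E.toBaseChangeInduction M) := by
    refine ⟨fun g h w => ?_⟩
    apply ((ModuleCat.extendRestrictScalarsAdj.{u, u, u} E.proj.toRingHom).homEquiv _ _).injective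
    apply E.induction_hom_ext
    ext x
    exact (E.fromBaseChange_toBaseChange g ((E.toInduction M).hom x)).trans
      (congr(($w).hom x).trans
        (E.fromBaseChange_toBaseChange h ((E.toInduction M).hom x)).symm)
  exact isIso_of_epi_of_isSplitMono _

/-- The inclusion `I ⊗ M ⟶ B ⊗_A M`. -/
noncomputable def tensorToInduction (M : ModuleCat.{u} A) :
    (tensorI A I).obj M ⟶ E.viaSect.obj (E.induction.obj M) :=
  (tensorI A I).map (E.toBaseChangeInduction M) ≫ E.mul.app (E.induction.obj M)

@[simp]
lemma mul_toBaseChange (V : ModuleCat.{u} B) : E.mul.app V ≫ E.toBaseChange.app V = 0 :=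
  congr_app E.mul_comp_toBaseChange V

lemma tensorToInduction_toBaseChange (M : ModuleCat.{u} A) :
    E.tensorToInduction M ≫ E.toBaseChange.app (E.induction.obj M) = 0 := by
  rw [tensorToInduction, Category.assoc, mul_toBaseChange, comp_zero]

/-- Multiplication by `I` factors through the base change, so on `I ⊗ M` the extension of `g` only
sees `g` modulo `I N`. -/
lemma tensorToInduction_extend {M : ModuleCat.{u} A} {N : ModuleCat.{u} B}
    (g : M ⟶ E.viaSect.obj N) :
    E.tensorToInduction M ≫ E.viaSect.map (E.extend g) =
      (tensorI A I).map (g ≫ E.toBaseChange.app N) ≫ E.mul.app N := by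
  have := E.mul.naturality (E.extend g)
  rw [tensorToInduction, Category.assoc, ← this, ← toBaseChangeInduction_extend, Functor.map_comp,
    Category.assoc]
  rfl

end

/-- A twisting cochain: a cocycle `Y ⟶ I ⊗ Y` of degree one. -/
structure TwistingCochain {A : Type u} (I : Type u) [CommRing A] [AddCommGroup I] [Module A I]
    (Y : CochainComplex (ModuleCat.{u} A) ℤ) where
  v (i j : ℤ) (h : i + 1 = j) : Y.X i ⟶ (tensorI A I).obj (Y.X j)
  comm (i j l : ℤ) (h : i + 1 = j) (h' : j + 1 = l) :
    v i j h ≫ (tensorI A I).map (Y.d j l) + Y.d i j ≫ v j l h' = 0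

section Twist

variable {k : Type v} {A I B : Type u} [Field k] [CommRing A] [Algebra k A]
  [AddCommGroup I] [Module A I] [CommRing B] [Algebra k B] (E : SplitSqZeroExtension k A I B)
  {Y : CochainComplex (ModuleCat.{u} A) ℤ} (a : TwistingCochain I Y)

/-- The differential of `B ⊗_A Y` twisted by a cocycle `Y ⟶ I ⊗ Y`, restricted to `Y`. -/
noncomputable def twistD (i j : ℤ) (h : i + 1 = j) :
    Y.X i ⟶ E.viaSect.obj (E.induction.obj (Y.X j)) :=
  Y.d i j ≫ E.toInduction (Y.X j) + a.v i j h ≫ E.tensorToInduction (Y.X j)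

lemma twistD_toBaseChange (i j : ℤ) (h : i + 1 = j) :
    E.twistD a i j h ≫ E.toBaseChange.app _ = Y.d i j ≫ E.toBaseChangeInduction (Y.X j) := by
  rw [twistD, Preadditive.add_comp, Category.assoc, Category.assoc,
    tensorToInduction_toBaseChange, comp_zero, add_zero, toBaseChangeInduction]

lemma twistD_extend (i j : ℤ) (h : i + 1 = j) {N : ModuleCat.{u} B}
    (g : Y.X j ⟶ E.viaSect.obj N) :
    E.twistD a i j h ≫ E.viaSect.map (E.extend g) = Y.d i j ≫ g +
      a.v i j h ≫ (tensorI A I).map (g ≫ E.toBaseChange.app N) ≫ E.mul.app N := by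
  rw [twistD, Preadditive.add_comp, Category.assoc, Category.assoc, toInduction_extend,
    tensorToInduction_extend]

/-- The complex `B ⊗_A Y` with differential twisted by a cocycle `Y ⟶ I ⊗ Y` of degree one. -/
noncomputable def twist : CochainComplex (ModuleCat.{u} B) ℤ where
  X n := E.induction.obj (Y.X n)
  d i j := if h : i + 1 = j then E.extend (E.twistD a i j h) else 0
  shape i j h := dif_neg h
  d_comp_d' i j l hij hjl := by
    have hij : i + 1 = j := hij
    have hjl : j + 1 = l := hjl
    rw [dif_pos hij, dif_pos hjl]
    apply E.induction_hom_ext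
    -- Of the four terms of the square, `d ∘ d` vanishes, the term quadratic in `a` vanishes because
    -- `I² = 0`, and the two mixed terms cancel by the cocycle condition.
    have h₁ := a.comm i j l hij hjl
    rw [Functor.map_comp, reassoc_of% E.toInduction_extend, twistD_extend, twistD_toBaseChange, twistD,
      Preadditive.comp_add, Y.d_comp_d_assoc, zero_comp, zero_add, Functor.map_comp,
      Category.assoc, Functor.map_zero, comp_zero, ← tensorToInduction]
    rw [← Category.assoc, ← Category.assoc (a.v i j hij), ← Preadditive.add_comp, add_comm, h₁,
      zero_comp]

lemma twist_d (i j : ℤ) (h : i + 1 = j) : (E.twist a).d i j = E.extend (E.twistD a i j h) :=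
  dif_pos h

/-- `Y` is the base change of a twist of `B ⊗_A Y`. -/
noncomputable def twistIso : Y ≅ E.baseChangeC.obj (E.twist a) :=
  HomologicalComplex.Hom.isoOfComponents (fun n =>
    show Y.X n ≅ E.baseChange.obj (E.induction.obj (Y.X n)) from
      asIso (E.toBaseChangeInduction (Y.X n)))
    (fun i j h => by
      have h : i + 1 = j := h
      refine Eq.trans ?_ ((E.toBaseChangeInduction_extend (E.twistD a i j h)).trans
        (E.twistD_toBaseChange a i j h))
      exact congr_arg (fun d : E.induction.obj (Y.X i) ⟶ E.induction.obj (Y.X j) =>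
        E.toBaseChangeInduction (Y.X i) ≫ E.baseChange.map d) (E.twist_d a i j h))

/-- Morphisms out of a twist of `B ⊗_A Y`. -/
noncomputable def twistDesc {K : CochainComplex (ModuleCat.{u} B) ℤ}
    (u : ∀ n, Y.X n ⟶ E.viaSect.obj (K.X n))
    (hu : ∀ i j (h : i + 1 = j), u i ≫ E.viaSect.map (K.d i j) = Y.d i j ≫ u j +
      a.v i j h ≫ (tensorI A I).map (u j ≫ E.toBaseChange.app (K.X j)) ≫ E.mul.app (K.X j)) :
    E.twist a ⟶ K where
  f n := E.extend (u n)
  comm' i j h := by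
    have h : i + 1 = j := h
    have h' := E.twist_d a i j h
    generalize (E.twist a).d i j = d at h'
    change E.extend (u i) ≫ K.d i j =
      (show E.induction.obj (Y.X i) ⟶ E.induction.obj (Y.X j) from d) ≫ E.extend (u j)
    subst h'
    apply E.induction_hom_ext
    rw [Functor.map_comp, Functor.map_comp, reassoc_of% E.toInduction_extend,
      reassoc_of% E.toInduction_extend, twistD_extend, hu i j h]

lemma twistIso_baseChange_twistDesc {K : CochainComplex (ModuleCat.{u} B) ℤ}
    (u : ∀ n, Y.X n ⟶ E.viaSect.obj (K.X n))
    (hu : ∀ i j (h : i + 1 = j), u i ≫ E.viaSect.map (K.d i j) = Y.d i j ≫ u j +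
      a.v i j h ≫ (tensorI A I).map (u j ≫ E.toBaseChange.app (K.X j)) ≫ E.mul.app (K.X j))
    (n : ℤ) :
    ((E.twistIso a).hom ≫ E.baseChangeC.map (E.twistDesc a u hu)).f n =
      u n ≫ E.toBaseChange.app (K.X n) :=
  E.toBaseChangeInduction_extend (u n)

lemma projective_twist (hY : ∀ n, Projective (Y.X n)) (n : ℤ) :
    Projective ((E.twist a).X n) :=
  E.inductionAdj.map_projective _ (hY n)

lemma isStrictlyLE_twist (b : ℤ) [Y.IsStrictlyLE b] : (E.twist a).IsStrictlyLE b := by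
  rw [CochainComplex.isStrictlyLE_iff]
  intro i hi
  exact E.induction.map_isZero (Y.isZero_of_isStrictlyLE b i hi)

end Twist

end SplitSqZeroExtension

/-! ### Connecting morphisms represented by degree one cocycles -/

namespace CochainComplex

open HomComplex

section

variable {C : Type u} [Category.{v} C] [Abelian C]

/-- Projectivity lifts `ρ` degree by degree. The lift need not commute with differentials, but its
failure to do so maps to zero in `S.X₃` and so comes from a cocycle with values in `S.X₁`. -/
lemma exists_lift_cochain {S : ShortComplex (CochainComplex C ℤ)} (hS : S.ShortExact)
    {R : CochainComplex C ℤ} [∀ n, Projective (R.X n)] (ρ : R ⟶ S.X₃) :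
    ∃ (u : Cochain R S.X₂ 0) (γ : Cocycle R S.X₁ 1),
      u.comp (Cochain.ofHom S.g) (add_zero 0) = Cochain.ofHom ρ ∧
      δ 0 1 u = γ.1.comp (Cochain.ofHom S.f) (add_zero 1) := by
  have := hS.mono_f
  have := hS.epi_g
  let u : Cochain R S.X₂ 0 := Cochain.ofHoms fun n => Projective.factorThru (ρ.f n) (S.g.f n)
  have hu : u.comp (Cochain.ofHom S.g) (add_zero 0) = Cochain.ofHom ρ := by
    ext n
    simp [u]
  have hu' : (δ 0 1 u).comp (Cochain.ofHom S.g) (add_zero 1) = 0 := by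
    rw [← δ_comp_ofHom, hu, δ_ofHom]
  have hv (p q : ℤ) (hpq : p + 1 = q) : (δ 0 1 u).v p q hpq ≫ S.g.f q = 0 := by
    have := congr($(hu').v p q hpq)
    rwa [Cochain.comp_zero_cochain_v, Cochain.ofHom_v, Cochain.zero_v] at this
  have hex : ∀ n, ((S.map (HomologicalComplex.eval _ _ n))).ShortExact := fun n =>
    hS.map_of_exact (HomologicalComplex.eval _ _ n)
  let γ : Cochain R S.X₁ 1 := Cochain.mk fun p q hpq =>
    have := (hex q).mono_f
    (hex q).exact.lift ((δ 0 1 u).v p q hpq) (hv p q hpq)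
  have hγ : γ.comp (Cochain.ofHom S.f) (add_zero 1) = δ 0 1 u := by
    ext p q hpq
    have := (hex q).mono_f
    rw [Cochain.comp_zero_cochain_v, Cochain.ofHom_v]
    exact (hex q).exact.lift_f ((δ 0 1 u).v p q hpq) (hv p q hpq)
  refine ⟨u, Cocycle.mk γ 2 (by norm_num) ?_, hu, hγ.symm⟩
  have h : (δ 1 2 γ).comp (Cochain.ofHom S.f) (add_zero 2) = 0 := by
    rw [← δ_comp_ofHom, hγ, δ_δ]
  ext p q hpq
  rw [← cancel_mono (S.f.f q)]
  simpa using congr($(h).v p q hpq)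

variable [HasDerivedCategory.{w} C]

/-- The connecting morphism is read off from the cone of `S.f`, which replaces `S.X₃`; the pair
formed by `u` and the cocycle is exactly a lift of `ρ` to that cone. -/
lemma Q_map_triangleOfSESδ {S : ShortComplex (CochainComplex C ℤ)} (hS : S.ShortExact)
    {R : CochainComplex C ℤ} (ρ : R ⟶ S.X₃) (u : Cochain R S.X₂ 0) (γ : Cocycle R S.X₁ 1)
    (hu : u.comp (Cochain.ofHom S.g) (add_zero 0) = Cochain.ofHom ρ)
    (hγ : δ 0 1 u = γ.1.comp (Cochain.ofHom S.f) (add_zero 1)) :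
    DerivedCategory.Q.map ρ ≫ DerivedCategory.triangleOfSESδ hS =
      DerivedCategory.Q.map (Cocycle.equivHomShift.symm γ) ≫
        (DerivedCategory.Q.commShiftIso (1 : ℤ)).hom.app S.X₁ := by
  -- The sign serves twice: a lift to the cone needs `δ u` plus its first component to vanish, and
  -- the third map of the cone triangle is minus the first projection.
  let l : R ⟶ mappingCone S.f := mappingCone.lift S.f (-γ) u (by
    rw [hγ, Cocycle.coe_neg, Cochain.neg_comp, add_neg_cancel])
  have h₁ : l ≫ mappingCone.descShortComplex S = ρ := by
    ext n
    have := congr($(hu).v n n (add_zero n))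
    simp only [Cochain.comp_zero_cochain_v, Cochain.ofHom_v] at this
    refine (mappingCone.lift_desc_f (φ := S.f) (-γ) u _ _ _ _ n (n + 1) rfl).trans ?_
    rw [this]
    simp
  have h₂ : l ≫ (show mappingCone S.f ⟶ S.X₁⟦(1 : ℤ)⟧ from (mappingCone.triangle S.f).mor₃) =
      Cocycle.equivHomShift.symm γ := by
    have h : Cocycle.equivHomShift.symm (- mappingCone.fst S.f) =
      (show mappingCone S.f ⟶ S.X₁⟦(1 : ℤ)⟧ from (mappingCone.triangle S.f).mor₃) := rfl
    rw [← h, ← Cocycle.equivHomShift_symm_precomp]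
    congr 1
    ext p q hpq
    simp [l]
  have h₃ := DerivedCategory.descShortComplex_triangleOfSESδ hS
  rw [← h₁, Functor.map_comp, Category.assoc, h₃, ← Category.assoc]
  congr 1
  exact (Functor.map_comp _ _ _).symm.trans (congr_arg _ h₂)

/-- Any lift of `ρ` has some defect `γ` representing the same derived morphism as `β`. As `R` is
K-projective, the two cocycles differ by a coboundary, and altering the lift by a cochain with
values in `S.X₁` makes the defect equal to `β` itself. -/
lemma exists_cochain_of_Q_map_triangleOfSESδ {S : ShortComplex (CochainComplex C ℤ)}
    (hS : S.ShortExact) {R : CochainComplex C ℤ} [∀ n, Projective (R.X n)] [R.IsKProjective]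
    (ρ : R ⟶ S.X₃) (β : Cocycle R S.X₁ 1)
    (h : DerivedCategory.Q.map ρ ≫ DerivedCategory.triangleOfSESδ hS =
      DerivedCategory.Q.map (Cocycle.equivHomShift.symm β) ≫
        (DerivedCategory.Q.commShiftIso (1 : ℤ)).hom.app S.X₁) :
    ∃ u : Cochain R S.X₂ 0, u.comp (Cochain.ofHom S.g) (add_zero 0) = Cochain.ofHom ρ ∧
      δ 0 1 u = β.1.comp (Cochain.ofHom S.f) (add_zero 1) := by
  obtain ⟨u, γ, hu, hγ⟩ := exists_lift_cochain hS ρ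
  rw [Q_map_triangleOfSESδ hS ρ u γ hu hγ, cancel_mono] at h
  obtain ⟨H⟩ := ProjectiveModels.homotopy_of_Q_map_eq _ _ h
  obtain ⟨z, hz⟩ := (Cochain.equivHomotopy _ _) H
  let z' := z.rightUnshift 0 (by norm_num)
  have hz' : γ.1 = -δ 0 1 z' + β.1 := by
    have := congr_arg (fun c => Cochain.rightUnshift c 1 (by norm_num)) hz
    replace this := this.trans (Cochain.rightUnshift_add _ _ _ _)
    have h₁ := Cochain.δ_rightUnshift z 0 (by norm_num) 1 0 (by norm_num)
    have h₂ : ∀ γ : Cocycle R S.X₁ 1, (Cochain.ofHom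
        (Cocycle.equivHomShift.symm γ)).rightUnshift 1 (by norm_num) = γ.1 := fun γ =>
      congr_arg Subtype.val (Cocycle.equivHomShift.apply_symm_apply γ)
    refine (h₂ γ).symm.trans (this.trans ?_)
    rw [h₂ β, h₁]
    simp
  refine ⟨u + z'.comp (Cochain.ofHom S.f) (add_zero 0), ?_, ?_⟩
  · rw [Cochain.add_comp, hu, Cochain.comp_assoc_of_second_is_zero_cochain, ← Cochain.ofHom_comp,
      S.zero, Cochain.ofHom_zero, Cochain.comp_zero, add_zero]
  · rw [δ_add, δ_comp_ofHom, hγ, hz', Cochain.add_comp, Cochain.neg_comp]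
    abel

end

end CochainComplex

/-! ### Consequence of a vanishing class -/

namespace YonedaTwo

variable {C : Type u} [Category.{v} C] [Abelian C]
  {T J S F : CochainComplex C ℤ} (t : T ⟶ J) (m : J ⟶ S) (e : S ⟶ F)
  (htm : t ≫ m = 0) (hme : m ≫ e = 0)

lemma exists_factor_of_extClass_eq_zero [HasDerivedCategory.{w} C] [Mono t] [Epi e]
    (h₁ : (ShortComplex.mk t m htm).Exact) (h₂ : (ShortComplex.mk m e hme).Exact)
    (h : extClass t m e htm hme h₁ h₂ = 0) :
    ∃ a : DerivedCategory.Q.obj F ⟶ (DerivedCategory.Q.obj J)⟦(1 : ℤ)⟧,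
      DerivedCategory.triangleOfSESδ (right_shortExact e) =
        a ≫ (DerivedCategory.Q.map (kernel.lift e m hme))⟦(1 : ℤ)⟧' := by
  have hT := DerivedCategory.triangleOfSES_distinguished
    (left_shortExact t m e htm hme h₁ h₂)
  -- Three rotations give the shifted triangle with all its maps negated, so a morphism to `ker e
  -- [1]` killed by the connecting morphism factors through `J[1]`; the sign is absorbed in `-g`.
  have hT' := Pretriangulated.rot_of_distTriang _ (Pretriangulated.rot_of_distTriang _
    (Pretriangulated.rot_of_distTriang _ hT))
  have h' : DerivedCategory.triangleOfSESδ (right_shortExact e) ≫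
      (DerivedCategory.triangleOfSESδ (left_shortExact t m e htm hme h₁ h₂))⟦(1 : ℤ)⟧' = 0 := by
    refine (cancel_mono ((shiftFunctorAdd' (DerivedCategory C) (1 : ℤ) 1 2 (by norm_num)).inv.app
      (DerivedCategory.Q.obj T))).1 ?_
    exact (Category.assoc _ _ _).trans (h.trans zero_comp.symm)
  obtain ⟨g, hg⟩ := Pretriangulated.Triangle.coyoneda_exact₃ _ hT'
    (DerivedCategory.triangleOfSESδ (right_shortExact e))
    ((Preadditive.comp_neg _ _).trans (by rw [neg_eq_zero]; exact h'))
  exact ⟨-g, hg.trans ((Preadditive.comp_neg _ _).trans (Preadditive.neg_comp _ _).symm)⟩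

end YonedaTwo

/-! ### From a vanishing class to a complex of projectives over `K` -/

namespace SplitSqZeroExtension

open CochainComplex HomComplex

section

variable {A I : Type u} [CommRing A] [AddCommGroup I] [Module A I]

instance [Module.Flat A I] : PreservesFiniteLimits (tensorI A I) := inferInstance

instance [Module.Flat A I] {Y Z : CochainComplex (ModuleCat.{u} A) ℤ} (f : Y ⟶ Z) [QuasiIso f] :
    QuasiIso ((tensorC A I).map f) := inferInstance

/-- A cocycle of degree one `Y ⟶ I ⊗ Y` is a twisting cochain. -/
noncomputable def TwistingCochain.ofCocycle {Y : CochainComplex (ModuleCat.{u} A) ℤ}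
    (c : Cocycle Y ((tensorC A I).obj Y) 1) : TwistingCochain I Y where
  v i j h := c.1.v i j h
  comm i j l h h' := by
    have := congr($(c.δ_eq_zero 2).v i l (by omega))
    rw [δ_v 1 2 (by norm_num) c.1 i l (by omega) j j (by omega) h] at this
    -- The sign in the coboundary of a degree one cochain is `(-1)²`, which is why
    -- `TwistingCochain.comm` is a sum.
    rw [Int.negOnePow_even 2 (by decide), one_smul] at this
    exact this

end

variable {k : Type v} {A I B : Type u} [Field k] [CommRing A] [Algebra k A]
  [AddCommGroup I] [Module A I] [CommRing B] [Algebra k B] (E : SplitSqZeroExtension k A I B)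

/-- The twisting cochain comes from the vanishing of the class: the extension `K` of `K̄` is induced
by an element of `Ext¹(K̄, I ⊗ K̄)`, which on a resolution `R` of `K̄` is a cocycle `R → I ⊗ R`.
Some lift `R → K` of `R → K̄` fails to be a chain map exactly by the product with this cocycle, and
therefore extends to a chain map from the twist of `B ⊗_A R`. -/
lemma exists_projective_of_hkrClass_eq_zero [Module.Flat A I]
    [HasDerivedCategory.{w} (ModuleCat.{u} A)] (K : CochainComplex (ModuleCat.{u} B) ℤ) (b : ℤ)
    [K.IsStrictlyLE b] (hK : E.hkrClass K = 0) :
    ∃ (S : CochainComplex (ModuleCat.{u} B) ℤ) (f : S ⟶ K),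
      (∀ n, Projective (S.X n)) ∧ S.IsStrictlyLE b ∧ QuasiIso (E.baseChangeC.map f) ∧
      ∀ n, Function.Surjective ((E.baseChangeC.map f).f n) := by
  have : (E.baseChangeC.obj K).IsStrictlyLE b := by
    rw [isStrictlyLE_iff]
    exact fun i hi => E.baseChange.map_isZero (K.isZero_of_isStrictlyLE b i hi)
  obtain ⟨R, ρ, hρ, hR, hRb, hρ'⟩ := exists_projective_surjective (E.baseChangeC.obj K) b
  have : R.IsKProjective := ProjectiveModels.isKProjective_of_boundedAbove ⟨b, hRb⟩ hR
  obtain ⟨a, ha⟩ := YonedaTwo.exists_factor_of_extClass_eq_zero _ _ _ _ _ _ _ hK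
  let ρI : (tensorC A I).obj R ⟶ E.idealTensorC.obj K := (tensorC A I).map ρ
  have : QuasiIso ρI := inferInstanceAs (QuasiIso ((tensorC A I).map ρ))
  -- Flatness of `I` makes `I ⊗ ρ` invertible in the derived category, so `a` can be moved from `K̄`
  -- to `R` at both ends; K-projectivity then represents it by a chain map.
  obtain ⟨α, hα⟩ := ProjectiveModels.exists_map_eq (DerivedCategory.Q.map ρ ≫ a ≫
    (inv (DerivedCategory.Q.map ρI))⟦(1 : ℤ)⟧' ≫
    (DerivedCategory.Q.commShiftIso (1 : ℤ)).inv.app _)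
  let c := Cocycle.equivHomShift α
  let j := kernel.lift (E.toBaseChangeC K) (E.mulC K) (E.mulC_toBaseChangeC K)
  obtain ⟨u, hu, hu'⟩ := exists_cochain_of_Q_map_triangleOfSESδ
    (YonedaTwo.right_shortExact (E.toBaseChangeC K)) ρ (c.postcomp (ρI ≫ j)) (by
      rw [Cocycle.equivHomShift_symm_postcomp, AddEquiv.symm_apply_apply, Functor.map_comp, hα, ha]
      have := DerivedCategory.Q.commShiftIso_hom_naturality (ρI ≫ j) (1 : ℤ)
      simp only [Category.assoc]
      rw [this, Iso.inv_hom_id_app_assoc, ← Functor.map_comp, Functor.map_comp _ ρI,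
        IsIso.inv_hom_id_assoc])
  let un (n : ℤ) : R.X n ⟶ E.viaSect.obj (K.X n) := u.v n n (add_zero n)
  have hv (n : ℤ) : un n ≫ E.toBaseChange.app (K.X n) = ρ.f n := by
    have := congr($(hu).v n n (add_zero n))
    simp only [Cochain.comp_zero_cochain_v, Cochain.ofHom_v] at this
    exact this
  let tw := TwistingCochain.ofCocycle c
  let f : E.twist tw ⟶ K := E.twistDesc tw un fun p q hpq => by
    have h₁ := congr($(hu').v p q hpq)
    rw [δ_zero_cochain_v, Cochain.comp_zero_cochain_v, Cochain.ofHom_v] at h₁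
    have h₂ : (c.postcomp (ρI ≫ j)).1.v p q hpq = c.1.v p q hpq ≫ (ρI ≫ j).f q :=
      Cochain.comp_zero_cochain_v _ _ _ _ _
    have h₃ : (ρI ≫ j).f q ≫ (kernel.ι (E.toBaseChangeC K)).f q =
        ρI.f q ≫ E.mul.app (K.X q) := by
      have : (ρI ≫ j) ≫ kernel.ι (E.toBaseChangeC K) = ρI ≫ E.mulC K := by simp [j]
      exact congr($(this).f q)
    refine Eq.trans ?_ (congr_arg (fun x => R.d p q ≫ un q + tw.v p q hpq ≫ (tensorI A I).map x ≫
      E.mul.app (K.X q)) (hv q).symm)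
    refine (sub_eq_iff_eq_add'.1 (h₁.trans ?_))
    rw [h₂]
    exact (Category.assoc _ _ _).trans (congr_arg _ h₃)
  have hf : (E.twistIso tw).hom ≫ E.baseChangeC.map f = ρ := by
    ext n : 1
    exact (E.twistIso_baseChange_twistDesc _ _ _ n).trans (hv n)
  refine ⟨E.twist tw, f, E.projective_twist tw hR, E.isStrictlyLE_twist tw b, ?_, fun n => ?_⟩
  · rw [← quasiIso_iff_comp_left (E.twistIso tw).hom, hf]
    exact hρ
  · intro y
    obtain ⟨x, hx⟩ := hρ' n y
    exact ⟨(E.twistIso tw).hom.f n x, (congr($(hf).f n x)).trans hx⟩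

end SplitSqZeroExtension

/-! ### The canonical truncation on elements -/

namespace CochainComplex

open ComplexShape

variable {R : Type u} [Ring R] (K : CochainComplex (ModuleCat.{u} R) ℤ) (c : ℤ)

lemma πTruncGE_surjective (n : ℤ) : Function.Surjective ((K.πTruncGE c).f n) :=
  (ModuleCat.epi_iff_surjective _).1
    (inferInstanceAs (Epi ((HomologicalComplex.πTruncGE K (embeddingUpIntGE c)).f n)))

lemma isIso_πTruncGE_f (n : ℤ) (hn : c < n) : IsIso ((K.πTruncGE c).f n) := by
  obtain ⟨j, hj⟩ := Int.le.dest hn.le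
  have hj' : (embeddingUpIntGE c).f j = n := hj
  refine ((embeddingUpIntGE c).isIso_liftExtend_f_iff _ (K.restrictionToTruncGE'_hasLift _) hj').2 ?_
  refine K.isIso_restrictionToTruncGE' _ j ?_
  rw [boundaryGE_embeddingUpIntGE_iff]
  omega

/-- In its lowest degree the truncation is the cokernel of the incoming differential. -/
lemma exists_d_eq_of_πTruncGE_eq_zero (m : ℤ) (hm : m + 1 = c) (x : K.X c)
    (hx : (K.πTruncGE c).f c x = 0) : ∃ y : K.X m, K.d m c y = x := by
  have hj : (embeddingUpIntGE c).f 0 = c := by simp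
  have hb : (embeddingUpIntGE c).BoundaryGE 0 := by rw [boundaryGE_embeddingUpIntGE_iff]
  have h₁ : (K.πTruncGE c).f c = K.pOpcycles c ≫ (K.truncGEXIsoOpcycles c).inv := by
    refine ((embeddingUpIntGE c).liftExtend_f _ (K.restrictionToTruncGE'_hasLift _) hj).trans ?_
    rw [K.restrictionToTruncGE'_f_eq_iso_hom_pOpcycles_iso_inv _ hj hb]
    simp [truncGEXIsoOpcycles, HomologicalComplex.truncGEXIsoOpcycles]
    rfl
  have h₂ : K.pOpcycles c x = 0 := by
    have := congr((K.truncGEXIsoOpcycles c).hom $(hx))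
    rw [h₁, map_zero] at this
    simpa using this
  have h₃ : (ShortComplex.mk (K.d m c) (K.pOpcycles c) (by simp)).Exact :=
    ShortComplex.exact_of_g_is_cokernel _ (K.opcyclesIsCokernel m c (by simp [← hm]))
  exact (ShortComplex.moduleCat_exact_iff _).1 h₃ x h₂

lemma isZero_truncGE_X (n : ℤ) (hn : n < c) : IsZero ((K.truncGE c).X n) :=
  (K.truncGE c).isZero_of_isStrictlyGE c n hn

lemma isStrictlyLE_truncGE (b : ℤ) [K.IsStrictlyLE b] : (K.truncGE c).IsStrictlyLE b := by
  rw [isStrictlyLE_iff]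
  intro i hi
  have := (ModuleCat.epi_iff_surjective _).2 (K.πTruncGE_surjective c i)
  exact IsZero.of_epi ((K.πTruncGE c).f i) (K.isZero_of_isStrictlyLE b i hi)

end CochainComplex

/-! ### Truncating a complex of projectives -/

namespace SplitSqZeroExtension

open CochainComplex

variable {k : Type v} {A I B : Type u} [Field k] [CommRing A] [Algebra k A]
  [AddCommGroup I] [Module A I] [CommRing B] [Algebra k B] (E : SplitSqZeroExtension k A I B)

/-- The multiplication map `I ⊗ (V ⊗_B A) ⟶ V` on elements. -/
noncomputable def mulElt (V : ModuleCat.{u} B) : E.idealTensor.obj V →+ V :=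
  (E.mul.app V).hom.toAddMonoidHom

/-- The map `V ⟶ V ⊗_B A` on elements. -/
noncomputable def bcElt (V : ModuleCat.{u} B) : V →+ E.baseChange.obj V :=
  (E.toBaseChange.app V).hom.toAddMonoidHom

lemma bcElt_surjective (V : ModuleCat.{u} B) : Function.Surjective (E.bcElt V) :=
  E.toBaseChange_surjective V

lemma bcElt_eq_zero_iff {V : ModuleCat.{u} B} (x : V) :
    E.bcElt V x = 0 ↔ ∃ y, E.mulElt V y = x :=
  E.mul_toBaseChange_exact V x

lemma bcElt_mulElt {V : ModuleCat.{u} B} (x : E.idealTensor.obj V) :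
    E.bcElt V (E.mulElt V x) = 0 :=
  (E.bcElt_eq_zero_iff _).2 ⟨x, rfl⟩

lemma bcElt_naturality {V W : ModuleCat.{u} B} (f : V ⟶ W) (x : V) :
    E.baseChange.map f (E.bcElt V x) = E.bcElt W (f x) :=
  (congr($(E.toBaseChange.naturality f) x)).symm

lemma mulElt_naturality {V W : ModuleCat.{u} B} (f : V ⟶ W) (x : E.idealTensor.obj V) :
    f (E.mulElt V x) = E.mulElt W (E.idealTensor.map f x) :=
  (congr($(E.mul.naturality f) x)).symm

lemma mulElt_injective (P : ModuleCat.{u} B) [Projective P] : Function.Injective (E.mulElt P) :=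
  E.mul_injective P

lemma baseChange_map_surjective {V W : ModuleCat.{u} B} (f : V ⟶ W) (hf : Function.Surjective f) :
    Function.Surjective (E.baseChange.map f) := by
  have := (ModuleCat.epi_iff_surjective f).2 hf
  exact (ModuleCat.epi_iff_surjective _).1 inferInstance

lemma tensorI_map_surjective {M N : ModuleCat.{u} A} (f : M ⟶ N) (hf : Function.Surjective f) :
    Function.Surjective ((tensorI A I).map f) := by
  have := (ModuleCat.epi_iff_surjective f).2 hf
  exact (ModuleCat.epi_iff_surjective _).1 inferInstance

lemma torInclusion_injective (V : ModuleCat.{u} B) :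
    Function.Injective (E.torInclusion.app V) :=
  (ModuleCat.mono_iff_injective _).1 (LeftDerivedOne.connecting_mono E.mul E.toBaseChange
    E.mul_comp_toBaseChange (fun P _ => E.projective_shortExact P) V)

lemma mulElt_eq_zero_iff {V : ModuleCat.{u} B} (x : E.idealTensor.obj V) :
    E.mulElt V x = 0 ↔ ∃ y, E.torInclusion.app V y = x :=
  (ShortComplex.ShortExact.moduleCat_exact_iff_function_exact _).1
    (LeftDerivedOne.connecting_exact E.mul E.toBaseChange E.mul_comp_toBaseChange
      (fun P _ => E.projective_shortExact P) V) x

lemma torInclusion_naturality {V W : ModuleCat.{u} B} (f : V ⟶ W) (x : E.tor₁.obj V) :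
    E.idealTensor.map f (E.torInclusion.app V x) = E.torInclusion.app W (E.tor₁.map f x) :=
  (congr($(E.torInclusion.naturality f) x)).symm

lemma isZero_tor₁_of_injective (V : ModuleCat.{u} B) (h : Function.Injective (E.mulElt V)) :
    IsZero (E.tor₁.obj V) := by
  refine (ModuleCat.isZero_iff_subsingleton).2 ⟨fun x y => ?_⟩
  have (z : E.tor₁.obj V) : z = 0 := by
    apply E.torInclusion_injective V
    rw [map_zero]
    exact h (((E.mulElt_eq_zero_iff _).2 ⟨z, rfl⟩).trans (map_zero _).symm)
  rw [this x, this y]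

section

variable {S : CochainComplex (ModuleCat.{u} B) ℤ}

/-- Only degree `c` matters. If the product of `y ∈ I ⊗ S̄` becomes zero in the truncation, it
equals `d s`. The class of `s` in `S̄` is a cycle, so by exactness `s` is a boundary plus the
product of some `z`. Injectivity of multiplication on projectives gives `y = d z`, which dies in the
truncation. -/
lemma mulElt_truncGE_injective (hS : ∀ n, Projective (S.X n)) (c : ℤ)
    (hc : ∀ n < c, (E.baseChangeC.obj S).ExactAt n) (n : ℤ) :
    Function.Injective (E.mulElt ((S.truncGE c).X n)) := by
  rcases lt_trichotomy n c with hn | rfl | hn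
  · have := ModuleCat.isZero_iff_subsingleton.1
      (E.idealTensor.map_isZero (S.isZero_truncGE_X c n hn))
    exact Function.injective_of_subsingleton _
  · obtain ⟨m, hm⟩ : ∃ m, m + 1 = n := ⟨n - 1, by omega⟩
    refine (injective_iff_map_eq_zero _).2 fun x hx => ?_
    obtain ⟨y, rfl⟩ := tensorI_map_surjective (I := I) _
      (E.baseChange_map_surjective _ (S.πTruncGE_surjective n n)) x
    obtain ⟨s, hs⟩ := S.exists_d_eq_of_πTruncGE_eq_zero n m hm (E.mulElt _ y)
      ((E.mulElt_naturality _ y).trans hx)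
    obtain ⟨r, hr⟩ := (exactAt_iff_elements _ (m - 1) m n (by omega) hm).1 (hc m (by omega))
      (E.bcElt _ s) ((E.bcElt_naturality (S.d m n) s).trans (by rw [hs, bcElt_mulElt]; rfl))
    obtain ⟨r, rfl⟩ := E.bcElt_surjective _ r
    obtain ⟨z, hz⟩ := (E.bcElt_eq_zero_iff (s - S.d (m - 1) m r)).1 (by
      rw [map_sub, ← E.bcElt_naturality (S.d (m - 1) m) r]
      exact sub_eq_zero.2 hr.symm)
    have hy : y = E.idealTensor.map (S.d m n) z := by
      apply E.mulElt_injective (S.X n)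
      rw [← E.mulElt_naturality, hz, map_sub, d_apply_d_apply, sub_zero, hs]
    have h0 : S.d m n ≫ (S.πTruncGE n).f n = 0 := by
      rw [← (S.πTruncGE n).comm]
      rw [(S.isZero_truncGE_X n m (by omega)).eq_of_src ((S.truncGE n).d m n) 0, comp_zero]
    rw [hy]
    have := congr(E.idealTensor.map $h0 z)
    rw [Functor.map_comp, Functor.map_zero] at this
    exact this
  · have := S.isIso_πTruncGE_f c n hn
    have := hS n
    have : Projective ((S.truncGE c).X n) := Projective.of_iso (asIso ((S.πTruncGE c).f n)) this
    exact E.mulElt_injective _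

/-- The kernel of the base changed projection is all of `S̄` below `c`, consists of boundaries in
degree `c` by right exactness, and vanishes above. -/
lemma quasiIso_baseChangeC_map_πTruncGE (c : ℤ)
    (hc : ∀ n < c, (E.baseChangeC.obj S).ExactAt n) :
    QuasiIso (E.baseChangeC.map (S.πTruncGE c)) := by
  refine quasiIso_of_surjective _
    (fun n => E.baseChange_map_surjective _ (S.πTruncGE_surjective c n)) ?_
  intro m n p hm hp x hx hdx
  rcases lt_trichotomy n c with hn | rfl | hn
  · obtain ⟨y, rfl⟩ := (exactAt_iff_elements _ m n p hm hp).1 (hc n hn) x hdx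
    have := ModuleCat.isZero_iff_subsingleton.1
      (E.baseChange.map_isZero (S.isZero_truncGE_X c m (by omega)))
    exact ⟨y, Subsingleton.elim (α := E.baseChange.obj ((S.truncGE c).X m)) _ _, rfl⟩
  · obtain ⟨s, rfl⟩ := E.bcElt_surjective _ x
    obtain ⟨v, hv⟩ := (E.bcElt_eq_zero_iff _).1
      ((E.bcElt_naturality ((S.πTruncGE n).f n) s).symm.trans hx)
    obtain ⟨v, rfl⟩ := tensorI_map_surjective (I := I) _
      (E.baseChange_map_surjective _ (S.πTruncGE_surjective n n)) v
    obtain ⟨r, hr⟩ := S.exists_d_eq_of_πTruncGE_eq_zero n m hm (s - E.mulElt _ v) (by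
      rw [map_sub, E.mulElt_naturality, sub_eq_zero]
      exact hv.symm)
    have := ModuleCat.isZero_iff_subsingleton.1
      (E.baseChange.map_isZero (S.isZero_truncGE_X n m (by omega)))
    refine ⟨E.bcElt _ r, Subsingleton.elim (α := E.baseChange.obj ((S.truncGE n).X m)) _ _, ?_⟩
    refine (E.bcElt_naturality (S.d m n) r).trans ?_
    rw [hr, map_sub, bcElt_mulElt, sub_zero]
  · have := S.isIso_πTruncGE_f c n hn
    have h : Function.Injective (E.baseChange.map ((S.πTruncGE c).f n)) :=
      (ModuleCat.mono_iff_injective _).1 inferInstance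
    obtain rfl : x = 0 := h (hx.trans (map_zero _).symm)
    exact ⟨0, map_zero _, map_zero _⟩

/-- The sequence `0 → I ⊗ S̄ → S → S̄ → 0` is exact because the terms of `S` are projective; its
outer complexes are exact below `c`, the left one by flatness, and hence so is `S`. -/
lemma quasiIso_πTruncGE [Module.Flat A I] (hS : ∀ n, Projective (S.X n)) (c : ℤ)
    (hc : ∀ n < c, (E.baseChangeC.obj S).ExactAt n) : QuasiIso (S.πTruncGE c) := by
  rw [quasiIso_πTruncGE_iff, isGE_iff]
  intro n hn
  obtain ⟨m, hm⟩ : ∃ m, m + 1 = n := ⟨n - 1, by omega⟩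
  rw [exactAt_iff_elements _ m n (n + 1) hm rfl]
  intro x hx
  obtain ⟨y, hy⟩ := (exactAt_iff_elements _ m n (n + 1) hm rfl).1 (hc n hn) (E.bcElt _ x)
    ((E.bcElt_naturality (S.d n (n + 1)) x).trans (by rw [hx, map_zero]; rfl))
  obtain ⟨y, rfl⟩ := E.bcElt_surjective _ y
  obtain ⟨z, hz⟩ := (E.bcElt_eq_zero_iff (x - S.d m n y)).1 (by
    rw [map_sub, ← E.bcElt_naturality (S.d m n) y]
    exact sub_eq_zero.2 hy.symm)
  have hex : ((tensorC A I).obj (E.baseChangeC.obj S)).ExactAt n := (hc n hn).map (tensorI A I)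
  obtain ⟨w, hw⟩ := (exactAt_iff_elements _ m n (n + 1) hm rfl).1 hex z (by
    apply E.mulElt_injective (S.X (n + 1))
    refine (E.mulElt_naturality (S.d n (n + 1)) z).symm.trans ?_
    rw [hz, map_sub, hx, d_apply_d_apply, sub_zero]
    exact (map_zero _).symm)
  refine ⟨y + E.mulElt _ w, ?_⟩
  have : S.d m n (E.mulElt _ w) = E.mulElt _ z :=
    (E.mulElt_naturality (S.d m n) w).trans (congr_arg _ hw)
  rw [map_add, this, hz, add_sub_cancel]

end

end SplitSqZeroExtension

/-! ### Admissible truncations and the quotient by products that vanish in `K` -/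

namespace SplitSqZeroExtension

open CochainComplex

variable {k : Type v} {A I B : Type u} [Field k] [CommRing A] [Algebra k A]
  [AddCommGroup I] [Module A I] [CommRing B] [Algebra k B] (E : SplitSqZeroExtension k A I B)

lemma exists_truncation [Module.Flat A I] {S K : CochainComplex (ModuleCat.{u} B) ℤ} (f : S ⟶ K)
    (b c : ℤ) [K.IsStrictlyGE c] [S.IsStrictlyLE b] (hS : ∀ n, Projective (S.X n))
    (hf : QuasiIso (E.baseChangeC.map f))
    (hf' : ∀ n, Function.Surjective ((E.baseChangeC.map f).f n)) :
    ∃ (V : CochainComplex (ModuleCat.{u} B) ℤ) (p : S ⟶ V) (g : V ⟶ K),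
      V.IsStrictlyLE b ∧ V.IsStrictlyGE c ∧ E.Admissible V ∧ QuasiIso p ∧
      QuasiIso (E.baseChangeC.map p) ∧ QuasiIso (E.baseChangeC.map g) ∧
      ∀ n, Function.Surjective ((E.baseChangeC.map g).f n) := by
  have hc (n : ℤ) (hn : n < c) : (E.baseChangeC.obj S).ExactAt n := by
    rw [exactAt_iff_of_quasiIsoAt (E.baseChangeC.map f) n,
      HomologicalComplex.exactAt_iff]
    exact ShortComplex.exact_of_isZero_X₂ _
      (E.baseChange.map_isZero (K.isZero_of_isStrictlyGE c n hn))
  -- The inverse exists since `K` lives in degrees `≥ c`, so `f` factors through the truncation.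
  let g : S.truncGE c ⟶ K := truncGEMap f c ≫ inv (K.πTruncGE c)
  have hg : S.πTruncGE c ≫ g = f := by
    rw [← Category.assoc, πTruncGE_naturality, Category.assoc, IsIso.hom_inv_id, Category.comp_id]
  have hg' : E.baseChangeC.map (S.πTruncGE c) ≫ E.baseChangeC.map g = E.baseChangeC.map f := by
    rw [← Functor.map_comp, hg]
  have h₁ := E.quasiIso_baseChangeC_map_πTruncGE c hc
  refine ⟨S.truncGE c, S.πTruncGE c, g, S.isStrictlyLE_truncGE c b, inferInstance,
    E.admissible_of_isZero fun n => E.isZero_tor₁_of_injective _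
      (E.mulElt_truncGE_injective hS c hc n), E.quasiIso_πTruncGE hS c hc, h₁, ?_, fun n x => ?_⟩
  · rw [← quasiIso_iff_comp_left (E.baseChangeC.map (S.πTruncGE c)), hg']
    exact hf
  · obtain ⟨y, rfl⟩ := hf' n x
    exact ⟨(E.baseChangeC.map (S.πTruncGE c)).f n y, congr($(hg').f n y)⟩

/-- By `h`, `Tor₁(X)` is the full preimage of `Tor₁(K)` under the surjection `I ⊗ X̄ → I ⊗ K̄`. The
map on `Tor₁` is thus surjective with the same kernel as this surjection, which is acyclic by
flatness. -/
lemma quasiIso_tor₁C_map [Module.Flat A I] {X K : CochainComplex (ModuleCat.{u} B) ℤ} (q : X ⟶ K)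
    (hq : QuasiIso (E.baseChangeC.map q))
    (hq' : ∀ n, Function.Surjective ((E.baseChangeC.map q).f n))
    (h : ∀ n y, q.f n (E.mulElt _ y) = 0 → E.mulElt (X.X n) y = 0) :
    QuasiIso (E.tor₁C.map q) := by
  have hI : ∀ n, Function.Surjective (((tensorC A I).map (E.baseChangeC.map q)).f n) :=
    fun n => tensorI_map_surjective _ (hq' n)
  have hI' := kernelAcyclic_of_quasiIso ((tensorC A I).map (E.baseChangeC.map q)) hI inferInstance
  refine quasiIso_of_surjective _ (fun n z => ?_) fun m n p hm hp x hx hdx => ?_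
  · obtain ⟨y, hy⟩ := hI n (E.torInclusion.app _ z)
    obtain ⟨y, rfl⟩ := (E.mulElt_eq_zero_iff y).1 (h n y (by
      refine (E.mulElt_naturality (q.f n) y).trans ?_
      exact (E.mulElt_eq_zero_iff _).2 ⟨z, hy.symm⟩))
    exact ⟨y, E.torInclusion_injective _
      ((E.torInclusion_naturality (q.f n) y).symm.trans hy)⟩
  · obtain ⟨y, hy, hy'⟩ := hI' m n p hm hp (E.torInclusion.app _ x)
      ((E.torInclusion_naturality (q.f n) x).trans
        ((congr_arg (E.torInclusion.app (K.X n)) hx).trans (map_zero _)))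
      ((E.torInclusion_naturality (X.d n p) x).trans
        ((congr_arg (E.torInclusion.app (X.X p)) hdx).trans (map_zero _)))
    obtain ⟨y, rfl⟩ := (E.mulElt_eq_zero_iff (V := X.X m) y).1 (h m y (by
      refine (E.mulElt_naturality (q.f m) y).trans ?_
      exact (congr_arg (E.mulElt (K.X m)) hy).trans (map_zero _)))
    exact ⟨y, E.torInclusion_injective _
      ((E.torInclusion_naturality (q.f m) y).symm.trans (hy.trans (map_zero _).symm)),
      E.torInclusion_injective _ ((E.torInclusion_naturality (X.d m n) y).symm.trans hy')⟩

section Adm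

/-- The morphism of the admissible derived category given by a morphism of complexes. -/
noncomputable def toDerivedAdmMap {K L : CochainComplex (ModuleCat.{u} B) ℤ} (f : K ⟶ L)
    (hK : ProjectiveModels.boundedAbove _ K) (hL : ProjectiveModels.boundedAbove _ L) :
    E.toDerivedAdm K hK ⟶ E.toDerivedAdm L hL :=
  E.admissibleW.Q.map (ObjectProperty.homMk ((HomotopyCategory.quotient _ _).map f))

lemma baseChangeAdm_map_toDerivedAdmMap [HasDerivedCategory.{w} (ModuleCat.{u} A)]
    {K L : CochainComplex (ModuleCat.{u} B) ℤ} (f : K ⟶ L)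
    (hK : ProjectiveModels.boundedAbove _ K) (hL : ProjectiveModels.boundedAbove _ L) :
    E.baseChangeAdm.map (E.toDerivedAdmMap f hK hL) =
      DerivedCategory.Q.map (E.baseChangeC.map f) := by
  let f' : (⟨(HomotopyCategory.quotient _ _).obj K, ⟨K, hK⟩⟩ :
      (ProjectiveModels.homotopyMinus (ModuleCat.{u} B)).FullSubcategory) ⟶
      ⟨(HomotopyCategory.quotient _ _).obj L, ⟨L, hL⟩⟩ :=
    ObjectProperty.homMk ((HomotopyCategory.quotient _ _).map f)
  have h : E.baseChangeAdm.map (E.admissibleW.Q.map f') =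
      DerivedCategory.Qh.map ((E.baseChange.mapHomotopyCategory (.up ℤ)).map f'.hom) :=
    (Functor.congr_hom (Localization.Construction.fac _ E.admissibleW_isInvertedBy) f').trans
      ((Category.id_comp _).trans (Category.comp_id _))
  exact h

lemma isIso_baseChangeAdm_map_toDerivedAdmMap [HasDerivedCategory.{w} (ModuleCat.{u} A)]
    {K L : CochainComplex (ModuleCat.{u} B) ℤ} (f : K ⟶ L)
    (hK : ProjectiveModels.boundedAbove _ K) (hL : ProjectiveModels.boundedAbove _ L)
    (hf : QuasiIso (E.baseChangeC.map f)) :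
    IsIso (E.baseChangeAdm.map (E.toDerivedAdmMap f hK hL)) := by
  rw [baseChangeAdm_map_toDerivedAdmMap]
  exact inferInstanceAs (IsIso (DerivedCategory.Q.map (E.baseChangeC.map f)))

lemma acyclic_map_mappingCone_iff {C D : Type*} [Category* C] [Category* D] [Abelian C] [Abelian D]
    (F : C ⥤ D) [F.Additive] {K L : CochainComplex C ℤ} (f : K ⟶ L) :
    ((F.mapHomologicalComplex (.up ℤ)).obj (mappingCone f)).Acyclic ↔
      QuasiIso ((F.mapHomologicalComplex (.up ℤ)).map f) := by
  rw [← acyclic_mappingCone_iff]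
  let e := mappingCone.mapHomologicalComplexIso f F
  exact forall_congr' fun n => exactAt_iff_of_quasiIsoAt e.hom n

lemma isIso_toDerivedAdmMap {K L : CochainComplex (ModuleCat.{u} B) ℤ} (f : K ⟶ L)
    (hK : ProjectiveModels.boundedAbove _ K) (hL : ProjectiveModels.boundedAbove _ L)
    (hf : QuasiIso (E.baseChangeC.map f)) (hf' : QuasiIso (E.tor₁C.map f)) :
    IsIso (E.toDerivedAdmMap f hK hL) := by
  refine Localization.inverts E.admissibleW.Q E.admissibleW _ ?_
  refine ObjectProperty.trW.mk _ (HomotopyCategory.mappingCone_triangleh_distinguished f) ⟨?_, ?_⟩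
  · exact (HomotopyCategory.quotient_obj_mem_subcategoryAcyclic_iff_acyclic _).2
      ((acyclic_map_mappingCone_iff E.baseChange f).2 hf)
  · exact (HomotopyCategory.quotient_obj_mem_subcategoryAcyclic_iff_acyclic _).2
      ((acyclic_map_mappingCone_iff E.tor₁ f).2 hf')

end Adm

section Quotient

variable (V : CochainComplex (ModuleCat.{u} B) ℤ) {T : CochainComplex (ModuleCat.{u} A) ℤ}
  (t : T ⟶ E.idealTensorC.obj V)

lemma quotientComplexπ_surjective (n : ℤ) :
    Function.Surjective ((E.quotientComplexπ V t).f n) :=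
  (ModuleCat.epi_iff_surjective _).1
    (inferInstanceAs (Epi ((HomologicalComplex.eval _ _ n).map (E.quotientComplexπ V t))))

lemma quotientComplexπ_eq_zero_iff (n : ℤ) (x : V.X n) :
    (E.quotientComplexπ V t).f n x = 0 ↔ ∃ y : T.X n, E.mulElt _ (t.f n y) = x := by
  have := (ShortComplex.exact_cokernel (E.viaProjC.map t ≫ E.mulBC V)).map
    (HomologicalComplex.eval _ _ n)
  exact (ShortComplex.ShortExact.moduleCat_exact_iff_function_exact _).1 this x

/-- The quotient only kills elements of `I V`, which are already zero in `V̄ = V / I V`. -/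
lemma isIso_baseChangeC_map_quotientComplexπ :
    IsIso (E.baseChangeC.map (E.quotientComplexπ V t)) := by
  have (n : ℤ) : IsIso ((E.baseChangeC.map (E.quotientComplexπ V t)).f n) := by
    refine (ConcreteCategory.isIso_iff_bijective _).2 ⟨?_, E.baseChange_map_surjective _
      (E.quotientComplexπ_surjective V t n)⟩
    refine (injective_iff_map_eq_zero _).2 fun x hx => ?_
    obtain ⟨x, rfl⟩ := E.bcElt_surjective _ x
    obtain ⟨y, hy⟩ := (E.bcElt_eq_zero_iff _).1
      ((E.bcElt_naturality ((E.quotientComplexπ V t).f n) x).symm.trans hx)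
    obtain ⟨y, rfl⟩ := tensorI_map_surjective (I := I) _
      (E.baseChange_map_surjective _ (E.quotientComplexπ_surjective V t n)) y
    obtain ⟨z, hz⟩ := (E.quotientComplexπ_eq_zero_iff V t n (x - E.mulElt _ y)).1 (by
      rw [map_sub, E.mulElt_naturality, sub_eq_zero]
      exact hy.symm)
    refine (E.bcElt_eq_zero_iff x).2 ⟨(show E.idealTensor.obj (V.X n) from t.f n z) +
      (show E.idealTensor.obj (V.X n) from y),
      ?_⟩
    refine (map_add (E.mulElt (V.X n)) _ _).trans ?_
    rw [hz, sub_add_cancel]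
  exact HomologicalComplex.Hom.isIso_of_components _

variable {V} {K : CochainComplex (ModuleCat.{u} B) ℤ} (g : V ⟶ K)

/-- The subcomplex of `I ⊗ (V ⊗_B A)` of elements whose product vanishes in `K`. -/
noncomputable abbrev mulKernel : CochainComplex (ModuleCat.{u} A) ℤ :=
  kernel (E.mulC V ≫ E.viaSectC.map g)

noncomputable abbrev mulKernelι : E.mulKernel g ⟶ E.idealTensorC.obj V :=
  kernel.ι (E.mulC V ≫ E.viaSectC.map g)

lemma mulKernel_elements (n : ℤ) (x : E.idealTensor.obj (V.X n)) :
    g.f n (E.mulElt _ x) = 0 ↔ ∃ y, (E.mulKernelι g).f n y = x := by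
  have := (ShortComplex.exact_kernel (E.mulC V ≫ E.viaSectC.map g)).map
    (HomologicalComplex.eval _ _ n)
  exact (ShortComplex.ShortExact.moduleCat_exact_iff_function_exact _).1 this x

lemma mulKernel_condition :
    (E.viaProjC.map (E.mulKernelι g) ≫ E.mulBC V) ≫ g = 0 := by
  ext n x
  exact (E.mulKernel_elements g n _).2 ⟨x, rfl⟩

/-- The map induced by `g : V ⟶ K` on the quotient of `V` by the products that vanish in `K`. -/
noncomputable def quotientDesc : E.quotientComplex V (E.mulKernelι g) ⟶ K :=
  cokernel.desc _ g (E.mulKernel_condition g)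

lemma quotientComplexπ_quotientDesc :
    E.quotientComplexπ V (E.mulKernelι g) ≫ E.quotientDesc g = g :=
  cokernel.π_desc _ _ _

lemma baseChangeC_quotientDesc :
    E.baseChangeC.map (E.quotientComplexπ V (E.mulKernelι g)) ≫
      E.baseChangeC.map (E.quotientDesc g) = E.baseChangeC.map g := by
  rw [← Functor.map_comp, quotientComplexπ_quotientDesc]

/-- This is the hypothesis needed in `quasiIso_tor₁C_map`, and the reason for dividing by exactly
`mulKernel`: a product that dies in `K` lifts to such a product in `V`. -/
lemma mulElt_eq_zero_of_quotientDesc (n : ℤ)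
    (y : E.idealTensor.obj ((E.quotientComplex V (E.mulKernelι g)).X n))
    (hy : (E.quotientDesc g).f n (E.mulElt _ y) = 0) : E.mulElt _ y = 0 := by
  obtain ⟨y, rfl⟩ := tensorI_map_surjective (I := I) _ (E.baseChange_map_surjective _
    (E.quotientComplexπ_surjective V (E.mulKernelι g) n)) y
  have h : (E.quotientComplexπ V (E.mulKernelι g)).f n (E.mulElt _ y) = 0 := by
    rw [quotientComplexπ_eq_zero_iff]
    have h₁ : g.f n (E.mulElt _ y) = 0 := by
      rw [← E.quotientComplexπ_quotientDesc g, ← hy]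
      exact congr_arg ((E.quotientDesc g).f n)
        (E.mulElt_naturality ((E.quotientComplexπ V (E.mulKernelι g)).f n) y)
    obtain ⟨z, rfl⟩ := (E.mulKernel_elements g n y).1 h₁
    exact ⟨z, rfl⟩
  exact (E.mulElt_naturality _ y).symm.trans h

lemma quasiIso_baseChangeC_quotientDesc (hg : QuasiIso (E.baseChangeC.map g)) :
    QuasiIso (E.baseChangeC.map (E.quotientDesc g)) := by
  have := E.isIso_baseChangeC_map_quotientComplexπ V (E.mulKernelι g)
  rw [← quasiIso_iff_comp_left (E.baseChangeC.map (E.quotientComplexπ V (E.mulKernelι g))),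
    baseChangeC_quotientDesc]
  exact hg

lemma surjective_baseChangeC_quotientDesc
    (hg : ∀ n, Function.Surjective ((E.baseChangeC.map g).f n)) (n : ℤ) :
    Function.Surjective ((E.baseChangeC.map (E.quotientDesc g)).f n) := by
  intro x
  obtain ⟨y, rfl⟩ := hg n x
  exact ⟨_, congr($(E.baseChangeC_quotientDesc g).f n y)⟩

lemma quasiIso_tor₁C_quotientDesc [Module.Flat A I] (hg : QuasiIso (E.baseChangeC.map g))
    (hg' : ∀ n, Function.Surjective ((E.baseChangeC.map g).f n)) :
    QuasiIso (E.tor₁C.map (E.quotientDesc g)) :=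
  E.quasiIso_tor₁C_map _ (E.quasiIso_baseChangeC_quotientDesc g hg)
    (E.surjective_baseChangeC_quotientDesc g hg') (E.mulElt_eq_zero_of_quotientDesc g)

end Quotient

end SplitSqZeroExtension

/-! ### The implications between the conditions -/

namespace SplitSqZeroExtension

open CochainComplex ProjectiveModels

variable {k : Type v} {A I B : Type u} [Field k] [CommRing A] [Algebra k A]
  [AddCommGroup I] [Module A I] [CommRing B] [Algebra k B] (E : SplitSqZeroExtension k A I B)

lemma nonempty_toDerivedAdm_iso_quotientComplex [Module.Flat A I]
    {V K : CochainComplex (ModuleCat.{u} B) ℤ} (g : V ⟶ K)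
    (hV : boundedAbove (ModuleCat.{u} B) V) (hK : boundedAbove (ModuleCat.{u} B) K)
    (hg : QuasiIso (E.baseChangeC.map g))
    (hg' : ∀ n, Function.Surjective ((E.baseChangeC.map g).f n)) :
    Nonempty (E.toDerivedAdm K hK ≅ E.toDerivedAdm (E.quotientComplex V (E.mulKernelι g))
      (E.quotientComplex_boundedAbove V _ hV)) := by
  have := E.isIso_toDerivedAdmMap (E.quotientDesc g) (E.quotientComplex_boundedAbove V _ hV) hK
    (E.quasiIso_baseChangeC_quotientDesc g hg) (E.quasiIso_tor₁C_quotientDesc g hg hg')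
  exact ⟨(asIso (E.toDerivedAdmMap (E.quotientDesc g) (E.quotientComplex_boundedAbove V _ hV)
    hK)).symm⟩

variable [HasDerivedCategory.{w} (ModuleCat.{u} A)]

lemma exists_admissible_of_hkrClass_eq_zero [Module.Flat A I]
    {b : ℤ} {K : CochainComplex (ModuleCat.{u} B) ℤ} (hK : boundedLE (ModuleCat.{u} B) b K)
    (h : E.hkrClass K = 0) :
    ∃ (S V : CochainComplex (ModuleCat.{u} B) ℤ) (p : S ⟶ V) (g : V ⟶ K),
      boundedAbove (ModuleCat.{u} B) S ∧ (∀ n, Projective (S.X n)) ∧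
      boundedLE (ModuleCat.{u} B) b V ∧ E.Admissible V ∧ QuasiIso p ∧
      QuasiIso (E.baseChangeC.map p) ∧ QuasiIso (E.baseChangeC.map g) ∧
      ∀ n, Function.Surjective ((E.baseChangeC.map g).f n) := by
  obtain ⟨hb, c, hc⟩ := hK
  obtain ⟨S, f, hS, hSb, hf, hf'⟩ := E.exists_projective_of_hkrClass_eq_zero K b h
  obtain ⟨V, p, g, hV, hV', hVa, hp, hp', hg, hg'⟩ := E.exists_truncation f b c hS hf hf'
  exact ⟨S, V, p, g, ⟨b, hSb⟩, hS, ⟨hV, c, hV'⟩, hVa, hp, hp', hg, hg'⟩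

/-- The terms of `V` need not be projective, but `p` is a quasi-isomorphism from projectives that
remains one after base change, so `V ⊗ᴸ A → V̄` is invertible; `V̄ → K̄` is invertible by
assumption. -/
lemma isIso_derivedBaseChange_map_comp [HasDerivedCategory.{w'} (ModuleCat.{u} B)]
    {S V K : CochainComplex (ModuleCat.{u} B) ℤ} (p : S ⟶ V) (g : V ⟶ K)
    (hSb : boundedAbove (ModuleCat.{u} B) S) (hS : ∀ n, Projective (S.X n))
    (hV : boundedAbove (ModuleCat.{u} B) V) (hK : boundedAbove (ModuleCat.{u} B) K)
    (hp : QuasiIso p) (hp' : QuasiIso (E.baseChangeC.map p)) (hg : QuasiIso (E.baseChangeC.map g)) :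
    IsIso (E.derivedBaseChange.map (toMinusMap g hV hK) ≫ E.derivedToBaseChange K hK) := by
  have h₁ := fromLeftDerivedMinus_naturality E.baseChange p hSb hV
  have h₂ := fromLeftDerivedMinus_naturality E.baseChange g hV hK
  have h₃ := isIso_fromLeftDerivedMinus E.baseChange hSb hS
  have h₄ : IsIso (DerivedCategory.Q.map (E.baseChangeC.map p)) := inferInstance
  have h₅ : IsIso (DerivedCategory.Q.map (E.baseChangeC.map g)) := inferInstance
  have h₆ : IsIso (fromLeftDerivedMinus E.baseChange V hV) :=
    IsIso.of_isIso_fac_left (f := (leftDerivedMinus E.baseChange).map (toMinusMap p hSb hV)) h₁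
  exact h₂ ▸ IsIso.comp_isIso' h₆ h₅

lemma exists_section_of_isIso [HasDerivedCategory.{w'} (ModuleCat.{u} B)]
    {V K : CochainComplex (ModuleCat.{u} B) ℤ}
    (hV : boundedAbove (ModuleCat.{u} B) V) (hK : boundedAbove (ModuleCat.{u} B) K)
    (φ : toMinus V hV ⟶ toMinus K hK)
    (h : IsIso (E.derivedBaseChange.map φ ≫ E.derivedToBaseChange K hK)) :
    ∃ s : DerivedCategory.Q.obj (E.baseChangeC.obj K) ⟶ E.derivedBaseChange.obj (toMinus K hK),
      s ≫ E.derivedToBaseChange K hK = 𝟙 _ :=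
  ⟨inv (E.derivedBaseChange.map φ ≫ E.derivedToBaseChange K hK) ≫ E.derivedBaseChange.map φ, by
    rw [Category.assoc, IsIso.inv_hom_id]⟩

lemma exists_adm_of_iso_quotientComplex
    {V K : CochainComplex (ModuleCat.{u} B) ℤ} {T : CochainComplex (ModuleCat.{u} A) ℤ}
    (t : T ⟶ E.idealTensorC.obj V)
    (hV : boundedAbove (ModuleCat.{u} B) V) (hK : boundedAbove (ModuleCat.{u} B) K)
    (e : E.toDerivedAdm K hK ≅
      E.toDerivedAdm (E.quotientComplex V t) (E.quotientComplex_boundedAbove V t hV)) :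
    ∃ φ : E.toDerivedAdm V hV ⟶ E.toDerivedAdm K hK, IsIso (E.baseChangeAdm.map φ) := by
  refine ⟨E.toDerivedAdmMap (E.quotientComplexπ V t) hV (E.quotientComplex_boundedAbove V t hV) ≫
    e.inv, ?_⟩
  have := E.isIso_baseChangeC_map_quotientComplexπ V t
  have := E.isIso_baseChangeAdm_map_toDerivedAdmMap (E.quotientComplexπ V t) hV
    (E.quotientComplex_boundedAbove V t hV) inferInstance
  rw [Functor.map_comp]
  infer_instance

end SplitSqZeroExtension

/-! ### Coproducts of the form `Y₀ ⨿ Φ Y₀ ⨿ Φ² Y₀ ⨿ ⋯` -/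

namespace CoproductTower

variable {C : Type*} [Category* C] [Preadditive C] (Y : ℕ → C) [HasCoproduct Y] (Φ : C ⥤ C)
  [PreservesColimit (Discrete.functor Y) Φ] (e : ∀ p, Y (p + 1) ≅ Φ.obj (Y p))

/-- The projection of `Y₀ ⨿ Y₁ ⨿ ⋯` to the first factor. -/
noncomputable def fst : ∐ Y ⟶ Y 0 :=
  Sigma.desc fun
    | 0 => 𝟙 _
    | _ + 1 => 0

/-- The projection of `Y₀ ⨿ Y₁ ⨿ ⋯` to `Y₁ ⨿ Y₂ ⨿ ⋯`, identified with `Φ (Y₀ ⨿ Y₁ ⨿ ⋯)`. -/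
noncomputable def next : ∐ Y ⟶ Φ.obj (∐ Y) :=
  Sigma.desc fun
    | 0 => 0
    | p + 1 => (e p).hom ≫ Φ.map (Sigma.ι Y p)

/-- The coproduct is the direct sum of `Y 0` and its own image under `Φ`; `s` is the inclusion of
the second summand. -/
lemma exists_next_section : ∃ s : Φ.obj (∐ Y) ⟶ ∐ Y,
    s ≫ next Y Φ e = 𝟙 _ ∧ s ≫ fst Y = 0 ∧ fst Y ≫ Sigma.ι Y 0 + next Y Φ e ≫ s = 𝟙 _ := by
  have hc : IsColimit (Cofan.mk (Φ.obj (∐ Y)) fun p => Φ.map (Sigma.ι Y p)) :=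
    isColimitCofanMkObjOfIsColimit Φ _ _ (coproductIsCoproduct Y)
  let s : Φ.obj (∐ Y) ⟶ ∐ Y := Cofan.IsColimit.desc hc fun p => (e p).inv ≫ Sigma.ι Y (p + 1)
  have hs (p : ℕ) : Φ.map (Sigma.ι Y p) ≫ s = (e p).inv ≫ Sigma.ι Y (p + 1) :=
    Cofan.IsColimit.fac hc _ p
  refine ⟨s, ?_, ?_, ?_⟩
  · refine Cofan.IsColimit.hom_ext hc _ _ fun p => ?_
    change Φ.map (Sigma.ι Y p) ≫ _ = Φ.map (Sigma.ι Y p) ≫ _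
    rw [reassoc_of% (hs p)]
    simp [next]
  · refine Cofan.IsColimit.hom_ext hc _ _ fun p => ?_
    change Φ.map (Sigma.ι Y p) ≫ _ = Φ.map (Sigma.ι Y p) ≫ _
    rw [reassoc_of% (hs p)]
    simp [fst]
  · ext p
    cases p with
    | zero => simp [fst, next]
    | succ p => simp [fst, next, hs]

end CoproductTower

/-! ### Countable coproducts of complexes of modules -/

namespace CochainComplex

section Coproduct

variable {R : Type u} [Ring R] (Y : ℕ → CochainComplex (ModuleCat.{u} R) ℤ)

/-- The coproduct of complexes is computed degreewise. -/
noncomputable def isColimitEvalCofan (n : ℤ) :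
    IsColimit (Cofan.mk ((∐ Y).X n) fun p => (Sigma.ι Y p).f n) :=
  isColimitCofanMkObjOfIsColimit (HomologicalComplex.eval _ _ n) _ _ (coproductIsCoproduct Y)

lemma projective_coproduct_X (n : ℤ) (hY : ∀ p, Projective ((Y p).X n)) :
    Projective ((∐ Y).X n) where
  factors f e _ :=
    ⟨Cofan.IsColimit.desc (isColimitEvalCofan Y n) fun p =>
        Projective.factorThru ((Sigma.ι Y p).f n ≫ f) e,
      Cofan.IsColimit.hom_ext (isColimitEvalCofan Y n) _ _ fun p => by
        rw [Cofan.IsColimit.fac_assoc, Projective.factorThru_comp]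
        rfl⟩

lemma isStrictlyLE_coproduct (b : ℤ) (hY : ∀ p, (Y p).IsStrictlyLE b) :
    (∐ Y).IsStrictlyLE b := by
  rw [isStrictlyLE_iff]
  intro i hi
  rw [IsZero.iff_id_eq_zero]
  exact Cofan.IsColimit.hom_ext (isColimitEvalCofan Y i) _ _ fun p =>
    ((Y p).isZero_of_isStrictlyLE b i hi).eq_of_src _ _

/-- The projection of a coproduct of complexes to a factor. -/
noncomputable def coproductProj (p : ℕ) : ∐ Y ⟶ Y p :=
  Sigma.desc fun q => if h : q = p then eqToHom (by rw [h]) else 0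

lemma ι_coproductProj_self (p : ℕ) : Sigma.ι Y p ≫ coproductProj Y p = 𝟙 _ := by
  simp [coproductProj]

lemma ι_coproductProj_of_ne {p q : ℕ} (h : q ≠ p) : Sigma.ι Y q ≫ coproductProj Y p = 0 := by
  simp [coproductProj, h]

lemma exists_eq_sum_ι (n : ℤ) (x : (∐ Y).X n) :
    ∃ s : Finset ℕ, x = ∑ p ∈ s, (Sigma.ι Y p).f n ((coproductProj Y p).f n x) := by
  have hself (p : ℕ) (y : (Y p).X n) : (coproductProj Y p).f n ((Sigma.ι Y p).f n y) = y :=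
    congr($(ι_coproductProj_self Y p).f n y)
  have hne {p q : ℕ} (h : q ≠ p) (y : (Y q).X n) :
      (coproductProj Y p).f n ((Sigma.ι Y q).f n y) = 0 :=
    congr($(ι_coproductProj_of_ne Y h).f n y)
  let N : Submodule R ((∐ Y).X n) := ⨆ p, LinearMap.range ((Sigma.ι Y p).f n).hom
  have hN : N = ⊤ := by
    have h : ModuleCat.ofHom N.mkQ = 0 :=
      Cofan.IsColimit.hom_ext (isColimitEvalCofan Y n) _ _ fun p => by
        ext y
        exact (Submodule.Quotient.mk_eq_zero N).2 (Submodule.mem_iSup_of_mem p ⟨y, rfl⟩)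
    rw [eq_top_iff]
    intro y _
    exact (Submodule.Quotient.mk_eq_zero N).1 congr(($h).hom y)
  -- Allowing every larger finite set lets the induction treat a sum of two elements with a common
  -- support.
  suffices h : ∃ s : Finset ℕ, ∀ s', s ⊆ s' →
      x = ∑ p ∈ s', (Sigma.ι Y p).f n ((coproductProj Y p).f n x) by
    obtain ⟨s, hs⟩ := h
    exact ⟨s, hs s subset_rfl⟩
  have hx : x ∈ N := hN ▸ Submodule.mem_top
  induction hx using Submodule.iSup_induction' with
  | mem q x hx =>
    obtain ⟨y, rfl⟩ := hx
    refine ⟨{q}, fun s' hs' => ?_⟩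
    rw [Finset.sum_eq_single q]
    · exact (congr_arg _ (hself q y)).symm
    · exact fun p _ hp => (congr_arg _ (hne hp.symm y)).trans (map_zero _)
    · exact fun h => (h (hs' (Finset.mem_singleton_self q))).elim
  | zero => exact ⟨∅, fun s' _ => by simp⟩
  | add x y _ _ hx hy =>
    obtain ⟨s, hs⟩ := hx
    obtain ⟨t, ht⟩ := hy
    refine ⟨s ∪ t, fun s' hs' => ?_⟩
    simp only [map_add, Finset.sum_add_distrib]
    rw [← hs s' (Finset.subset_union_left.trans hs'), ← ht s' (Finset.subset_union_right.trans hs')]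

/-- Elements have finite support, so preimages and primitives can be chosen factor by factor and
summed. -/
lemma quasiIso_sigmaMap {Z W : ℕ → CochainComplex (ModuleCat.{u} R) ℤ} (f : ∀ p, Z p ⟶ W p)
    (hf : ∀ p n, Function.Surjective ((f p).f n)) (hf' : ∀ p, QuasiIso (f p)) :
    QuasiIso (Limits.Sigma.map f) := by
  have hπ (p : ℕ) : Limits.Sigma.map f ≫ coproductProj W p = coproductProj Z p ≫ f p := by
    ext q : 1
    by_cases h : q = p
    · subst h
      simp [coproductProj]
    · simp [coproductProj, h]
  have hι (p : ℕ) (n : ℤ) (y : (Z p).X n) : (Limits.Sigma.map f).f n ((Sigma.ι Z p).f n y) =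
      (Sigma.ι W p).f n ((f p).f n y) :=
    congr($(Limits.Sigma.ι_map f p).f n y)
  refine quasiIso_of_surjective _ (fun n x => ?_) fun m n l hm hl x hx hdx => ?_
  · obtain ⟨s, hs⟩ := exists_eq_sum_ι W n x
    choose y hy using fun p => hf p n ((coproductProj W p).f n x)
    refine ⟨∑ p ∈ s, (Sigma.ι Z p).f n (y p), ?_⟩
    rw [map_sum]
    conv_rhs => rw [hs]
    exact Finset.sum_congr rfl fun p _ => by rw [hι, hy]
  · obtain ⟨s, hs⟩ := exists_eq_sum_ι Z n x
    have h (p : ℕ) := kernelAcyclic_of_quasiIso (f p) (hf p) (hf' p) m n l hm hl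
      ((coproductProj Z p).f n x)
      ((congr($(hπ p).f n x)).symm.trans ((congr_arg ((coproductProj W p).f n) hx).trans
        (map_zero _)))
      (by rw [hom_d_apply, hdx, map_zero])
    choose y hy hy' using h
    refine ⟨∑ p ∈ s, (Sigma.ι Z p).f m (y p), ?_, ?_⟩
    · rw [map_sum]
      exact Finset.sum_eq_zero fun p _ => by rw [hι, hy, map_zero]
    · rw [map_sum]
      conv_rhs => rw [hs]
      exact Finset.sum_congr rfl fun p _ => by rw [hom_d_apply, hy']

end Coproduct

end CochainComplex

/-! ### Resolving complexes of `A`-modules over `B` -/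

namespace SplitSqZeroExtension

open CochainComplex HomComplex

section

variable {A I : Type u} [CommRing A] [AddCommGroup I] [Module A I]

instance : PreservesColimitsOfShape (Discrete ℕ) (tensorC A I) :=
  HomologicalComplex.preservesColimitsOfShape_of_eval _ fun n =>
    inferInstanceAs (PreservesColimitsOfShape (Discrete ℕ)
      (HomologicalComplex.eval (ModuleCat.{u} A) (.up ℤ) n ⋙ tensorI A I))

lemma equivHomShift_v {Y Z : CochainComplex (ModuleCat.{u} A) ℤ} (α : Y ⟶ Z⟦(1 : ℤ)⟧) (n : ℤ) :
    (Cocycle.equivHomShift α).1.v n (n + 1) rfl = α.f n := by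
  simp [Cocycle.equivHomShift_apply, Cochain.rightUnshift_v _ _ _ _ _ _ _ (add_zero n)]
  exact Category.comp_id _

end

variable {k : Type v} {A I B : Type u} [Field k] [CommRing A] [Algebra k A]
  [AddCommGroup I] [Module A I] [CommRing B] [Algebra k B] (E : SplitSqZeroExtension k A I B)

lemma mul_app_viaProj (N : ModuleCat.{u} A) : E.mul.app (E.viaProj.obj N) = 0 := by
  refine ModuleCat.hom_ext (TensorProduct.ext' fun (i : I)
    (x : E.baseChange.obj (E.viaProj.obj N)) => ?_)
  obtain ⟨v, rfl⟩ := E.toBaseChange_surjective _ x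
  refine (E.actionHom_toBaseChange _ v i).trans ?_
  change E.proj (E.incl i) • (show N from v) = 0
  rw [(E.proj_eq_zero_iff _).2 ⟨i, rfl⟩, zero_smul]

section

variable {Y : CochainComplex (ModuleCat.{u} A) ℤ} (a : TwistingCochain I Y)

/-- The inclusion of `Y` into a twist of `B ⊗_A Y` on elements. -/
noncomputable def twistInl (n : ℤ) : Y.X n →+ (E.twist a).X n :=
  (E.toInduction (Y.X n)).hom.toAddMonoidHom

/-- The inclusion of `I ⊗ Y` into a twist of `B ⊗_A Y` on elements. -/
noncomputable def twistInr (n : ℤ) : (tensorI A I).obj (Y.X n) →+ (E.twist a).X n :=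
  (E.tensorToInduction (Y.X n)).hom.toAddMonoidHom

lemma twist_d_twistInl (i j : ℤ) (h : i + 1 = j) (y : Y.X i) :
    (E.twist a).d i j (E.twistInl a i y) =
      E.twistInl a j (Y.d i j y) + E.twistInr a j (a.v i j h y) := by
  rw [twist_d _ _ _ _ h]
  exact congr(($(E.toInduction_extend (E.twistD a i j h))).hom y)

lemma twist_d_twistInr (i j : ℤ) (h : i + 1 = j) (z : (tensorI A I).obj (Y.X i)) :
    (E.twist a).d i j (E.twistInr a i z) = E.twistInr a j ((tensorI A I).map (Y.d i j) z) := by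
  rw [twist_d _ _ _ _ h]
  have := E.tensorToInduction_extend (E.twistD a i j h)
  rw [twistD_toBaseChange, Functor.map_comp, Category.assoc] at this
  exact congr(($this).hom z)

lemma bcElt_twistInr (n : ℤ) (z : (tensorI A I).obj (Y.X n)) :
    E.bcElt _ (E.twistInr a n z) = 0 :=
  E.bcElt_mulElt _

lemma exists_eq_twistInl_add_twistInr (n : ℤ) (x : (E.twist a).X n) :
    ∃ y z, x = E.twistInl a n y + E.twistInr a n z := by
  obtain ⟨y, hy⟩ := ((ConcreteCategory.isIso_iff_bijective
    (E.toBaseChangeInduction (Y.X n))).1 inferInstance).2 (E.bcElt _ x)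
  obtain ⟨z, hz⟩ := (E.bcElt_eq_zero_iff (x - E.twistInl a n y)).1 (by
    rw [map_sub, sub_eq_zero]
    exact hy.symm)
  obtain ⟨z, rfl⟩ := tensorI_map_surjective (I := I) (E.toBaseChangeInduction (Y.X n))
    ((ConcreteCategory.isIso_iff_bijective _).1 inferInstance).2 z
  exact ⟨y, z, sub_eq_iff_eq_add'.1 hz.symm⟩

lemma twistInl_add_twistInr_eq_zero (n : ℤ) [Projective (Y.X n)] (y : Y.X n)
    (z : (tensorI A I).obj (Y.X n)) (h : E.twistInl a n y + E.twistInr a n z = 0) :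
    y = 0 ∧ z = 0 := by
  have hy : y = 0 := by
    apply ((ConcreteCategory.isIso_iff_bijective
      (E.toBaseChangeInduction (Y.X n))).1 inferInstance).1
    have h' := congr_arg (E.bcElt _) h
    rw [map_add, bcElt_twistInr, add_zero, map_zero] at h'
    exact h'.trans (map_zero _).symm
  subst hy
  rw [map_zero, zero_add] at h
  have : Projective (E.induction.obj (Y.X n)) := E.inductionAdj.map_projective _ inferInstance
  have h' := E.mulElt_injective (E.induction.obj (Y.X n)) (h.trans (map_zero _).symm)
  have : IsIso ((tensorI A I).map (E.toBaseChangeInduction (Y.X n))) := inferInstance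
  exact ⟨rfl, ((ConcreteCategory.isIso_iff_bijective
    ((tensorI A I).map (E.toBaseChangeInduction (Y.X n)))).1 this).1 (h'.trans (map_zero _).symm)⟩

end

/-- As graded modules `B ⊗_A Y p` is `Y p ⊕ (I ⊗ Y p)`. The twisting cochain is the projection of `∐
Y` to the factors of positive index, identified with `(I ⊗ ∐ Y)[1]`; through it `Y (p + 1)` cancels
the summand `I ⊗ Y p`, and only `Y 0` survives, with `I` acting by zero. -/
lemma exists_projective_viaProj (Y : ℕ → CochainComplex (ModuleCat.{u} A) ℤ)
    (e : ∀ p, Y (p + 1) ≅ ((tensorC A I).obj (Y p))⟦(1 : ℤ)⟧) (b : ℤ)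
    (hY : ∀ p n, Projective ((Y p).X n)) (hb : ∀ p, (Y p).IsStrictlyLE b) :
    ∃ (P : CochainComplex (ModuleCat.{u} B) ℤ) (π : P ⟶ E.viaProjC.obj (Y 0)),
      QuasiIso π ∧ (∀ n, Projective (P.X n)) ∧ P.IsStrictlyLE b ∧
      Nonempty (∐ Y ≅ E.baseChangeC.obj P) := by
  have hY' (n : ℤ) : Projective ((∐ Y).X n) := projective_coproduct_X Y n fun p => hY p n
  have hb' := isStrictlyLE_coproduct Y b hb
  let Φ := tensorC A I ⋙ CategoryTheory.shiftFunctor (CochainComplex (ModuleCat.{u} A) ℤ) (1 : ℤ)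
  obtain ⟨s, hs₁, hs₂, hs₃⟩ := CoproductTower.exists_next_section Y Φ e
  let α : ∐ Y ⟶ ((tensorC A I).obj (∐ Y))⟦(1 : ℤ)⟧ := CoproductTower.next Y Φ e
  let r : ∐ Y ⟶ Y 0 := CoproductTower.fst Y
  let a := TwistingCochain.ofCocycle (Cocycle.equivHomShift α)
  have ha (n : ℤ) : a.v n (n + 1) rfl = α.f n := equivHomShift_v α n
  let u (n : ℤ) : (∐ Y).X n ⟶ E.viaSect.obj ((E.viaProjC.obj (Y 0)).X n) :=
    r.f n ≫ E.toViaSectViaProj _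
  have h₀ (n : ℤ) : E.mul.app ((E.viaProjC.obj (Y 0)).X n) = 0 := E.mul_app_viaProj _
  let π : E.twist a ⟶ E.viaProjC.obj (Y 0) := E.twistDesc a u fun i j h => by
    rw [h₀, comp_zero, comp_zero, add_zero]
    ext y
    exact congr($(r.comm i j) y)
  have hπ₁ (n : ℤ) (y : (∐ Y).X n) : π.f n (E.twistInl a n y) = r.f n y :=
    congr(($(E.toInduction_extend (u n))).hom y)
  have hπ₂ (n : ℤ) (z) : π.f n (E.twistInr a n z) = 0 := by
    have := E.tensorToInduction_extend (u n)
    rw [h₀, comp_zero] at this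
    exact congr(($this).hom z)
  refine ⟨E.twist a, π, quasiIso_of_surjective _ ?_ ?_, E.projective_twist a hY',
    E.isStrictlyLE_twist a b, ⟨E.twistIso a⟩⟩
  · intro n x
    refine ⟨E.twistInl a n ((Sigma.ι Y 0).f n x), (hπ₁ _ _).trans ?_⟩
    have : Sigma.ι Y 0 ≫ r = 𝟙 _ := by simp [r, CoproductTower.fst]
    exact congr($(this).f n x)
  · rintro m _ _ rfl rfl x hx hdx
    obtain ⟨y, z, rfl⟩ := E.exists_eq_twistInl_add_twistInr a _ x
    have hy : r.f (m + 1) y = 0 := by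
      rw [map_add, hπ₂, add_zero] at hx
      exact (hπ₁ _ _).symm.trans hx
    have hdx' : E.twistInl a _ ((∐ Y).d (m + 1) (m + 1 + 1) y) + E.twistInr a _
        (a.v (m + 1) (m + 1 + 1) rfl y + (tensorI A I).map ((∐ Y).d _ _) z) = 0 := by
      rw [map_add, twist_d_twistInl _ _ _ _ rfl, twist_d_twistInr _ _ _ _ rfl] at hdx
      rw [map_add, ← add_assoc]
      exact hdx
    obtain ⟨h₁, h₂⟩ := E.twistInl_add_twistInr_eq_zero a _ _ _ hdx'
    -- The primitive of the cycle `(y, z)` is the element with no component in `Y 0` that the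
    -- twisting cochain sends to `z`. That its untwisted differential is `y` is checked on the
    -- projections to `Y 0` and to the rest, the latter by comparing the cocycle identity with `h₂`.
    let y' : (∐ Y).X m := s.f m z
    have hry' : r.f m y' = 0 := congr($(hs₂).f m z)
    have hay' : a.v m (m + 1) rfl y' = z := by
      rw [ha]
      exact congr($(hs₁).f m z)
    have hdy' : (∐ Y).d m (m + 1) y' = y := by
      rw [← sub_eq_zero]
      have h₃ : r.f (m + 1) ((∐ Y).d m (m + 1) y' - y) = 0 := by
        rw [map_sub, hy, ← hom_d_apply, hry', map_zero, sub_zero]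
      have h₄ : α.f (m + 1) ((∐ Y).d m (m + 1) y' - y) = 0 := by
        have h₅ : (tensorI A I).map ((∐ Y).d (m + 1) (m + 1 + 1)) (a.v m (m + 1) rfl y') +
            a.v (m + 1) (m + 1 + 1) rfl ((∐ Y).d m (m + 1) y') = 0 :=
          congr($(a.comm m (m + 1) (m + 1 + 1) rfl rfl) y')
        rw [hay'] at h₅
        have h₆ : a.v (m + 1) (m + 1 + 1) rfl ((∐ Y).d m (m + 1) y' - y) = 0 := by
          rw [map_sub, sub_eq_zero]
          exact (eq_neg_of_add_eq_zero_right h₅).trans (eq_neg_of_add_eq_zero_left h₂).symm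
        rw [ha] at h₆
        exact h₆
      have h₇ : (Sigma.ι Y 0).f (m + 1) (r.f (m + 1) ((∐ Y).d m (m + 1) y' - y)) +
          s.f (m + 1) (α.f (m + 1) ((∐ Y).d m (m + 1) y' - y)) = (∐ Y).d m (m + 1) y' - y :=
        congr($(hs₃).f (m + 1) ((∐ Y).d m (m + 1) y' - y))
      rw [← h₇, h₃, h₄, map_zero]
      exact (zero_add _).trans (map_zero (s.f (m + 1)).hom)
    refine ⟨E.twistInl a m y', (hπ₁ _ _).trans hry', ?_⟩
    rw [twist_d_twistInl _ _ _ _ rfl, hay', hdy']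

end SplitSqZeroExtension

/-! ### Cones in the derived category -/

namespace CochainComplex

section

variable {C : Type u} [Category.{v} C] [Abelian C] [HasDerivedCategory.{w} C]

lemma nonempty_Q_mappingCone_iso {S : ShortComplex (CochainComplex C ℤ)} (hS : S.ShortExact)
    {P : CochainComplex C ℤ} (g : P ⟶ S.X₁) [QuasiIso g] :
    Nonempty (DerivedCategory.Q.obj (mappingCone (g ≫ S.f)) ≅ DerivedCategory.Q.obj S.X₃) :=
  have : IsIso (DerivedCategory.Q.map g) := inferInstance
  ⟨Pretriangulated.Triangle.π₃.mapIso (Pretriangulated.isoTriangleOfIso₁₂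
    _ _ (DerivedCategory.mappingCone_triangle_distinguished (g ≫ S.f))
    (DerivedCategory.triangleOfSES_distinguished hS) (@asIso _ _ _ _ (DerivedCategory.Q.map g) this)
    (Iso.refl _) ((Category.comp_id _).trans (Functor.map_comp _ _ _)))⟩

lemma nonempty_Q_mappingCone_iso_biprod {P L : CochainComplex C ℤ} (g : P ⟶ L)
    (hg : DerivedCategory.Q.map g = 0) :
    Nonempty (DerivedCategory.Q.obj (mappingCone g) ≅
      DerivedCategory.Q.obj L ⊞ (DerivedCategory.Q.obj P)⟦(1 : ℤ)⟧) := by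
  -- After one rotation the vanishing morphism is the last one of the triangle, so the triangle
  -- splits.
  have hT := Pretriangulated.rot_of_distTriang _
    (DerivedCategory.mappingCone_triangle_distinguished g)
  obtain ⟨e, -⟩ := Pretriangulated.exists_iso_binaryBiproduct_of_distTriang _ hT (by
    refine (congr_arg (fun h => -h⟦(1 : ℤ)⟧') hg).trans ?_
    rw [Functor.map_zero, neg_zero]
    rfl)
  exact ⟨e⟩

end

end CochainComplex

/-! ### The tower of shifted tensor powers of `I` -/

namespace SplitSqZeroExtension

open CochainComplex ProjectiveModels

section TensorPower

variable (A I : Type u) [CommRing A] [AddCommGroup I] [Module A I]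

/-- `I ⊗ I^{⊗ p} ≃ I^{⊗ (p + 1)}` -/
noncomputable def tensorPowerSucc (p : ℕ) :
    TensorProduct A I (TensorPower A p I) ≃ₗ[A] TensorPower A (p + 1) I :=
  (TensorProduct.congr (PiTensorProduct.subsingletonEquiv (R := A) (s := fun _ : Fin 1 => I)
    0).symm (LinearEquiv.refl A _)).trans
    (TensorPower.mulEquiv.trans (TensorPower.cast A I (add_comm 1 p)))

instance [Module.Projective A I] (p : ℕ) : Module.Projective A (TensorPower A p I) := by
  induction p with
  | zero =>
    exact Module.Projective.of_equiv
      (PiTensorProduct.isEmptyEquiv (R := A) (s := fun _ => I) (Fin 0)).symm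
  | succ p ih => exact Module.Projective.of_equiv (tensorPowerSucc A I p)

/-- `I ⊗ (I^{⊗ p} ⊗ M) ≅ I^{⊗ (p + 1)} ⊗ M` -/
noncomputable def tensorCTensorPower (p : ℕ) (M : CochainComplex (ModuleCat.{u} A) ℤ) :
    (tensorC A I).obj ((tensorC A (TensorPower A p I)).obj M) ≅
      (tensorC A (TensorPower A (p + 1) I)).obj M :=
  (NatIso.mapHomologicalComplex ((MonoidalCategory.tensorLeftTensor _ _).symm ≪≫
    (MonoidalCategory.curriedTensor _).mapIso (tensorPowerSucc A I p).toModuleIso :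
      MonoidalCategory.tensorLeft (ModuleCat.of A (TensorPower A p I)) ⋙ tensorI A I ≅
        tensorI A (TensorPower A (p + 1) I)) (.up ℤ)).app M

/-- `(I^{⊗ p} ⊗ M)[p]` -/
noncomputable abbrev tensorTower (M : CochainComplex (ModuleCat.{u} A) ℤ) (p : ℕ) :
    CochainComplex (ModuleCat.{u} A) ℤ :=
  ((tensorC A (TensorPower A p I)).obj M)⟦(p : ℤ)⟧

/-- `(I^{⊗ 0} ⊗ M)[0] ≅ M` -/
noncomputable def tensorTowerZero (M : CochainComplex (ModuleCat.{u} A) ℤ) :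
    tensorTower A I M 0 ≅ M :=
  (CategoryTheory.shiftFunctorZero' _ ((0 : ℕ) : ℤ) Nat.cast_zero).app _ ≪≫
    (NatIso.mapHomologicalComplex ((MonoidalCategory.curriedTensor _).mapIso
      (PiTensorProduct.isEmptyEquiv (R := A) (s := fun _ => I) (Fin 0)).toModuleIso ≪≫
      MonoidalCategory.leftUnitorNatIso _ :
      tensorI A (TensorPower A 0 I) ≅ 𝟭 (ModuleCat.{u} A)) (.up ℤ)).app M ≪≫
    (Functor.mapHomologicalComplexIdIso _ _).app M

/-- `(I^{⊗ (p + 1)} ⊗ M)[p + 1] ≅ (I ⊗ (I^{⊗ p} ⊗ M)[p])[1]` -/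
noncomputable def tensorTowerSucc (M : CochainComplex (ModuleCat.{u} A) ℤ) (p : ℕ) :
    tensorTower A I M (p + 1) ≅ ((tensorC A I).obj (tensorTower A I M p))⟦(1 : ℤ)⟧ :=
  (CategoryTheory.shiftFunctorAdd' _ (p : ℤ) 1 ((p + 1 : ℕ) : ℤ) (by simp)).app _ ≪≫
    (CategoryTheory.shiftFunctor _ (1 : ℤ)).mapIso
      ((CategoryTheory.shiftFunctor _ (p : ℤ)).mapIso (tensorCTensorPower A I p M).symm ≪≫
        (((tensorC A I).commShiftIso (p : ℤ)).app _).symm)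

variable {A I}

lemma projective_tensorI_obj [Module.Projective A I] (M : ModuleCat.{u} A) [Projective M] :
    Projective ((tensorI A I).obj M) := by
  have : Module.Projective A M := (IsProjective.iff_projective M).2 inferInstance
  exact (IsProjective.iff_projective ((tensorI A I).obj M)).1
    (inferInstanceAs (Module.Projective A (TensorProduct A I M)))

lemma projective_tensorTower_X [Module.Projective A I] (M : CochainComplex (ModuleCat.{u} A) ℤ)
    (hM : ∀ n, Projective (M.X n)) (p : ℕ) (n : ℤ) : Projective ((tensorTower A I M p).X n) :=
  have := hM (n + p)
  projective_tensorI_obj (M.X (n + p))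

lemma isStrictlyLE_tensorTower (M : CochainComplex (ModuleCat.{u} A) ℤ) (b : ℤ)
    [M.IsStrictlyLE b] (p : ℕ) : (tensorTower A I M p).IsStrictlyLE b := by
  rw [isStrictlyLE_iff]
  intro i hi
  exact (tensorI A (TensorPower A p I)).map_isZero
    (M.isZero_of_isStrictlyLE b (i + p) (by omega))

end TensorPower

end SplitSqZeroExtension

/-! ### The kernel of `I ⊗ S̄ → K` as a model of `Tor₁` -/

namespace SplitSqZeroExtension

open CochainComplex ProjectiveModels

variable {k : Type v} {A I B : Type u} [Field k] [CommRing A] [Algebra k A]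
  [AddCommGroup I] [Module A I] [CommRing B] [Algebra k B] (E : SplitSqZeroExtension k A I B)

section

variable {S K : CochainComplex (ModuleCat.{u} B) ℤ} (f : S ⟶ K)

lemma mulKernelι_injective (n : ℤ) : Function.Injective ((E.mulKernelι f).f n) :=
  (ModuleCat.mono_iff_injective _).1
    (inferInstanceAs (Mono ((HomologicalComplex.eval _ _ n).map (E.mulKernelι f))))

/-- Nakayama's lemma for the nilpotent ideal `I`. -/
lemma surjective_of_surjective_baseChangeC
    (hf : ∀ n, Function.Surjective ((E.baseChangeC.map f).f n)) (n : ℤ) :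
    Function.Surjective (f.f n) := by
  intro x
  obtain ⟨s, hs⟩ := hf n (E.bcElt _ x)
  obtain ⟨s, rfl⟩ := E.bcElt_surjective _ s
  obtain ⟨y, hy⟩ := (E.bcElt_eq_zero_iff (x - f.f n s)).1 (by
    rw [map_sub, ← E.bcElt_naturality (f.f n) s]
    exact sub_eq_zero.2 hs.symm)
  obtain ⟨y, rfl⟩ := tensorI_map_surjective (I := I) _ (hf n) y
  refine ⟨s + E.mulElt _ y, ?_⟩
  rw [map_add, E.mulElt_naturality (f.f n) y]
  exact (congr_arg (f.f n s + ·) hy).trans (add_sub_cancel _ _)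

/-- Once the products dying in `K` are divided out, the kernel of the map to `K` is identified with
the acyclic kernel of `f̄`. A primitive in the latter lifts to some `r`, which is corrected by a
product so that `f r = 0`; the remaining error is a product vanishing in `K`, hence zero in the
quotient. -/
lemma quasiIso_quotientDesc (hf : QuasiIso (E.baseChangeC.map f))
    (hf' : ∀ n, Function.Surjective ((E.baseChangeC.map f).f n)) :
    QuasiIso (E.quotientDesc f) := by
  have hq (n : ℤ) (s : S.X n) : (E.quotientDesc f).f n
      ((E.quotientComplexπ S (E.mulKernelι f)).f n s) = f.f n s :=
    congr($(E.quotientComplexπ_quotientDesc f).f n s)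
  have hfa := kernelAcyclic_of_quasiIso _ hf' hf
  refine quasiIso_of_surjective _ (fun n x => ?_) fun m n p hm hp x hx hdx => ?_
  · obtain ⟨s, rfl⟩ := E.surjective_of_surjective_baseChangeC f hf' n x
    exact ⟨_, hq n s⟩
  · obtain ⟨s, rfl⟩ := E.quotientComplexπ_surjective S _ n x
    rw [hq] at hx
    rw [hom_d_apply, quotientComplexπ_eq_zero_iff] at hdx
    obtain ⟨t, ht⟩ := hdx
    obtain ⟨r, hr, hr'⟩ := hfa m n p hm hp (E.bcElt _ s)
      ((E.bcElt_naturality (f.f n) s).trans (by rw [hx, map_zero]; rfl))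
      ((E.bcElt_naturality (S.d n p) s).trans ((E.bcElt_eq_zero_iff _).2 ⟨_, ht⟩))
    obtain ⟨r, rfl⟩ := E.bcElt_surjective _ r
    obtain ⟨z, hz⟩ := (E.bcElt_eq_zero_iff (f.f m r)).1
      ((E.bcElt_naturality (f.f m) r).symm.trans hr)
    obtain ⟨z, rfl⟩ := tensorI_map_surjective (I := I) _ (hf' m) z
    have hz' : f.f m (r - E.mulElt _ z) = 0 := by
      rw [map_sub, E.mulElt_naturality (f.f m) z, sub_eq_zero]
      exact hz.symm
    refine ⟨(E.quotientComplexπ S _).f m (r - E.mulElt _ z), (hq _ _).trans hz', ?_⟩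
    rw [hom_d_apply, ← sub_eq_zero, ← map_sub, quotientComplexπ_eq_zero_iff]
    have hrz : E.bcElt _ (r - E.mulElt _ z) = E.bcElt _ r :=
      (map_sub _ _ _).trans
        ((congr_arg (E.bcElt _ r - ·) (E.bcElt_mulElt z)).trans (sub_zero _))
    obtain ⟨y, hy⟩ := (E.bcElt_eq_zero_iff (S.d m n (r - E.mulElt _ z) - s)).1 (by
      rw [map_sub, sub_eq_zero, ← E.bcElt_naturality (S.d m n), hrz]
      exact hr')
    obtain ⟨y, rfl⟩ := (E.mulKernel_elements f n y).1 (by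
      rw [hy, map_sub, ← hom_d_apply, hz', hx, map_zero, sub_zero])
    exact ⟨y, hy⟩

lemma quotientComplex_shortExact (hS : ∀ n, Projective (S.X n)) :
    (ShortComplex.mk (E.viaProjC.map (E.mulKernelι f) ≫ E.mulBC S)
      (E.quotientComplexπ S (E.mulKernelι f)) (cokernel.condition _)).ShortExact where
  exact := ShortComplex.exact_cokernel _
  mono_f := HomologicalComplex.mono_of_mono_f _ fun n => (ModuleCat.mono_iff_injective _).2
    fun x y h => by
      have := hS n
      exact E.mulKernelι_injective f n (E.mulElt_injective (S.X n) h)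
  epi_g := E.quotientComplexπ_epi S _

/-- The map from the kernel of `I ⊗ (S ⊗_B A) ⟶ K` to `Tor₁^B(K, A)`. -/
noncomputable def mulKernelToTor : E.mulKernel f ⟶ E.tor₁C.obj K :=
  (E.torInclusionC_mulC_exact K).lift (E.mulKernelι f ≫ E.idealTensorC.map f) (by
    have h := (NatTrans.mapHomologicalComplex E.mul (.up ℤ)).naturality f
    have h' := kernel.condition (E.mulC S ≫ E.viaSectC.map f)
    refine (Category.assoc _ _ _).trans ((congr_arg _ h).trans ?_)
    exact h')

lemma torInclusion_mulKernelToTor (n : ℤ) (x : (E.mulKernel f).X n) :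
    E.torInclusion.app _ ((E.mulKernelToTor f).f n x) =
      E.idealTensor.map (f.f n) ((E.mulKernelι f).f n x) := by
  have : E.mulKernelToTor f ≫ E.torInclusionC K = E.mulKernelι f ≫ E.idealTensorC.map f :=
    (E.torInclusionC_mulC_exact K).lift_f _ _
  exact congr($(this).f n x)

lemma mulKernelToTor_surjective (hf' : ∀ n, Function.Surjective ((E.baseChangeC.map f).f n))
    (n : ℤ) : Function.Surjective ((E.mulKernelToTor f).f n) := by
  intro z
  obtain ⟨y, hy⟩ := tensorI_map_surjective (I := I) _ (hf' n) (E.torInclusion.app _ z)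
  obtain ⟨y, rfl⟩ := (E.mulKernel_elements f n y).1 (by
    refine (E.mulElt_naturality (f.f n) y).trans ?_
    exact (E.mulElt_eq_zero_iff _).2 ⟨z, hy.symm⟩)
  exact ⟨y, E.torInclusion_injective _ ((E.torInclusion_mulKernelToTor f n y).trans hy)⟩

/-- `mulKernel` is the preimage of `Tor₁(K)` under `I ⊗ f̄`, so this surjection has the same kernel
as `I ⊗ f̄`, acyclic by flatness. -/
lemma quasiIso_mulKernelToTor [Module.Flat A I] (hf : QuasiIso (E.baseChangeC.map f))
    (hf' : ∀ n, Function.Surjective ((E.baseChangeC.map f).f n)) :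
    QuasiIso (E.mulKernelToTor f) := by
  have hI : ∀ n, Function.Surjective (((tensorC A I).map (E.baseChangeC.map f)).f n) :=
    fun n => tensorI_map_surjective _ (hf' n)
  have hI' := kernelAcyclic_of_quasiIso ((tensorC A I).map (E.baseChangeC.map f)) hI inferInstance
  refine quasiIso_of_surjective _ (E.mulKernelToTor_surjective f hf') fun m n p hm hp x hx hdx => ?_
  obtain ⟨y, hy, hy'⟩ := hI' m n p hm hp ((E.mulKernelι f).f n x)
    ((E.torInclusion_mulKernelToTor f n x).symm.trans
      ((congr_arg (E.torInclusion.app (K.X n)) hx).trans (map_zero _)))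
    ((hom_d_apply (E.mulKernelι f) n p x).trans
      ((congr_arg ((E.mulKernelι f).f p) hdx).trans (map_zero _)))
  obtain ⟨y, rfl⟩ := (E.mulKernel_elements f m y).1 (by
    refine (E.mulElt_naturality (f.f m) y).trans ?_
    exact (congr_arg (E.mulElt (K.X m)) hy).trans (map_zero _))
  refine ⟨y, E.torInclusion_injective _
    ((E.torInclusion_mulKernelToTor f m y).trans (hy.trans (map_zero _).symm)), ?_⟩
  exact E.mulKernelι_injective f n ((hom_d_apply (E.mulKernelι f) m n y).symm.trans hy')

lemma isStrictlyLE_mulKernel (b : ℤ) [S.IsStrictlyLE b] : (E.mulKernel f).IsStrictlyLE b := by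
  rw [isStrictlyLE_iff]
  intro i hi
  have : Mono ((E.mulKernelι f).f i) :=
    inferInstanceAs (Mono ((HomologicalComplex.eval _ _ i).map (E.mulKernelι f)))
  exact IsZero.of_mono ((E.mulKernelι f).f i)
    (E.idealTensor.map_isZero (S.isZero_of_isStrictlyLE b i hi))

end

end SplitSqZeroExtension

/-! ### The decomposition of `K ⊗ᴸ A` -/

namespace SplitSqZeroExtension

open CochainComplex ProjectiveModels

section

variable (A I : Type u) [CommRing A] [AddCommGroup I] [Module A I]
  [HasDerivedCategory.{w} (ModuleCat.{u} A)]

/-- Tensor powers of `I` are projective, hence flat, so each factor map is a quasi-isomorphism; its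
surjectivity is what lets `quasiIso_sigmaMap` pass to the coproduct. -/
lemma nonempty_shift_Q_coproduct_tensorTower_iso [Module.Projective A I]
    {M N : CochainComplex (ModuleCat.{u} A) ℤ} (g : M ⟶ N) [QuasiIso g]
    (hg : ∀ n, Function.Surjective (g.f n)) :
    Nonempty ((DerivedCategory.Q.obj (∐ tensorTower A I M))⟦(1 : ℤ)⟧ ≅
      DerivedCategory.Q.obj
        (∐ fun p : ℕ => ((tensorC A (TensorPower A p I)).obj N)⟦(p : ℤ) + 1⟧)) := by
  let h (p : ℕ) : (tensorTower A I M p)⟦(1 : ℤ)⟧ ⟶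
      ((tensorC A (TensorPower A p I)).obj N)⟦(p : ℤ) + 1⟧ :=
    ((CategoryTheory.shiftFunctorAdd _ (p : ℤ) 1).app _).inv ≫
      ((tensorC A (TensorPower A p I)).map g)⟦(p : ℤ) + 1⟧'
  have hq : QuasiIso (Limits.Sigma.map h) := by
    refine quasiIso_sigmaMap h (fun p n => ?_) fun p => ?_
    · have h₁ : Function.Surjective
          (((CategoryTheory.shiftFunctorAdd _ (p : ℤ) 1).app
            ((tensorC A (TensorPower A p I)).obj M)).inv.f n) :=
        (ModuleCat.epi_iff_surjective _).1 (inferInstanceAs (Epi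
          ((HomologicalComplex.eval _ _ n).map ((CategoryTheory.shiftFunctorAdd _ (p : ℤ) 1).app
            ((tensorC A (TensorPower A p I)).obj M)).inv)))
      exact (tensorI_map_surjective (I := TensorPower A p I) _ (hg (n + (p + 1)))).comp h₁
    · have : QuasiIso ((tensorC A (TensorPower A p I)).map g) := inferInstance
      have : QuasiIso (((tensorC A (TensorPower A p I)).map g)⟦(p : ℤ) + 1⟧') := inferInstance
      exact quasiIso_comp _ _
  exact ⟨((DerivedCategory.Q.commShiftIso (1 : ℤ)).app _).symm ≪≫
    DerivedCategory.Q.mapIso (PreservesCoproduct.iso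
      (CategoryTheory.shiftFunctor (CochainComplex (ModuleCat.{u} A) ℤ) (1 : ℤ)) _) ≪≫
    asIso (DerivedCategory.Q.map (Limits.Sigma.map h))⟩

end

variable {k : Type v} {A I B : Type u} [Field k] [CommRing A] [Algebra k A]
  [AddCommGroup I] [Module A I] [CommRing B] [Algebra k B] (E : SplitSqZeroExtension k A I B)
  [HasDerivedCategory.{w} (ModuleCat.{u} A)] [HasDerivedCategory.{w'} (ModuleCat.{u} B)]

/-- `K` is quasi-isomorphic to `S / mulKernel`, hence to the cone of `u : P → S`. This cone consists
of projectives, so `K ⊗ᴸ A` is the cone of the base change of `u`. -/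
lemma nonempty_derivedBaseChange_iso_biprod (b : ℤ) {S K P : CochainComplex (ModuleCat.{u} B) ℤ}
    (f : S ⟶ K) (hK : boundedAbove (ModuleCat.{u} B) K) (hS : ∀ n, Projective (S.X n))
    [S.IsStrictlyLE b] (hf : QuasiIso (E.baseChangeC.map f))
    (hf' : ∀ n, Function.Surjective ((E.baseChangeC.map f).f n))
    (hP : ∀ n, Projective (P.X n)) [P.IsStrictlyLE b]
    (g : P ⟶ E.viaProjC.obj (E.mulKernel f)) [QuasiIso g] :
    Nonempty (E.derivedBaseChange.obj (toMinus K hK) ≅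
      DerivedCategory.Q.obj (E.baseChangeC.obj K) ⊞
        (DerivedCategory.Q.obj (E.baseChangeC.obj P))⟦(1 : ℤ)⟧) := by
  have := E.quasiIso_quotientDesc f hf hf'
  let u : P ⟶ S := g ≫ E.viaProjC.map (E.mulKernelι f) ≫ E.mulBC S
  obtain ⟨e₁⟩ := nonempty_Q_mappingCone_iso (E.quotientComplex_shortExact f hS) g
  let e₂ : (toMinus K hK).obj ≅ DerivedCategory.Q.obj (mappingCone u) :=
    (asIso (DerivedCategory.Q.map (E.quotientDesc f))).symm ≪≫ e₁.symm
  obtain ⟨e₃⟩ := nonempty_leftDerivedMinus_obj_iso E.baseChange (toMinus K hK)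
    ⟨b, isStrictlyLE_mappingCone u b⟩ (projective_mappingCone_X u hP hS) e₂
  have hfi : IsIso (DerivedCategory.Q.map (E.baseChangeC.map f)) := inferInstance
  have huf : u ≫ f = 0 :=
    (Category.assoc _ _ _).trans ((congr_arg (g ≫ ·) (E.mulKernel_condition f)).trans comp_zero)
  -- This is where the splitting comes from: `u` dies in `K`, and `S̄ → K̄` is invertible in `D(A)`.
  have hu : DerivedCategory.Q.map (E.baseChangeC.map u) = 0 := by
    rw [← cancel_mono (DerivedCategory.Q.map (E.baseChangeC.map f)), ← Functor.map_comp,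
      ← Functor.map_comp, huf, Functor.map_zero, Functor.map_zero, zero_comp]
  obtain ⟨e₄⟩ := nonempty_Q_mappingCone_iso_biprod _ hu
  exact ⟨e₃ ≪≫ DerivedCategory.Q.mapIso (mappingCone.mapHomologicalComplexIso u E.baseChange) ≪≫
    e₄ ≪≫ biprod.mapIso (asIso (DerivedCategory.Q.map (E.baseChangeC.map f))) (Iso.refl _)⟩

/-- One complex `P` plays both roles: it resolves `mulKernel`, hence also `Tor₁(K)` over `B`, which
gives the first form, and its base change is an explicit coproduct, which gives the second. -/
lemma nonempty_decomposition [Module.Projective A I] {b : ℤ}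
    (K : CochainComplex (ModuleCat.{u} B) ℤ) (hK : boundedLE (ModuleCat.{u} B) b K)
    (h : E.hkrClass K = 0) :
    Nonempty (E.derivedBaseChange.obj (toMinus K hK.boundedAbove) ≅
      DerivedCategory.Q.obj (E.baseChangeC.obj K) ⊞
        (E.derivedBaseChange.obj (toMinus (E.viaProjC.obj (E.tor₁C.obj K))
          (E.tor₁C_boundedAbove K hK.boundedAbove)))⟦(1 : ℤ)⟧) ∧
    Nonempty (E.derivedBaseChange.obj (toMinus K hK.boundedAbove) ≅
      DerivedCategory.Q.obj (E.baseChangeC.obj K) ⊞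
        DerivedCategory.Q.obj (∐ fun p : ℕ => (E.tensorPowerTor K p)⟦(p : ℤ) + 1⟧)) := by
  have : K.IsStrictlyLE b := hK.1
  obtain ⟨S, f, hS, hSb, hf, hf'⟩ := E.exists_projective_of_hkrClass_eq_zero K b h
  have := E.isStrictlyLE_mulKernel f b
  obtain ⟨M, μ, hμ, hM, hMb, hμ'⟩ := exists_projective_surjective (E.mulKernel f) b
  obtain ⟨P, π, hπ, hP, hPb, ⟨ψ⟩⟩ := E.exists_projective_viaProj (tensorTower A I M)
    (tensorTowerSucc A I M) b (projective_tensorTower_X M hM) (isStrictlyLE_tensorTower M b)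
  have : QuasiIso ((tensorTowerZero A I M).hom ≫ μ) := quasiIso_comp _ _
  have : QuasiIso (E.viaProjC.map ((tensorTowerZero A I M).hom ≫ μ)) := inferInstance
  have := E.quasiIso_mulKernelToTor f hf hf'
  have : QuasiIso (E.viaProjC.map (E.mulKernelToTor f)) := inferInstance
  let g : P ⟶ E.viaProjC.obj (E.mulKernel f) :=
    π ≫ E.viaProjC.map ((tensorTowerZero A I M).hom ≫ μ)
  have : QuasiIso g := quasiIso_comp _ _
  have : QuasiIso (g ≫ E.viaProjC.map (E.mulKernelToTor f)) := quasiIso_comp _ _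
  obtain ⟨e⟩ := E.nonempty_derivedBaseChange_iso_biprod b f hK.boundedAbove hS hf hf' hP g
  obtain ⟨e'⟩ := nonempty_leftDerivedMinus_obj_iso E.baseChange
    (toMinus (E.viaProjC.obj (E.tor₁C.obj K)) (E.tor₁C_boundedAbove K hK.boundedAbove))
    ⟨b, hPb⟩ hP (asIso (DerivedCategory.Q.map (g ≫ E.viaProjC.map (E.mulKernelToTor f)))).symm
  have : QuasiIso (μ ≫ E.mulKernelToTor f) := quasiIso_comp _ _
  obtain ⟨e''⟩ := nonempty_shift_Q_coproduct_tensorTower_iso A I (μ ≫ E.mulKernelToTor f)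
    fun n => (E.mulKernelToTor_surjective f hf' n).comp (hμ' n)
  exact ⟨⟨e ≪≫ biprod.mapIso (Iso.refl _)
      ((CategoryTheory.shiftFunctor _ (1 : ℤ)).mapIso e'.symm)⟩,
    ⟨e ≪≫ biprod.mapIso (Iso.refl _) ((CategoryTheory.shiftFunctor _ (1 : ℤ)).mapIso
      (DerivedCategory.Q.mapIso ψ.symm) ≪≫ e'')⟩⟩

end SplitSqZeroExtension

/-! ### The theorem -/

theorem theorem4p17 {k : Type v} {A I B : Type u} [Field k] [CharZero k]
    [CommRing A] [Algebra k A] [AddCommGroup I] [Module A I] [Module.Free A I] [Module.Finite A I]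
    [CommRing B] [Algebra k B] (E : SplitSqZeroExtension k A I B)
    [HasDerivedCategory.{w} (ModuleCat.{u} A)] [HasDerivedCategory.{w'} (ModuleCat.{u} B)]
    (b : ℤ) (K : CochainComplex (ModuleCat.{u} B) ℤ) (hK : ProjectiveModels.boundedLE (ModuleCat.{u} B) b K) :
    List.TFAE
      [ E.hkrClass K = 0,
        ∃ s : DerivedCategory.Q.obj (E.baseChangeC.obj K) ⟶
            E.derivedBaseChange.obj (ProjectiveModels.toMinus K hK.boundedAbove),
          s ≫ E.derivedToBaseChange K hK.boundedAbove = 𝟙 _,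
        ∃ (V : CochainComplex (ModuleCat.{u} B) ℤ) (hV : ProjectiveModels.boundedLE (ModuleCat.{u} B) b V),
          E.Admissible V ∧
          ∃ φ : ProjectiveModels.toMinus V hV.boundedAbove ⟶
              ProjectiveModels.toMinus K hK.boundedAbove,
            IsIso (E.derivedBaseChange.map φ ≫ E.derivedToBaseChange K hK.boundedAbove),
        ∃ (V : CochainComplex (ModuleCat.{u} B) ℤ) (hV : ProjectiveModels.boundedLE (ModuleCat.{u} B) b V),
          E.Admissible V ∧
          ∃ φ : E.toDerivedAdm V hV.boundedAbove ⟶ E.toDerivedAdm K hK.boundedAbove,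
            IsIso (E.baseChangeAdm.map φ),
        ∃ (V : CochainComplex (ModuleCat.{u} B) ℤ) (hV : ProjectiveModels.boundedLE (ModuleCat.{u} B) b V),
          E.Admissible V ∧
          ∃ (T : CochainComplex (ModuleCat.{u} A) ℤ) (t : T ⟶ E.idealTensorC.obj V),
            Mono t ∧
            Nonempty (E.toDerivedAdm K hK.boundedAbove ≅ E.toDerivedAdm (E.quotientComplex V t)
              (E.quotientComplex_boundedAbove V t hV.boundedAbove)) ] ∧
    (E.hkrClass K = 0 →
      Nonempty (E.derivedBaseChange.obj (ProjectiveModels.toMinus K hK.boundedAbove) ≅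
        DerivedCategory.Q.obj (E.baseChangeC.obj K) ⊞
          (E.derivedBaseChange.obj (ProjectiveModels.toMinus (E.viaProjC.obj (E.tor₁C.obj K))
            (E.tor₁C_boundedAbove K hK.boundedAbove)))⟦(1 : ℤ)⟧) ∧
      Nonempty (E.derivedBaseChange.obj (ProjectiveModels.toMinus K hK.boundedAbove) ≅
        DerivedCategory.Q.obj (E.baseChangeC.obj K) ⊞
          DerivedCategory.Q.obj (∐ fun p : ℕ => (E.tensorPowerTor K p)⟦(p : ℤ) + 1⟧))) := by
  refine ⟨?_, E.nonempty_decomposition K hK⟩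
  -- Two cycles through (i) suffice: (i) ⇒ (iii) ⇒ (ii) ⇒ (i) and (i) ⇒ (v) ⇒ (iv) ⇒ (i), both
  -- leaving (i) through the same construction of an admissible complex.
  tfae_have 3 → 2
  | ⟨V, hV, _, φ, hφ⟩ => E.exists_section_of_isIso hV.boundedAbove hK.boundedAbove φ hφ
  tfae_have 2 → 1
  | ⟨s, hs⟩ => E.hkrClass_eq_zero_of_section K hK.boundedAbove s hs
  tfae_have 4 → 1
  | ⟨V, hV, hV', φ, hφ⟩ =>
    E.hkrClass_eq_zero_of_adm hV.boundedAbove hK.boundedAbove hV' φ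
  tfae_have 5 → 4
  | ⟨V, hV, hV', T, t, _, ⟨e⟩⟩ =>
    ⟨V, hV, hV', E.exists_adm_of_iso_quotientComplex t hV.boundedAbove hK.boundedAbove e⟩
  tfae_have 1 → 3 := fun h => by
    obtain ⟨S, V, p, g, hSb, hS, hV, hVa, hp, hp', hg, hg'⟩ :=
      E.exists_admissible_of_hkrClass_eq_zero hK h
    exact ⟨V, hV, hVa, ProjectiveModels.toMinusMap g hV.boundedAbove hK.boundedAbove,
      E.isIso_derivedBaseChange_map_comp p g hSb hS hV.boundedAbove hK.boundedAbove hp hp' hg⟩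
  tfae_have 1 → 5 := fun h => by
    obtain ⟨S, V, p, g, hSb, hS, hV, hVa, hp, hp', hg, hg'⟩ :=
      E.exists_admissible_of_hkrClass_eq_zero hK h
    exact ⟨V, hV, hVa, E.mulKernel g, E.mulKernelι g, inferInstance,
      E.nonempty_toDerivedAdm_iso_quotientComplex g hV.boundedAbove hK.boundedAbove hg hg'⟩
  tfae_finish
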